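/- \textbf{Setting.} Functions on $\mathbb{T}^2=[0,2\pi)^2$ are functions of $(x,y)$ that are $2\pi$-periodic in both variables; $\langle f\rangle=\frac1{4\pi^2}\int_{\mathbb{T}^2}f$. Fix $\lambda>-1/2$. Consider an in-plane velocity $\mathbf u=(u_x,u_y)$, a stretching rate $\gamma$ and an out-of-plane vorticity $\omega$ on $\mathbb{T}^2\times[0,T)$ with $$\nabla\cdot\mathbf u=-\gamma,\qquad \partial_xu_y-\partial_yu_x=\omega,$$ $$\partial_t\omega+\mathbf u\cdot\nabla\omega=\gamma\,\omega,\qquad \partial_t\gamma+\mathbf u\cdot\nabla\gamma=2\langle\gamma^2\rangle-\gamma^2+\lambda\left(\langle\gamma^2\rangle-\gamma^2\right),$$ $\gamma(\cdot,0)=\gamma_0$, $\omega(\cdot,0)=\omega_0$. A pathline is a curve with $\dot{\mathbf X}(t)=\mathbf u(\mathbf X(t),t)$ on $[0,T)$. A solution on $[0,T)$ is either a classical one ($\mathbf u,\gamma,\omega$ of class $C^1$ on $\mathbb{T}^2\times[0,T)$ satisfying these equations for $0<t<T$), or, so as to allow bounded and possibly discontinuous data, a generalized one: $\mathbf u$ is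 continuous; $\gamma(\cdot,t),\omega(\cdot,t)$ are bounded and measurable; the first two equations hold in the sense of distributions; a pathline starts at every point at $t=0$, and at every time $t\in[0,T)$ every point lies on a pathline started at $t=0$; and along every pathline with $\mathbf X(0)=\mathbf X_0$, for $0<t<T$, $$\gamma(\mathbf X(t),t)=\frac{\dot S(t)\gamma_0(\mathbf X_0)}{1+(\lambda+1)\gamma_0(\mathbf X_0)S(t)}-\frac{\ddot S(t)}{2(\lambda+1)\dot S(t)},\qquad \omega(\mathbf X(t),t)=\omega_0(\mathbf X_0)\left[\frac{1+(\lambda+1)\gamma_0(\mathbf X_0)S(t)}{\dot S(t)^{1/2}}\right]^{\frac1{\lambda+1}},$$ where $S$ is the solution on $[0,T)$, with values below $S_*:=\frac{1}{-(\lambda+1)\inf\gamma_0}$ and $S(t)\to S_*$ as $t\to T$, of $$\dot S=\left\langle[1+(\lambda+1)\gamma_0S]^{-\frac1{\lambda+1}}\right\rangle^{-2(\lambda+1)},\qquad S(0)=0.$$ \textbf{Theorem.} Let $\lambda>-1/2$. Let $\gamma_0$ be measurable, nonzero, bounded, of zero mean on $\mathbb{T}^2$ and of generic type: it attains its infimum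 $\gamma_-$ at a single point $\mathbf X_-\in\mathbb{T}^2$ and its supremum at a single point $\mathbf X_+\in\mathbb{T}^2$, it is twice differentiable at both points, and $D^2\gamma_0$ is positive definite at $\mathbf X_-$ and negative definite at $\mathbf X_+$. Assume moreover that $\inf_{\mathbb{T}^2\setminus U}\gamma_0>\gamma_-$ for every neighbourhood $U$ of $\mathbf X_-$ (automatic if $\gamma_0$ is continuous). Put $\Delta=\det D^2\gamma_0(\mathbf X_-)$ and $M=\left\langle(\gamma_0+|\gamma_-|)^{-\frac1{\lambda+1}}\right\rangle$. Let $W_{-1}$ be the Lambert branch $w\mathrm e^{w}=z$, $w\le-1$, $-1/\mathrm e\le z<0$. There is exactly one finite singularity time $T_*\in(0,\infty)$, that is, a time $T_*$ such that the equation for $S$ above has a solution on $[0,T_*)$ with $S(t)<S_*$ there and $S(t)\to S_*$ as $t\to T_*$. If $\lambda>0$, the average defining $M$ is finite. Let $(\mathbf u,\gamma,\omega)$ be any solution on $[0,T_*)$ with initial data $\gamma_0,\omega_0$, and write $w(t)=\left|W_{-1}\left(-\pi\sqrt{S_*\Delta}\,(T_*-t)^{1/2}\right)\right|$. As $t\to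 T_*^-$ (with $f\sim g$ meaning $f-g=o(g)$): (i) Along a pathline with $\mathbf X(0)=\mathbf X_-$ the infimum $\inf_{\mathbb{T}^2}\gamma(\cdot,t)$ is attained for all $t\in[0,T_*)$, and $$\gamma(\mathbf X(t),t),\ \inf_{\mathbb{T}^2}\gamma(\cdot,t)\ \sim\ \begin{cases}-\frac1{2\lambda+1}(T_*-t)^{-1},&-\frac12<\lambda\le0,\\-\frac1{\lambda+1}(T_*-t)^{-1},&\lambda>0.\end{cases}$$ (ii) Along a pathline with $\mathbf X(0)=\mathbf X_+$ the supremum $\sup_{\mathbb{T}^2}\gamma(\cdot,t)$ is attained for all $t\in[0,T_*)$, and $$\gamma(\mathbf X(t),t),\ \sup_{\mathbb{T}^2}\gamma(\cdot,t)\ \sim\ \begin{cases}\frac{|\lambda|}{(\lambda+1)(2\lambda+1)}(T_*-t)^{-1},&-\frac12<\lambda<0,\\[2pt]\frac1{2w(t)}(T_*-t)^{-1},&\lambda=0,\\[2pt]\frac{(\lambda+1)^{\lambda/(\lambda+1)}}{2\pi\sqrt\Delta\,M^{2\lambda+1}}(T_*-t)^{-\frac1{\lambda+1}},&\lambda>0.\end{cases}$$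 (iii) Along every pathline starting at neither $\mathbf X_-$ nor $\mathbf X_+$, $\gamma(\mathbf X(t),t)$ has the same asymptotics as in (ii). (iv) Along a pathline with $\mathbf X(0)=\mathbf X_-$, $\omega(\mathbf X(t),t)\to0$ and $$\omega(\mathbf X(t),t)\sim\omega_0(\mathbf X_-)\times\begin{cases}\left(2\pi|\lambda|(2\lambda+1)\sqrt\Delta\right)^{\frac1{2\lambda+1}}(T_*-t)^{\frac1{2\lambda+1}},&-\frac12<\lambda<0,\\[2pt]\frac{\pi\sqrt\Delta}{w(t)}(T_*-t),&\lambda=0,\\[2pt]\frac{(\lambda+1)^{1/(\lambda+1)}}{M}(T_*-t)^{\frac1{\lambda+1}},&\lambda>0.\end{cases}$$ Along every pathline starting at $\mathbf X_0\ne\mathbf X_-$: if $\lambda>0$, $\omega(\mathbf X(t),t)$ is bounded on $[0,T_*)$; if $-\frac12<\lambda\le0$, $$\omega(\mathbf X(t),t)\sim\omega_0(\mathbf X_0)\times\begin{cases}\frac{\left((\lambda+1)(2\lambda+1)(|\gamma_-|+\gamma_0(\mathbf X_0))\right)^{\frac1{\lambda+1}}}{\left(2\pi|\lambda|(2\lambda+1)\sqrt\Delta\right)^{\frac1{2\lambda+1}}}(T_*-t)^{-\frac{|\lambda|}{(\lambda+1)(2\lambda+1)}},&-\frac12<\lambda<0,\\[2pt]\frac{|\gamma_-|+\gamma_0(\mathbf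 X_0)}{\pi\sqrt\Delta}\,w(t),&\lambda=0,\end{cases}$$ and $|\omega(\mathbf X(t),t)|\to\infty$ if $\omega_0(\mathbf X_0)\ne0$. (When $\omega_0$ vanishes at the starting point, $f\sim0$ means that $\omega$ vanishes along the pathline for $t$ near $T_*$.) -/

import Mathlib

open Set Filter Topology MeasureTheory

noncomputable section

namespace Stagnation

/-! The plane `ℝ × ℝ` carries coordinates `(x, y)`; functions on the torus `𝕋² = [0, 2π)²` are
functions on the plane that are `2π`-periodic in both coordinates. -/

/-- Two points of the plane represent the same point of the torus. -/
def SamePoint (p q : ℝ × ℝ) : Prop :=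
  ∃ m n : ℤ, q = (p.1 + m * (2 * Real.pi), p.2 + n * (2 * Real.pi))

/-- `2π`-periodicity in both coordinates. -/
def TorusPeriodic {E : Type*} (f : ℝ × ℝ → E) : Prop :=
  ∀ p q, SamePoint p q → f q = f p

/-- The fundamental cell `[0, 2π)²`. -/
def cell : Set (ℝ × ℝ) := Ico 0 (2 * Real.pi) ×ˢ Ico 0 (2 * Real.pi)

/-- The average `⟨f⟩` over the torus. -/
def torusAvg (f : ℝ × ℝ → ℝ) : ℝ := (4 * Real.pi ^ 2)⁻¹ * ∫ p in cell, f p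

/-- Partial derivative in `x`. -/
def dx (f : ℝ × ℝ → ℝ) (p : ℝ × ℝ) : ℝ := fderiv ℝ f p (1, 0)

/-- Partial derivative in `y`. -/
def dy (f : ℝ × ℝ → ℝ) (p : ℝ × ℝ) : ℝ := fderiv ℝ f p (0, 1)

/-- `f` is twice (Fréchet) differentiable at `p`. -/
def TwiceDifferentiableAt (f : ℝ × ℝ → ℝ) (p : ℝ × ℝ) : Prop :=
  (∀ᶠ q in 𝓝 p, DifferentiableAt ℝ f q) ∧ DifferentiableAt ℝ (fderiv ℝ f) p

/-- The matrix `D² f (p)` of second derivatives. -/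
def hessian (f : ℝ × ℝ → ℝ) (p : ℝ × ℝ) : Matrix (Fin 2) (Fin 2) ℝ :=
  !![fderiv ℝ (fderiv ℝ f) p (1, 0) (1, 0), fderiv ℝ (fderiv ℝ f) p (1, 0) (0, 1);
     fderiv ℝ (fderiv ℝ f) p (0, 1) (1, 0), fderiv ℝ (fderiv ℝ f) p (0, 1) (0, 1)]

/-- A nonzero, bounded, zero-mean (measurable) function on the torus. -/
structure IsInitialStretching (f : ℝ × ℝ → ℝ) : Prop where
  periodic : TorusPeriodic f
  measurable : AEMeasurable f volume
  nonzero : f ≠ 0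
  bounded : ∃ C, ∀ p, |f p| ≤ C
  mean_zero : torusAvg f = 0

/-- `f` is of generic type: its infimum is attained at the single torus point `pmin`, its supremum
at the single torus point `pmax`, and the matrix of second derivatives is positive definite at
`pmin` and negative definite at `pmax`. -/
structure IsGenericType (f : ℝ × ℝ → ℝ) (pmin pmax : ℝ × ℝ) : Prop where
  min_le : ∀ q, f pmin ≤ f q
  min_unique : ∀ q, f q = f pmin → SamePoint pmin q
  le_max : ∀ q, f q ≤ f pmax
  max_unique : ∀ q, f q = f pmax → SamePoint pmax q
  twice_min : TwiceDifferentiableAt f pmin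
  twice_max : TwiceDifferentiableAt f pmax
  hessian_min : (hessian f pmin).PosDef
  hessian_max : (-(hessian f pmax)).PosDef

/-- The minimum is well separated: `f` comes close to its minimal value only near `pmin` on the
torus. This is automatic for a continuous periodic `f` with a single minimum point. -/
def WellSeparatedMin (f : ℝ × ℝ → ℝ) (pmin : ℝ × ℝ) : Prop :=
  ∀ r > 0, ∃ ε > 0, ∀ q, f q < f pmin + ε → ∃ q', SamePoint q q' ∧ dist q' pmin < r

/-! ### The system for the in-plane velocity `u`, the stretching rate `γ`, the vorticity `ω` -/

/-- `X` is a pathline of the in-plane velocity `u` on `[0, T)` starting at `x₀`. -/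
structure IsPathline (T : ℝ) (u : ℝ → ℝ × ℝ → ℝ × ℝ) (x₀ : ℝ × ℝ) (X : ℝ → ℝ × ℝ) : Prop where
  start : X 0 = x₀
  ode : ∀ t ∈ Ico 0 T, HasDerivWithinAt X (u t (X t)) (Ico 0 T) t

/-- Classical (`C¹`) solutions on `[0, T)`. -/
structure IsClassicalSolution (lam T : ℝ) (γ₀ ω₀ : ℝ × ℝ → ℝ)
    (u : ℝ → ℝ × ℝ → ℝ × ℝ) (γ ω : ℝ → ℝ × ℝ → ℝ) : Prop where
  init_γ : γ 0 = γ₀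
  init_ω : ω 0 = ω₀
  periodic_u : ∀ t ∈ Ico 0 T, TorusPeriodic (u t)
  periodic_γ : ∀ t ∈ Ico 0 T, TorusPeriodic (γ t)
  periodic_ω : ∀ t ∈ Ico 0 T, TorusPeriodic (ω t)
  smooth_u : ContDiffOn ℝ 1 (fun z : ℝ × (ℝ × ℝ) => u z.1 z.2) (Ico 0 T ×ˢ univ)
  smooth_γ : ContDiffOn ℝ 1 (fun z : ℝ × (ℝ × ℝ) => γ z.1 z.2) (Ico 0 T ×ˢ univ)
  smooth_ω : ContDiffOn ℝ 1 (fun z : ℝ × (ℝ × ℝ) => ω z.1 z.2) (Ico 0 T ×ˢ univ)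
  div_eq : ∀ t ∈ Ioo 0 T, ∀ p,
    dx (fun q => (u t q).1) p + dy (fun q => (u t q).2) p = -γ t p
  curl_eq : ∀ t ∈ Ioo 0 T, ∀ p,
    dx (fun q => (u t q).2) p - dy (fun q => (u t q).1) p = ω t p
  ω_eq : ∀ t ∈ Ioo 0 T, ∀ p,
    deriv (fun s => ω s p) t + ((u t p).1 * dx (ω t) p + (u t p).2 * dy (ω t) p)
      = γ t p * ω t p
  γ_eq : ∀ t ∈ Ioo 0 T, ∀ p,
    deriv (fun s => γ s p) t + ((u t p).1 * dx (γ t) p + (u t p).2 * dy (γ t) p)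
      = 2 * torusAvg (fun q => γ t q ^ 2) - γ t p ^ 2
        + lam * (torusAvg (fun q => γ t q ^ 2) - γ t p ^ 2)

/-- Right-hand side of the scalar equation `S' = ⟨(1 + (λ+1) γ₀ S)^(-1/(λ+1))⟩^(-2(λ+1))`. -/
def sRate (lam : ℝ) (γ₀ : ℝ × ℝ → ℝ) (s : ℝ) : ℝ :=
  torusAvg (fun p => (1 + (lam + 1) * γ₀ p * s) ^ (-(1 / (lam + 1)))) ^ (-(2 * (lam + 1)))

/-- The critical value `S_* = -1 / ((λ+1) inf γ₀)` (for `λ > -1`). -/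
def sStar (lam : ℝ) (γ₀ : ℝ × ℝ → ℝ) : ℝ := 1 / (-(lam + 1) * ⨅ p, γ₀ p)

/-- `S` solves the scalar equation on `[0, T)` with `S(0) = 0`, and `T` is the first time at which
`S` reaches `S_*`. -/
structure IsSolutionUpTo (lam : ℝ) (γ₀ : ℝ × ℝ → ℝ) (T : ℝ) (S : ℝ → ℝ) : Prop where
  pos : 0 < T
  zero : S 0 = 0
  ode : ∀ t ∈ Ico 0 T, HasDerivWithinAt S (sRate lam γ₀ (S t)) (Ico 0 T) t
  before : ∀ t ∈ Ico 0 T, S t < sStar lam γ₀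
  reach : Tendsto S (𝓝[<] T) (𝓝 (sStar lam γ₀))

/-- `T` is the (finite) singularity time `T_*`, the first time with `S(T_*) = S_*`. -/
def IsSingularityTime (lam : ℝ) (γ₀ : ℝ × ℝ → ℝ) (T : ℝ) : Prop :=
  ∃ S, IsSolutionUpTo lam γ₀ T S

/-- Generalized solutions on `[0, T)` for bounded, not necessarily continuous data: the velocity is
continuous and satisfies the divergence and curl equations in the sense of distributions, pathlines
start at every point and fill the torus at all times, and the fields are carried by the pathlines
according to the solution formulae in terms of `S`. -/
structure IsGeneralizedSolution (lam T : ℝ) (γ₀ ω₀ : ℝ × ℝ → ℝ)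
    (u : ℝ → ℝ × ℝ → ℝ × ℝ) (γ ω : ℝ → ℝ × ℝ → ℝ) : Prop where
  init_γ : γ 0 = γ₀
  init_ω : ω 0 = ω₀
  periodic_u : ∀ t ∈ Ico 0 T, TorusPeriodic (u t)
  periodic_γ : ∀ t ∈ Ico 0 T, TorusPeriodic (γ t)
  periodic_ω : ∀ t ∈ Ico 0 T, TorusPeriodic (ω t)
  continuous_u : ContinuousOn (fun z : ℝ × (ℝ × ℝ) => u z.1 z.2) (Ico 0 T ×ˢ univ)
  measurable_γ : ∀ t ∈ Ico 0 T, AEMeasurable (γ t) volume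
  measurable_ω : ∀ t ∈ Ico 0 T, AEMeasurable (ω t) volume
  bounded_γ : ∀ t ∈ Ico 0 T, ∃ C, ∀ p, |γ t p| ≤ C
  bounded_ω : ∀ t ∈ Ico 0 T, ∃ C, ∀ p, |ω t p| ≤ C
  div_eq : ∀ t ∈ Ico 0 T, ∀ φ : ℝ × ℝ → ℝ, ContDiff ℝ (⊤ : ℕ∞) φ → TorusPeriodic φ →
    torusAvg (fun p => (u t p).1 * dx φ p + (u t p).2 * dy φ p) = torusAvg (fun p => γ t p * φ p)
  curl_eq : ∀ t ∈ Ico 0 T, ∀ φ : ℝ × ℝ → ℝ, ContDiff ℝ (⊤ : ℕ∞) φ → TorusPeriodic φ →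
    torusAvg (fun p => (u t p).1 * dy φ p - (u t p).2 * dx φ p) = torusAvg (fun p => ω t p * φ p)
  exists_pathline : ∀ x₀, ∃ X, IsPathline T u x₀ X
  pathlines_fill : ∀ t ∈ Ico 0 T, ∀ p, ∃ x₀ X, IsPathline T u x₀ X ∧ X t = p
  along : ∃ S, IsSolutionUpTo lam γ₀ T S ∧ ∀ x₀ X, IsPathline T u x₀ X → ∀ t ∈ Ioo 0 T,
    γ t (X t) = deriv S t * γ₀ x₀ / (1 + (lam + 1) * γ₀ x₀ * S t)
        - 1 / (2 * (lam + 1)) * (deriv (deriv S) t / deriv S t) ∧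
    ω t (X t) = ω₀ x₀ *
        ((1 + (lam + 1) * γ₀ x₀ * S t) / deriv S t ^ (1 / 2 : ℝ)) ^ (1 / (lam + 1))

/-! ### The asymptotic rates -/

/-- The branch `W₋₁` of the Lambert function: the inverse of `w ↦ w eʷ` on `(-∞, -1]`, defined for
arguments in `[-1/e, 0)`. -/
def lambertWm1 (z : ℝ) : ℝ := Function.invFunOn (fun w : ℝ => w * Real.exp w) (Iic (-1)) z

/-- `|W₋₁(-π √(S_* Δ) (T - t)^(1/2))|` -/
def absW (S Δ T t : ℝ) : ℝ :=
  |lambertWm1 (-Real.pi * Real.sqrt (S * Δ) * (T - t) ^ (1 / 2 : ℝ))|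

/-- Rate of the infimum of `γ`. -/
def infRate (lam T t : ℝ) : ℝ :=
  if lam ≤ 0 then -(1 / (2 * lam + 1)) * (T - t)⁻¹ else -(1 / (lam + 1)) * (T - t)⁻¹

/-- Rate of the supremum of `γ`; `M` stands for `⟨(γ₀ + |γ₋|)^(-1/(λ+1))⟩`. -/
def supRate (lam S Δ M T t : ℝ) : ℝ :=
  if lam < 0 then |lam| / ((lam + 1) * (2 * lam + 1)) * (T - t)⁻¹
  else if lam = 0 then 1 / (2 * absW S Δ T t) * (T - t)⁻¹
  else (lam + 1) ^ (lam / (lam + 1)) / (2 * Real.pi * Real.sqrt Δ * M ^ (2 * lam + 1))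
    * (T - t) ^ (-(1 / (lam + 1)))

/-- Rate of `ω / ω₀` along the pathline from the minimum. -/
def vortMinRate (lam S Δ M T t : ℝ) : ℝ :=
  if lam < 0 then
    (2 * Real.pi * |lam| * (2 * lam + 1) * Real.sqrt Δ) ^ (1 / (2 * lam + 1))
      * (T - t) ^ (1 / (2 * lam + 1))
  else if lam = 0 then Real.pi * Real.sqrt Δ / absW S Δ T t * (T - t)
  else (lam + 1) ^ (1 / (lam + 1)) / M * (T - t) ^ (1 / (lam + 1))

/-- Rate of `ω / ω₀` (for `λ ≤ 0`) along a pathline from a point where `γ₀` exceeds its minimum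
by `h`. -/
def vortOtherRate (lam S Δ h T t : ℝ) : ℝ :=
  if lam < 0 then
    ((lam + 1) * (2 * lam + 1) * h) ^ (1 / (lam + 1))
      / (2 * Real.pi * |lam| * (2 * lam + 1) * Real.sqrt Δ) ^ (1 / (2 * lam + 1))
      * (T - t) ^ (-(|lam| / ((lam + 1) * (2 * lam + 1))))
  else h / (Real.pi * Real.sqrt Δ) * absW S Δ T t

end Stagnation

end

/-! Put m = |γ₋|, h = γ₀ + m and δ = 1/((λ+1)S) - m (`gap`). Then 1 + (λ+1)γ₀S = (λ+1)S(h + δ), so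
with K(δ) = ⟨(h+δ)^(-1/(λ+1))⟩ the equation for S becomes autonomous, δ' = -(λ+1) K^(-2(λ+1)), and
the singularity is δ = 0. With L(δ) = ⟨(h+δ)^(-1/(λ+1)-1)⟩, the fields on the pathline from
elevation x = h(X₀) are γ = K^(-2(λ+1)) (L/K - 1/(x+δ)) and ω = ω₀ (x+δ)^(1/(λ+1)) K (`stretchVal`,
`vortVal`). The former increases with x, so the extrema stay on the pathlines from the extremal
points.

Everything then rests on averages of negative powers near a nondegenerate minimum in the plane. The
substitution v = √δ z and dominated convergence give ⟨(h+δ)^(-r)⟩ ~ δ^(1-r)/(2π(r-1)√Δ) for r > 1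
(`tendsto_rpow_mul_powAvg`). Integrating in δ yields log(1/δ)/(2π√Δ) at r = 1 and a finite limit for
r < 1. For K the exponent is r = 1/(λ+1), so the three cases are λ < 0, λ = 0 and λ > 0; L is always
supercritical. For λ < 0 the reciprocal speed K^(2(λ+1))/(λ+1) behaves like δ^(2λ), integrable
because λ > -1/2, so the singularity time is finite. By l'Hôpital, T - t is equivalent to an
explicit function of δ (`tendsto_profile_div`), and inverting it gives the rates. At λ = 0 this
function is a multiple of δ log²δ, and only -log δ ~ -log(T - t) ~ 2w is needed.

For classical solutions the formulae must be derived. Let Y be γ along the pathline from the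
minimum, φ = exp((λ+1)∫Y) and R = ∫φ^(-2). For fixed τ₁ the field N = (λ+1)φ(Y - γ)(R - R(τ₁)) + 1/φ
(`carrier`) has material derivative -(λ+1)γN, so N^(-1/(λ+1)) obeys the continuity equation and its
integral is conserved. Comparing t = τ₁, where N is constant in space, with t = 0, where N = 1 +
(λ+1)hR(τ₁), gives φ^(1/(λ+1)) = ⟨(1 + (λ+1)hR)^(-1/(λ+1))⟩ (`expFactor_rpow`) without a change of
variables by the flow. This closes the equation for R, identifies 1/((λ+1)R) with the gap, and
recovers γ and ω on all pathlines by Riccati and linear equations (`along_eq`). -/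

open Set Filter Topology MeasureTheory

noncomputable section

namespace Stagnation

/-! ### Averages over the torus -/

/-- The half-open square of side `2π` centred at the origin. -/
def box : Set (ℝ × ℝ) := Ioc (-Real.pi) Real.pi ×ˢ Ioc (-Real.pi) Real.pi

lemma measurableSet_box : MeasurableSet box := measurableSet_Ioc.prod measurableSet_Ioc

lemma measurableSet_cell : MeasurableSet cell := measurableSet_Ico.prod measurableSet_Ico

lemma volume_cell : volume cell = ENNReal.ofReal (4 * Real.pi ^ 2) := by
  rw [cell, Measure.volume_eq_prod, Measure.prod_prod, Real.volume_Ico,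
    ← ENNReal.ofReal_mul (by linarith [Real.pi_pos])]
  congr 1; ring

lemma volume_cell_lt_top : volume cell < ⊤ := by rw [volume_cell]; exact ENNReal.ofReal_lt_top

lemma volume_box_lt_top : volume box < ⊤ := by
  rw [box, Measure.volume_eq_prod, Measure.prod_prod, Real.volume_Ioc,
    ← ENNReal.ofReal_mul (by linarith [Real.pi_pos])]
  exact ENNReal.ofReal_lt_top

instance isFiniteMeasure_cell : IsFiniteMeasure (volume.restrict cell) :=
  ⟨by rw [Measure.restrict_apply_univ]; exact volume_cell_lt_top⟩

lemma four_pi_sq_pos : 0 < (4 * Real.pi ^ 2 : ℝ) := by positivity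

lemma volume_real_cell : volume.real cell = 4 * Real.pi ^ 2 := by
  rw [Measure.real, volume_cell, ENNReal.toReal_ofReal four_pi_sq_pos.le]

lemma torusAvg_const (c : ℝ) : torusAvg (fun _ => c) = c := by
  rw [torusAvg, setIntegral_const, volume_real_cell, smul_eq_mul, ← mul_assoc,
    inv_mul_cancel₀ four_pi_sq_pos.ne', one_mul]

lemma torusAvg_const_mul (c : ℝ) (f : ℝ × ℝ → ℝ) :
    torusAvg (fun p => c * f p) = c * torusAvg f := by
  rw [torusAvg, torusAvg, integral_const_mul]; ring

lemma torusAvg_mono {f g : ℝ × ℝ → ℝ} (hf : IntegrableOn f cell) (hg : IntegrableOn g cell)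
    (h : ∀ p, f p ≤ g p) : torusAvg f ≤ torusAvg g :=
  mul_le_mul_of_nonneg_left (integral_mono hf hg h) (inv_nonneg.2 four_pi_sq_pos.le)

lemma torusAvg_pos {f : ℝ × ℝ → ℝ} (hf : IntegrableOn f cell) (h : ∀ p, 0 < f p) :
    0 < torusAvg f := by
  refine mul_pos (inv_pos.2 four_pi_sq_pos) ?_
  rw [setIntegral_pos_iff_support_of_nonneg_ae (ae_of_all _ fun p => (h p).le) hf]
  have : Function.support f = univ := by ext p; simp [(h p).ne']
  rw [this, univ_inter, volume_cell]
  exact ENNReal.ofReal_pos.2 four_pi_sq_pos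

lemma TorusPeriodic.comp {f : ℝ × ℝ → ℝ} (hf : TorusPeriodic f) (F : ℝ → ℝ) :
    TorusPeriodic (fun p => F (f p)) := fun p q h => by simp only [hf p q h]

lemma TorusPeriodic.left {f : ℝ × ℝ → ℝ} (hf : TorusPeriodic f) (y : ℝ) :
    Function.Periodic (fun x => f (x, y)) (2 * Real.pi) := fun x =>
  hf (x, y) _ ⟨1, 0, by simp⟩

lemma TorusPeriodic.right {f : ℝ × ℝ → ℝ} (hf : TorusPeriodic f) (x : ℝ) :
    Function.Periodic (fun y => f (x, y)) (2 * Real.pi) := fun y =>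
  hf (x, y) _ ⟨0, 1, by simp⟩

/-- Recentres averages at the minimum, wherever it lies relative to the cell: an integral over one
period does not depend on its starting point. -/
lemma setIntegral_cell_eq_box {f : ℝ × ℝ → ℝ} (hper : TorusPeriodic f)
    (hm : AEStronglyMeasurable f volume) {c : ℝ} (hb : ∀ p, |f p| ≤ c) (p₀ : ℝ × ℝ) :
    ∫ p in cell, f p = ∫ v in box, f (p₀ + v) := by
  have hm' : AEStronglyMeasurable (fun v => f (p₀ + v)) volume :=
    hm.comp_quasiMeasurePreserving (measurePreserving_add_left volume p₀).quasiMeasurePreserving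
  have h1 : IntegrableOn f cell :=
    Measure.integrableOn_of_bounded volume_cell_lt_top.ne hm (ae_of_all _ hb)
  have h2 : IntegrableOn (fun v => f (p₀ + v)) box :=
    Measure.integrableOn_of_bounded volume_box_lt_top.ne hm' (ae_of_all _ fun v => hb _)
  have hpi := Real.pi_pos
  have e1 : ∫ p in cell, f p
      = ∫ x in (0 : ℝ)..(2 * Real.pi), ∫ y in (0 : ℝ)..(2 * Real.pi), f (x, y) := by
    rw [cell, Measure.volume_eq_prod, setIntegral_prod f h1]
    simp only [intervalIntegral.integral_of_le (show (0 : ℝ) ≤ 2 * Real.pi by linarith),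
      integral_Ico_eq_integral_Ioo, integral_Ioc_eq_integral_Ioo]
  have e2 : ∫ v in box, f (p₀ + v)
      = ∫ x in (-Real.pi)..Real.pi, ∫ y in (-Real.pi)..Real.pi, f (p₀.1 + x, p₀.2 + y) := by
    rw [box, Measure.volume_eq_prod, setIntegral_prod _ h2]
    simp only [intervalIntegral.integral_of_le (show -Real.pi ≤ Real.pi by linarith)]
    rfl
  have e3 : ∀ x, ∫ y in (-Real.pi)..Real.pi, f (x, p₀.2 + y)
      = ∫ y in (0 : ℝ)..(2 * Real.pi), f (x, y) := by
    intro x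
    rw [intervalIntegral.integral_comp_add_left (fun y => f (x, y))]
    have := (hper.right x).intervalIntegral_add_eq (p₀.2 + -Real.pi) 0
    rw [zero_add] at this
    rw [← this]; congr 1; ring
  have e4 : Function.Periodic (fun x => ∫ y in (0 : ℝ)..(2 * Real.pi), f (x, y))
      (2 * Real.pi) := fun x => by
    simp only
    congr 1; ext y; exact hper.left y x
  rw [e1, e2]
  simp only [e3]
  rw [intervalIntegral.integral_comp_add_left
    (fun x => ∫ y in (0 : ℝ)..(2 * Real.pi), f (x, y))]
  have := e4.intervalIntegral_add_eq (p₀.1 + -Real.pi) 0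
  rw [zero_add] at this
  rw [← this]; congr 1; ring

/-! ### Nondegenerate minima -/

/-- `h` is a nonnegative function on the torus with a unique, well separated zero `p₀`, at
which it is equivalent to half the positive definite form `A x² + 2 B x y + C y²`. -/
structure QuadraticWell (h : ℝ × ℝ → ℝ) (p₀ : ℝ × ℝ) (A B C : ℝ) : Prop where
  periodic : TorusPeriodic h
  measurable : AEMeasurable h volume
  nonneg : ∀ p, 0 ≤ h p
  zero : h p₀ = 0
  eq_zero : ∀ p, h p = 0 → SamePoint p₀ p
  A_pos : 0 < A
  det_pos : 0 < A * C - B ^ 2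
  expansion : (fun v : ℝ × ℝ => h (p₀ + v) - (A * v.1 ^ 2 + 2 * B * v.1 * v.2 + C * v.2 ^ 2) / 2)
    =o[𝓝 0] fun v => ‖v‖ ^ 2
  far : ∀ r > 0, ∃ ε > 0, ∀ v ∈ box, r ≤ ‖v‖ → ε ≤ h (p₀ + v)

/-- For the form Q with matrix H, (A + C) Q(v) = |Hv|² + (det H)|v|² in Euclidean norms, so the
constant is determinant over trace. The norm on the product is the maximum norm, hence each squared
coordinate is bounded separately. -/
lemma quadForm_lower {A B C : ℝ} (hA : 0 < A) (hD : 0 < A * C - B ^ 2) :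
    ∃ c > 0, ∀ v : ℝ × ℝ, c * ‖v‖ ^ 2 ≤ A * v.1 ^ 2 + 2 * B * v.1 * v.2 + C * v.2 ^ 2 := by
  have hC : 0 < C := by
    by_contra! hC
    nlinarith [mul_nonneg hA.le (neg_nonneg.2 hC), sq_nonneg B]
  refine ⟨(A * C - B ^ 2) / (A + C), by positivity, fun v => ?_⟩
  have h1 : (A * C - B ^ 2) / (A + C) * v.1 ^ 2
      ≤ A * v.1 ^ 2 + 2 * B * v.1 * v.2 + C * v.2 ^ 2 := by
    rw [div_mul_eq_mul_div, div_le_iff₀ (by positivity)]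
    nlinarith [sq_nonneg (B * v.1 + C * v.2), sq_nonneg (A * v.1 + B * v.2), sq_nonneg v.2,
      mul_nonneg hD.le (sq_nonneg v.2)]
  have h2 : (A * C - B ^ 2) / (A + C) * v.2 ^ 2
      ≤ A * v.1 ^ 2 + 2 * B * v.1 * v.2 + C * v.2 ^ 2 := by
    rw [div_mul_eq_mul_div, div_le_iff₀ (by positivity)]
    nlinarith [sq_nonneg (B * v.1 + C * v.2), sq_nonneg (A * v.1 + B * v.2), sq_nonneg v.1,
      mul_nonneg hD.le (sq_nonneg v.1)]
  rcases le_total ‖v.1‖ ‖v.2‖ with h | h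
  · rw [Prod.norm_def, max_eq_right h, Real.norm_eq_abs, sq_abs]; exact h2
  · rw [Prod.norm_def, max_eq_left h, Real.norm_eq_abs, sq_abs]; exact h1

/-- Second-order Taylor expansion (Peano form) at a critical point. -/
lemma TwiceDifferentiableAt.expansion {f : ℝ × ℝ → ℝ} {p : ℝ × ℝ} (hf : TwiceDifferentiableAt f p)
    (hcrit : fderiv ℝ f p = 0) :
    (fun v : ℝ × ℝ => f (p + v) - f p - fderiv ℝ (fderiv ℝ f) p v v / 2)
      =o[𝓝 0] fun v => ‖v‖ ^ 2 := by
  obtain ⟨hd, h2⟩ := hf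
  set D := fderiv ℝ (fderiv ℝ f) p with hD
  have hsymm : ∀ v w, D v w = D w v := fun v w =>
    second_derivative_symmetric_of_eventually (hd.mono fun q hq => hq.hasFDerivAt)
      h2.hasFDerivAt v w
  have hsmall := h2.hasFDerivAt.isLittleO
  rw [Asymptotics.isLittleO_iff]
  intro ε hε
  have hs := hsmall.def hε
  obtain ⟨r, hr, hball⟩ := Metric.eventually_nhds_iff_ball.1 (hd.and hs)
  have hmem : ∀ᶠ v : ℝ × ℝ in 𝓝 0, v ∈ Metric.ball (0 : ℝ × ℝ) r := Metric.ball_mem_nhds _ hr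
  filter_upwards [hmem] with v hv
  have hv' : ‖v‖ < r := by simpa using hv
  -- Since `fderiv ℝ f` vanishes at `p`, the derivative of `g` has norm at most ε‖w‖ near 0; the
  -- mean value inequality on the closed ball of radius ‖v‖ gives ε‖v‖².
  set g : ℝ × ℝ → ℝ := fun w => f (p + w) - D w w / 2 with hg
  have hder : ∀ w ∈ Metric.closedBall (0 : ℝ × ℝ) ‖v‖,
      HasFDerivWithinAt g (fderiv ℝ f (p + w) - D w) (Metric.closedBall (0 : ℝ × ℝ) ‖v‖) w := by
    intro w hw
    have hw' : ‖w‖ < r := lt_of_le_of_lt (by simpa using hw) hv'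
    have hdw := (hball (p + w) (by simpa using hw')).1.hasFDerivAt
    have h1 : HasFDerivAt (fun w => f (p + w)) (fderiv ℝ f (p + w)) w := by
      exact (hdw.comp w ((hasFDerivAt_id w).const_add p)).congr_fderiv (by ext <;> simp)
    have h3 : HasFDerivAt (fun w => D w w / 2) (D w) w := by
      have h4 := (D.hasFDerivAt (x := w)).clm_apply (hasFDerivAt_id w)
      have h5 := h4.const_mul (1 / 2 : ℝ)
      refine (h5.congr_fderiv ?_).congr_of_eventuallyEq (Eventually.of_forall fun x => ?_)
      · ext <;> simp [hsymm _ w] <;> ring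
      · simp; ring
    exact (h1.sub h3).hasFDerivWithinAt
  have hbound : ∀ w ∈ Metric.closedBall (0 : ℝ × ℝ) ‖v‖,
      ‖fderiv ℝ f (p + w) - D w‖ ≤ ε * ‖v‖ := by
    intro w hw
    have hw0 : ‖w‖ ≤ ‖v‖ := by simpa using hw
    have hw' : ‖w‖ < r := lt_of_le_of_lt hw0 hv'
    have := (hball (p + w) (by simpa using hw')).2
    rw [hcrit] at this
    simp only [sub_zero, add_sub_cancel_left] at this
    exact this.trans (by gcongr)
  have := (convex_closedBall (0 : ℝ × ℝ) ‖v‖).norm_image_sub_le_of_norm_hasFDerivWithin_le hder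
    hbound (x := 0) (y := v) (by simp) (by simp)
  simp only [hg, add_zero, map_zero, zero_div, sub_zero] at this
  calc ‖f (p + v) - f p - D v v / 2‖ = ‖f (p + v) - D v v / 2 - f p‖ := by congr 1; ring
    _ ≤ ε * ‖v‖ * ‖v‖ := by simpa using this
    _ = ε * ‖‖v‖ ^ 2‖ := by rw [norm_pow, norm_norm]; ring

lemma hessian_quadForm {f : ℝ × ℝ → ℝ} {p : ℝ × ℝ} (hf : TwiceDifferentiableAt f p) (v : ℝ × ℝ) :
    fderiv ℝ (fderiv ℝ f) p v v = hessian f p 0 0 * v.1 ^ 2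
      + 2 * hessian f p 0 1 * v.1 * v.2 + hessian f p 1 1 * v.2 ^ 2 := by
  set D := fderiv ℝ (fderiv ℝ f) p with hD
  have hsymm : D (0, 1) (1, 0) = D (1, 0) (0, 1) :=
    second_derivative_symmetric_of_eventually (hf.1.mono fun q hq => hq.hasFDerivAt)
      hf.2.hasFDerivAt _ _
  have hv : v = v.1 • ((1, 0) : ℝ × ℝ) + v.2 • ((0, 1) : ℝ × ℝ) := by ext <;> simp
  have : hessian f p 0 0 = D (1, 0) (1, 0) ∧ hessian f p 0 1 = D (1, 0) (0, 1) ∧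
    hessian f p 1 1 = D (0, 1) (0, 1) := by simp [hessian, hD]
  rw [this.1, this.2.1, this.2.2]
  conv_lhs => rw [hv]
  simp only [map_add, map_smul, add_apply, smul_apply,
    smul_eq_mul, hsymm]
  ring

/-- The elevation of the initial stretching rate above its minimum is a quadratic well. -/
lemma quadraticWell_of_isGenericType {γ₀ : ℝ × ℝ → ℝ} {pmin pmax : ℝ × ℝ}
    (hγ₀ : IsInitialStretching γ₀) (hgen : IsGenericType γ₀ pmin pmax)
    (hsep : WellSeparatedMin γ₀ pmin) :
    ∃ A B C, QuadraticWell (fun p => γ₀ p - γ₀ pmin) pmin A B C ∧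
      A * C - B ^ 2 = (hessian γ₀ pmin).det := by
  have hcrit : fderiv ℝ γ₀ pmin = 0 :=
    IsLocalMin.fderiv_eq_zero (Eventually.of_forall hgen.min_le)
  have hdet : hessian γ₀ pmin 0 0 * hessian γ₀ pmin 1 1 - hessian γ₀ pmin 0 1 ^ 2
      = (hessian γ₀ pmin).det := by
    have h := hgen.hessian_min.1.apply 0 1
    simp only [star_trivial] at h
    rw [Matrix.det_fin_two, h]; ring
  refine ⟨hessian γ₀ pmin 0 0, hessian γ₀ pmin 0 1, hessian γ₀ pmin 1 1, ?_, hdet⟩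
  refine ⟨hγ₀.periodic.comp (fun x => x - γ₀ pmin), hγ₀.measurable.sub_const _,
    fun p => sub_nonneg.2 (hgen.min_le p), sub_self _,
    fun p hp => hgen.min_unique p (sub_eq_zero.1 hp), hgen.hessian_min.diag_pos,
    hdet ▸ hgen.hessian_min.det_pos, ?_, ?_⟩
  · simpa only [hessian_quadForm hgen.twice_min] using hgen.twice_min.expansion hcrit
  · intro r hr
    have hpi := Real.pi_pos
    -- Separation locates points only modulo the period lattice. A nonzero shift moves a coordinate
    -- in (-π, π] out of (-π, π), so below distance π the shift is zero and the bound concerns `v`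
    -- itself.
    obtain ⟨ε, hε, h⟩ := hsep (min r Real.pi) (lt_min hr hpi)
    refine ⟨ε, hε, fun v hv hrv => ?_⟩
    by_contra! hlt
    obtain ⟨q', ⟨k, l, rfl⟩, hd⟩ := h (pmin + v) (by linarith)
    rw [Prod.dist_eq, max_lt_iff, Real.dist_eq, Real.dist_eq] at hd
    obtain ⟨⟨h1, h2⟩, h3, h4⟩ := hv
    have key : ∀ (x : ℝ) (k : ℤ), -Real.pi < x → x ≤ Real.pi →
        |x + k * (2 * Real.pi)| < min r Real.pi → |x| < min r Real.pi := by
      intro x k hx1 hx2 hx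
      have hx' := abs_lt.1 (hx.trans_le (min_le_right _ _))
      have hk : k = 0 := by
        by_contra hk
        rcases lt_or_gt_of_ne hk with hk | hk
        · have : (k : ℝ) ≤ -1 := by exact_mod_cast Int.le_sub_one_of_lt hk
          nlinarith
        · have : (1 : ℝ) ≤ k := by exact_mod_cast hk
          nlinarith
      simpa [hk] using hx
    have a1 := key v.1 k h1 h2 (by
      have := hd.1
      rwa [Prod.fst_add, show pmin.1 + v.1 + k * (2 * Real.pi) - pmin.1
        = v.1 + k * (2 * Real.pi) by ring] at this)
    have a2 := key v.2 l h3 h4 (by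
      have := hd.2
      rwa [Prod.snd_add, show pmin.2 + v.2 + l * (2 * Real.pi) - pmin.2
        = v.2 + l * (2 * Real.pi) by ring] at this)
    rw [Prod.norm_def] at hrv
    have := max_lt a1 a2
    exact absurd (hrv.trans_lt (this.trans_le (min_le_left _ _))) (lt_irrefl _)

/-- Near the well the remainder costs at most half of the quadratic part; elsewhere h ≥ ε while ‖v‖
≤ π. The bound supplies the integrable majorant of the scaling limit. -/
lemma QuadraticWell.lower {h : ℝ × ℝ → ℝ} {p₀ : ℝ × ℝ} {A B C : ℝ} (hw : QuadraticWell h p₀ A B C) :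
    ∃ c > 0, ∀ v ∈ box, c * ‖v‖ ^ 2 ≤ h (p₀ + v) := by
  obtain ⟨c, hc, hq⟩ := quadForm_lower hw.A_pos hw.det_pos
  obtain ⟨r, hr, hball⟩ := Metric.eventually_nhds_iff_ball.1
    (hw.expansion.def (show 0 < c / 4 by positivity))
  obtain ⟨ε, hε, hfar⟩ := hw.far r hr
  have hpi := Real.pi_pos
  refine ⟨min (c / 4) (ε / Real.pi ^ 2), by positivity, fun v hv => ?_⟩
  rcases lt_or_ge ‖v‖ r with h1 | h1
  · have := (abs_le.1 (hball v (by simpa using h1))).1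
    simp only [norm_pow, norm_norm] at this
    have h2 := hq v
    have : min (c / 4) (ε / Real.pi ^ 2) * ‖v‖ ^ 2 ≤ c / 4 * ‖v‖ ^ 2 := by
      gcongr; exact min_le_left _ _
    linarith
  · refine le_trans ?_ (hfar v hv h1)
    have hvn : ‖v‖ ≤ Real.pi := by
      rw [Prod.norm_def, max_le_iff, Real.norm_eq_abs, Real.norm_eq_abs, abs_le, abs_le]
      exact ⟨⟨hv.1.1.le, hv.1.2⟩, hv.2.1.le, hv.2.2⟩
    calc min (c / 4) (ε / Real.pi ^ 2) * ‖v‖ ^ 2 ≤ (ε / Real.pi ^ 2) * Real.pi ^ 2 := by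
          gcongr; exact min_le_right _ _
      _ = ε := by field_simp

/-! ### The limiting integral -/

lemma integral_Ioi_mul_rpow {p : ℝ} (hp : 1 < p) :
    ∫ r in Ioi (0 : ℝ), r * (r ^ 2 / 2 + 1) ^ (-p) = 1 / (p - 1) := by
  have hpos : ∀ x : ℝ, 0 < x ^ 2 / 2 + 1 := fun x => by positivity
  have hd : ∀ x ∈ Ici (0 : ℝ), HasDerivAt (fun r : ℝ => -(1 / (p - 1)) * (r ^ 2 / 2 + 1) ^ (1 - p))
      (x * (x ^ 2 / 2 + 1) ^ (-p)) x := by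
    intro x _
    have h1 : HasDerivAt (fun r : ℝ => r ^ 2 / 2 + 1) x x := by
      have := ((hasDerivAt_pow 2 x).div_const 2).add_const 1
      exact this.congr_deriv (by simp)
    have h2 := (h1.rpow_const (p := 1 - p) (Or.inl (hpos x).ne')).const_mul (-(1 / (p - 1)))
    refine h2.congr_deriv ?_
    have : p - 1 ≠ 0 := by linarith
    rw [show 1 - p - 1 = -p by ring]
    field_simp
    ring
  have hlim : Tendsto (fun r : ℝ => -(1 / (p - 1)) * (r ^ 2 / 2 + 1) ^ (1 - p)) atTop (𝓝 0) := by
    have h1 : Tendsto (fun r : ℝ => r ^ 2 / 2 + 1) atTop atTop :=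
      tendsto_atTop_add_const_right _ _
        ((tendsto_pow_atTop two_ne_zero).atTop_div_const (by norm_num))
    have h2 := (tendsto_rpow_neg_atTop (show 0 < p - 1 by linarith)).comp h1
    have h3 := h2.const_mul (-(1 / (p - 1)))
    simpa [Function.comp_def] using h3
  rw [integral_Ioi_of_hasDerivAt_of_tendsto' hd
    (integrableOn_Ioi_deriv_of_nonneg' hd (fun x hx => ?_) hlim) hlim]
  · simp
  · exact mul_nonneg (le_of_lt hx) (Real.rpow_nonneg (hpos x).le _)

lemma integral_radial {p : ℝ} (hp : 1 < p) :
    ∫ v : ℝ × ℝ, ((v.1 ^ 2 + v.2 ^ 2) / 2 + 1) ^ (-p) = 2 * Real.pi / (p - 1) := by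
  rw [← integral_comp_polarCoord_symm]
  have : ∀ z : ℝ × ℝ, z.1 • (((polarCoord.symm z).1 ^ 2 + (polarCoord.symm z).2 ^ 2) / 2 + 1)
      ^ (-p) = (z.1 * (z.1 ^ 2 / 2 + 1) ^ (-p)) * 1 := by
    intro z
    rw [polarCoord_symm_apply, smul_eq_mul, mul_one]
    congr 4
    linear_combination z.1 ^ 2 * Real.cos_sq_add_sin_sq z.2
  simp only [this]
  rw [polarCoord_target, Measure.volume_eq_prod,
    setIntegral_prod_mul (fun r : ℝ => r * (r ^ 2 / 2 + 1) ^ (-p)) (fun _ => (1 : ℝ)),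
    integral_Ioi_mul_rpow hp, setIntegral_const, Measure.real, Real.volume_Ioo,
    ENNReal.toReal_ofReal (by linarith [Real.pi_pos]), smul_eq_mul]
  ring

/-- The upper triangular Cholesky factor, of determinant √D, carries the form to x² + y². -/
lemma integral_quadForm {A B C p : ℝ} (hA : 0 < A) (hD : 0 < A * C - B ^ 2) (hp : 1 < p) :
    ∫ v : ℝ × ℝ, ((A * v.1 ^ 2 + 2 * B * v.1 * v.2 + C * v.2 ^ 2) / 2 + 1) ^ (-p)
      = 2 * Real.pi / (√(A * C - B ^ 2) * (p - 1)) := by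
  set D := A * C - B ^ 2 with hDdef
  have hsA : 0 < √A := Real.sqrt_pos.2 hA
  have hsD : 0 < √D := Real.sqrt_pos.2 hD
  have hA2 : √A ^ 2 = A := Real.sq_sqrt hA.le
  have hD2 : √D ^ 2 = D := Real.sq_sqrt hD.le
  set f : (ℝ × ℝ) →L[ℝ] (ℝ × ℝ) := LinearMap.toContinuousLinearMap
    (Matrix.toLin (Module.Basis.finTwoProd ℝ) (Module.Basis.finTwoProd ℝ)
      !![√A, B / √A; 0, √D / √A]) with hf
  have hfv : ∀ v : ℝ × ℝ, f v = (√A * v.1 + B / √A * v.2, √D / √A * v.2) := by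
    intro v
    rw [hf, LinearMap.coe_toContinuousLinearMap', Matrix.toLin_finTwoProd_apply]
    simp
  have hdet : f.det = √D := by
    rw [hf, LinearMap.det_toContinuousLinearMap, LinearMap.det_toLin, Matrix.det_fin_two_of]
    field_simp
    ring
  have hinj : InjOn f univ := by
    rintro ⟨x, y⟩ - ⟨x', y'⟩ - h
    rw [hfv, hfv, Prod.mk.injEq] at h
    obtain ⟨h1, h2⟩ := h
    have hy : y = y' := mul_left_cancel₀ (div_pos hsD hsA).ne' h2
    subst hy
    have hx : x = x' := mul_left_cancel₀ hsA.ne' (add_right_cancel h1)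
    rw [hx]
  have himg : f '' univ = univ := by
    rw [image_univ]
    refine eq_univ_of_forall fun w => ⟨((w.1 - B / √A * (w.2 / (√D / √A))) / √A,
      w.2 / (√D / √A)), ?_⟩
    rw [hfv]
    ext
    · field_simp; ring
    · field_simp
  have key := integral_image_eq_integral_abs_det_fderiv_smul (volume : Measure (ℝ × ℝ))
    MeasurableSet.univ (fun x _ => (f.hasFDerivAt (x := x)).hasFDerivWithinAt) hinj
    (fun v => ((v.1 ^ 2 + v.2 ^ 2) / 2 + 1) ^ (-p))
  rw [himg, setIntegral_univ, setIntegral_univ, integral_radial hp, integral_smul, hdet,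
    abs_of_pos hsD, smul_eq_mul] at key
  have : ∀ v : ℝ × ℝ, (f v).1 ^ 2 + (f v).2 ^ 2
      = A * v.1 ^ 2 + 2 * B * v.1 * v.2 + C * v.2 ^ 2 := by
    intro v
    rw [hfv]
    simp only
    have h1 : (√A * v.1 + B / √A * v.2) ^ 2 + (√D / √A * v.2) ^ 2
        = √A ^ 2 * v.1 ^ 2 + 2 * B * v.1 * v.2 + (B ^ 2 + √D ^ 2) / √A ^ 2 * v.2 ^ 2 := by
      field_simp; ring
    rw [h1, hA2, hD2, hDdef]
    field_simp; ring
  simp only [this] at key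
  have hp' : p - 1 ≠ 0 := by linarith
  rw [eq_comm, div_eq_iff (by positivity)]
  rw [div_eq_iff hp'] at key
  linear_combination key

/-! ### Averages of negative powers -/

/-- The average `⟨(h + δ)^(-r)⟩`. -/
def powAvg (h : ℝ × ℝ → ℝ) (r δ : ℝ) : ℝ := torusAvg fun p => (h p + δ) ^ (-r)

namespace QuadraticWell

variable {h : ℝ × ℝ → ℝ} {p₀ : ℝ × ℝ} {A B C : ℝ}

lemma aestronglyMeasurable_rpow (hw : QuadraticWell h p₀ A B C) (r δ : ℝ) :
    AEStronglyMeasurable (fun p => (h p + δ) ^ (-r)) volume :=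
  ((hw.measurable.add_const δ).pow_const _).aestronglyMeasurable

lemma abs_rpow_le (hw : QuadraticWell h p₀ A B C) {r δ : ℝ} (hr : 0 ≤ r) (hδ : 0 < δ) (p : ℝ × ℝ) :
    |(h p + δ) ^ (-r)| ≤ δ ^ (-r) := by
  have := hw.nonneg p
  rw [abs_of_nonneg (Real.rpow_nonneg (by linarith) _)]
  exact Real.rpow_le_rpow_of_nonpos hδ (by linarith) (by linarith)

lemma integrableOn_rpow (hw : QuadraticWell h p₀ A B C) {r δ : ℝ} (hr : 0 ≤ r) (hδ : 0 < δ) :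
    IntegrableOn (fun p => (h p + δ) ^ (-r)) cell :=
  Measure.integrableOn_of_bounded volume_cell_lt_top.ne (hw.aestronglyMeasurable_rpow r δ)
    (ae_of_all _ fun p => hw.abs_rpow_le hr hδ p)

lemma powAvg_pos (hw : QuadraticWell h p₀ A B C) {r δ : ℝ} (hr : 0 ≤ r) (hδ : 0 < δ) :
    0 < powAvg h r δ :=
  torusAvg_pos (hw.integrableOn_rpow hr hδ) fun p =>
    Real.rpow_pos_of_pos (by linarith [hw.nonneg p]) _

lemma powAvg_le (hw : QuadraticWell h p₀ A B C) {r δ : ℝ} (hr : 0 ≤ r) (hδ : 0 < δ) :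
    powAvg h r δ ≤ δ ^ (-r) := by
  rw [← torusAvg_const (δ ^ (-r))]
  exact torusAvg_mono (hw.integrableOn_rpow hr hδ) (integrable_const _)
    fun p => (le_abs_self _).trans (hw.abs_rpow_le hr hδ p)

/-- Links K to L, and lets the critical and subcritical averages be obtained from supercritical ones
by integration in δ. The integrands are dominated on the half-line beyond δ/2. -/
lemma hasDerivAt_powAvg (hw : QuadraticWell h p₀ A B C) {r δ : ℝ} (hr : 0 ≤ r) (hδ : 0 < δ) :
    HasDerivAt (powAvg h r) (-r * powAvg h (r + 1) δ) δ := by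
  have hb := hasDerivAt_integral_of_dominated_loc_of_deriv_le (μ := volume.restrict cell)
    (F := fun x p => (h p + x) ^ (-r)) (F' := fun x p => -r * (h p + x) ^ (-(r + 1)))
    (x₀ := δ) (s := Ioi (δ / 2)) (bound := fun _ => r * (δ / 2) ^ (-(r + 1)))
    (Ioi_mem_nhds (by linarith))
    (Eventually.of_forall fun x => (hw.aestronglyMeasurable_rpow r x).restrict)
    (hw.integrableOn_rpow hr hδ)
    ((hw.aestronglyMeasurable_rpow (r + 1) δ).const_mul (-r)).restrict
    (ae_of_all _ fun p x hx => ?_) (integrable_const _) (ae_of_all _ fun p x hx => ?_)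
  · have := hb.2.const_mul ((4 * Real.pi ^ 2)⁻¹)
    rw [integral_const_mul] at this
    refine this.congr_deriv ?_
    simp only [powAvg, torusAvg]; ring
  · have hx' : 0 < x := lt_trans (by linarith) hx
    rw [norm_mul, norm_neg, Real.norm_of_nonneg hr]
    gcongr
    exact (hw.abs_rpow_le (by linarith) hx' p).trans
      (Real.rpow_le_rpow_of_nonpos (by linarith) (le_of_lt hx) (by linarith))
  · have hx' : 0 < x := lt_trans (by linarith) hx
    have h1 : HasDerivAt (fun x => h p + x) 1 x := (hasDerivAt_id x).const_add _
    have h2 := h1.rpow_const (p := -r) (Or.inl (by linarith [hw.nonneg p]))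
    refine h2.congr_deriv ?_
    rw [show -r - 1 = -(r + 1) by ring]; ring

lemma tendsto_scaled (hw : QuadraticWell h p₀ A B C) (z : ℝ × ℝ) :
    Tendsto (fun δ : ℝ => h (p₀ + √δ • z) / δ) (𝓝[>] 0)
      (𝓝 ((A * z.1 ^ 2 + 2 * B * z.1 * z.2 + C * z.2 ^ 2) / 2)) := by
  have hsq : Tendsto (fun δ : ℝ => √δ • z) (𝓝[>] 0) (𝓝 0) := by
    have : Tendsto (fun δ : ℝ => √δ) (𝓝[>] 0) (𝓝 0) := by
      simpa using (Real.continuous_sqrt.tendsto 0).mono_left nhdsWithin_le_nhds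
    simpa using this.smul_const z
  have h1 := hw.expansion.comp_tendsto hsq
  have h2 : (fun δ : ℝ => h (p₀ + √δ • z)
      - δ * ((A * z.1 ^ 2 + 2 * B * z.1 * z.2 + C * z.2 ^ 2) / 2)) =o[𝓝[>] 0] fun δ => δ := by
    refine (h1.trans_isBigO (Asymptotics.IsBigO.of_bound (‖z‖ ^ 2) ?_)).congr' ?_ EventuallyEq.rfl
    · filter_upwards [self_mem_nhdsWithin] with δ hδ
      simp only [Function.comp, norm_smul, Real.norm_eq_abs, mul_pow, sq_abs,
        Real.sq_sqrt (le_of_lt hδ)]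
      rw [abs_mul, abs_of_nonneg (sq_nonneg ‖z‖), mul_comm]
    · filter_upwards [self_mem_nhdsWithin] with δ hδ
      have := Real.sq_sqrt (le_of_lt hδ)
      simp only [Function.comp, Prod.smul_fst, Prod.smul_snd, smul_eq_mul]
      linear_combination (-(A * z.1 ^ 2 + 2 * B * z.1 * z.2 + C * z.2 ^ 2) / 2) * this
  have h3 := h2.tendsto_div_nhds_zero
  have h4 := h3.add_const ((A * z.1 ^ 2 + 2 * B * z.1 * z.2 + C * z.2 ^ 2) / 2)
  rw [zero_add] at h4
  refine h4.congr' ?_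
  filter_upwards [self_mem_nhdsWithin] with δ hδ
  have : δ ≠ 0 := ne_of_gt hδ
  field_simp
  ring

/-- Substitution v = √δ z, with Jacobian δ in the plane. The indicator carries the expanding domain,
so that the limit can be taken in an integral over the whole plane. -/
lemma rpow_mul_powAvg (hw : QuadraticWell h p₀ A B C) {r δ : ℝ} (hr : 0 ≤ r) (hδ : 0 < δ) :
    δ ^ (r - 1) * powAvg h r δ = (4 * Real.pi ^ 2)⁻¹ *
      ∫ z : ℝ × ℝ, box.indicator (fun v => (h (p₀ + v) / δ + 1) ^ (-r)) (√δ • z) := by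
  rw [Measure.integral_comp_smul, integral_indicator measurableSet_box]
  rw [powAvg, torusAvg, setIntegral_cell_eq_box (f := fun p => (h p + δ) ^ (-r))
    (hw.periodic.comp fun x => (x + δ) ^ (-r))
    (hw.aestronglyMeasurable_rpow r δ) (hw.abs_rpow_le hr hδ) p₀]
  have e : ∀ v, (h (p₀ + v) / δ + 1) ^ (-r) = δ ^ r * (h (p₀ + v) + δ) ^ (-r) := by
    intro v
    have := hw.nonneg (p₀ + v)
    rw [show h (p₀ + v) / δ + 1 = (h (p₀ + v) + δ) / δ by field_simp,
      Real.div_rpow (by linarith) hδ.le, Real.rpow_neg hδ.le r]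
    field_simp
  simp only [e]
  rw [integral_const_mul, Module.finrank_prod, Module.finrank_self, Real.sq_sqrt hδ.le,
    abs_of_pos (inv_pos.2 hδ), Real.rpow_sub_one hδ.ne', smul_eq_mul]
  field_simp

/-- Asymptotics of supercritical averages: `⟨(h + δ)^(-r)⟩ ~ δ^(1-r) / (2π (r-1) √Δ)`. -/
lemma tendsto_rpow_mul_powAvg (hw : QuadraticWell h p₀ A B C) {r : ℝ} (hr : 1 < r) :
    Tendsto (fun δ => δ ^ (r - 1) * powAvg h r δ) (𝓝[>] 0)
      (𝓝 (1 / (2 * Real.pi * √(A * C - B ^ 2)) / (r - 1))) := by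
  obtain ⟨c, hc, hlow⟩ := hw.lower
  have hlim : Tendsto (fun δ : ℝ => ∫ z : ℝ × ℝ,
      box.indicator (fun v => (h (p₀ + v) / δ + 1) ^ (-r)) (√δ • z)) (𝓝[>] 0)
      (𝓝 (∫ z : ℝ × ℝ, ((A * z.1 ^ 2 + 2 * B * z.1 * z.2 + C * z.2 ^ 2) / 2 + 1) ^ (-r))) := by
    -- The bound c‖v‖² ≤ h gives h/δ + 1 ≥ min(c, 1)(1 + ‖z‖²) uniformly in δ; the majorant decays
    -- with exponent 2r, larger than the dimension 2.
    refine tendsto_integral_filter_of_dominated_convergence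
      (fun z => (min c 1) ^ (-r) * (1 + ‖z‖ ^ 2) ^ (-(2 * r) / 2)) ?_ ?_ ?_ ?_
    · filter_upwards [self_mem_nhdsWithin] with δ hδ
      have hm : AEStronglyMeasurable (fun v : ℝ × ℝ => (h (p₀ + v) / δ + 1) ^ (-r)) volume := by
        have h1 : AEMeasurable (fun v => h (p₀ + v)) volume :=
          hw.measurable.comp_quasiMeasurePreserving
            (measurePreserving_add_left volume p₀).quasiMeasurePreserving
        exact (((h1.div_const δ).add_const 1).pow_const _).aestronglyMeasurable
      exact (hm.indicator measurableSet_box).comp_quasiMeasurePreserving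
        ⟨measurable_const_smul _, by
          rw [Measure.map_addHaar_smul volume (Real.sqrt_pos.2 hδ).ne']
          exact Measure.smul_absolutelyContinuous⟩
    · filter_upwards [self_mem_nhdsWithin] with δ hδ
      have hδ' : 0 < δ := hδ
      refine ae_of_all _ fun z => ?_
      have hm : 0 < min c 1 := lt_min hc one_pos
      by_cases hz : √δ • z ∈ box
      · rw [indicator_of_mem hz]
        have h1 := hlow _ hz
        rw [norm_smul, mul_pow, Real.norm_eq_abs, sq_abs, Real.sq_sqrt hδ'.le] at h1
        have h2 : min c 1 * (1 + ‖z‖ ^ 2) ≤ h (p₀ + √δ • z) / δ + 1 := by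
          have h3 : c * ‖z‖ ^ 2 ≤ h (p₀ + √δ • z) / δ := by
            rw [le_div_iff₀ hδ']; linarith
          have h4 : min c 1 * ‖z‖ ^ 2 ≤ c * ‖z‖ ^ 2 := by gcongr; exact min_le_left _ _
          have h5 : min c 1 ≤ 1 := min_le_right _ _
          linarith
        have h6 : 0 < min c 1 * (1 + ‖z‖ ^ 2) := by positivity
        rw [Real.norm_of_nonneg (Real.rpow_nonneg (h6.trans_le h2).le _),
          show -(2 * r) / 2 = -r by ring, ← Real.mul_rpow hm.le (by positivity)]
        exact Real.rpow_le_rpow_of_nonpos h6 h2 (by linarith)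
      · rw [indicator_of_notMem hz, norm_zero]
        positivity
    · refine (integrable_rpow_neg_one_add_norm_sq ?_).const_mul _
      rw [Module.finrank_prod, Module.finrank_self]
      push_cast; linarith
    · refine ae_of_all _ fun z => ?_
      have hbox : ∀ᶠ δ : ℝ in 𝓝[>] 0, √δ • z ∈ box := by
        have hsq : Tendsto (fun δ : ℝ => √δ • z) (𝓝[>] 0) (𝓝 0) := by
          have : Tendsto (fun δ : ℝ => √δ) (𝓝[>] 0) (𝓝 0) := by
            simpa using (Real.continuous_sqrt.tendsto 0).mono_left nhdsWithin_le_nhds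
          simpa using this.smul_const z
        refine hsq (prod_mem_nhds ?_ ?_) <;>
          exact Ioc_mem_nhds (neg_lt_zero.2 Real.pi_pos) Real.pi_pos
      have hpos : 0 ≤ (A * z.1 ^ 2 + 2 * B * z.1 * z.2 + C * z.2 ^ 2) / 2 := by
        obtain ⟨k, hk, hq⟩ := quadForm_lower hw.A_pos hw.det_pos
        have := hq z
        have : 0 ≤ k * ‖z‖ ^ 2 := by positivity
        linarith
      refine (((hw.tendsto_scaled z).add_const 1).rpow_const (p := -r)
        (Or.inl (by linarith))).congr' ?_
      filter_upwards [hbox] with δ hδ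
      rw [indicator_of_mem hδ]
  rw [integral_quadForm hw.A_pos hw.det_pos hr] at hlim
  have hsD : 0 < √(A * C - B ^ 2) := Real.sqrt_pos.2 hw.det_pos
  have hpi := Real.pi_pos
  have hr1 : r - 1 ≠ 0 := by linarith
  have h2 := hlim.const_mul ((4 * Real.pi ^ 2)⁻¹)
  rw [show (4 * Real.pi ^ 2)⁻¹ * (2 * Real.pi / (√(A * C - B ^ 2) * (r - 1)))
    = 1 / (2 * Real.pi * √(A * C - B ^ 2)) / (r - 1) by field_simp; ring] at h2
  refine h2.congr' ?_
  filter_upwards [self_mem_nhdsWithin] with δ hδ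
  exact (hw.rpow_mul_powAvg (by linarith) hδ).symm

end QuadraticWell

/-- A function whose derivative tends to `c` at infinity grows like `c u`. -/
lemma tendsto_div_id_of_tendsto_deriv {G G' : ℝ → ℝ} {c : ℝ}
    (hG : ∀ u, HasDerivAt G (G' u) u) (hc : Tendsto G' atTop (𝓝 c)) :
    Tendsto (fun u => G u / u) atTop (𝓝 c) := by
  have hlo : (fun u => G u - c * u) =o[atTop] fun u => u := by
    rw [Asymptotics.isLittleO_iff]
    intro ε hε
    have h1 : ∀ᶠ u in atTop, ‖G' u - c‖ ≤ ε / 2 := by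
      have := (Metric.tendsto_nhds.1 hc (ε / 2) (by positivity))
      filter_upwards [this] with u hu using hu.le
    obtain ⟨u₀, hu₀⟩ := eventually_atTop.1 h1
    have h2 : ∀ u ≥ u₀, ‖(G u - c * u) - (G u₀ - c * u₀)‖ ≤ ε / 2 * ‖u - u₀‖ := fun u hu =>
      (convex_Ici u₀).norm_image_sub_le_of_norm_hasDerivWithin_le (f := fun u => G u - c * u)
        (f' := fun u => G' u - c)
        (fun x _ => (((hG x).sub ((hasDerivAt_id x).const_mul c)).congr_deriv
          (by simp)).hasDerivWithinAt)
        (fun x hx => hu₀ x hx) self_mem_Ici hu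
    -- The last threshold makes the contributions of the starting point `u₀` at most ε/2 · u.
    filter_upwards [eventually_ge_atTop u₀, eventually_ge_atTop 0,
      eventually_ge_atTop ((‖G u₀ - c * u₀‖ + ε / 2 * ‖u₀‖) * (2 / ε))] with u hu hu0 hu1
    have h3 := h2 u hu
    have h4 : ‖u - u₀‖ ≤ ‖u‖ + ‖u₀‖ := norm_sub_le _ _
    have h5 : ‖G u - c * u‖ ≤ ‖(G u - c * u) - (G u₀ - c * u₀)‖ + ‖G u₀ - c * u₀‖ := by
      simpa using norm_add_le ((G u - c * u) - (G u₀ - c * u₀)) (G u₀ - c * u₀)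
    have h6 : ‖G u₀ - c * u₀‖ + ε / 2 * ‖u₀‖ ≤ ε / 2 * u := by
      have := mul_le_mul_of_nonneg_left hu1 (show 0 ≤ ε / 2 by positivity)
      rwa [show ε / 2 * ((‖G u₀ - c * u₀‖ + ε / 2 * ‖u₀‖) * (2 / ε))
        = ‖G u₀ - c * u₀‖ + ε / 2 * ‖u₀‖ by field_simp] at this
    have h7 : ε / 2 * ‖u - u₀‖ ≤ ε / 2 * (‖u‖ + ‖u₀‖) := by gcongr
    rw [Real.norm_of_nonneg hu0] at h7 ⊢
    linarith
  have h1 := hlo.tendsto_div_nhds_zero.add_const c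
  rw [zero_add] at h1
  refine h1.congr' ?_
  filter_upwards [eventually_ne_atTop 0] with u hu
  field_simp; ring

/-! ### Critical and subcritical averages -/

namespace QuadraticWell

variable {h : ℝ × ℝ → ℝ} {p₀ : ℝ × ℝ} {A B C : ℝ}

/-- Asymptotics of the critical average: `⟨(h + δ)⁻¹⟩ ~ log(1/δ) / (2π √Δ)`. -/
lemma tendsto_powAvg_one_div_log (hw : QuadraticWell h p₀ A B C) :
    Tendsto (fun δ => powAvg h 1 δ / -Real.log δ) (𝓝[>] 0)
      (𝓝 (1 / (2 * Real.pi * √(A * C - B ^ 2)))) := by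
  have hexp : Tendsto (fun u : ℝ => Real.exp (-u)) atTop (𝓝[>] 0) :=
    tendsto_nhdsWithin_iff.2 ⟨Real.tendsto_exp_neg_atTop_nhds_zero,
      Eventually.of_forall fun u => Real.exp_pos _⟩
  -- In the variable u = -log δ the derivative of ⟨(h+δ)⁻¹⟩ is δ⟨(h+δ)⁻²⟩, whose limit is the
  -- supercritical case r = 2.
  have h1 : Tendsto (fun u : ℝ => Real.exp (-u) * powAvg h 2 (Real.exp (-u))) atTop
      (𝓝 (1 / (2 * Real.pi * √(A * C - B ^ 2)))) := by
    have := (hw.tendsto_rpow_mul_powAvg (r := 2) (by norm_num)).comp hexp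
    norm_num [Function.comp_def] at this
    simpa using this
  have h2 := tendsto_div_id_of_tendsto_deriv (G := fun u => powAvg h 1 (Real.exp (-u)))
    (fun u => ?_) h1
  · have h3 : Tendsto (fun δ : ℝ => -Real.log δ) (𝓝[>] 0) atTop :=
      tendsto_neg_atBot_atTop.comp Real.tendsto_log_nhdsGT_zero
    refine (h2.comp h3).congr' ?_
    filter_upwards [self_mem_nhdsWithin] with δ hδ
    simp [Real.exp_log hδ]
  · have h4 := hw.hasDerivAt_powAvg (r := 1) zero_le_one (Real.exp_pos (-u))
    have h5 : HasDerivAt (fun u : ℝ => Real.exp (-u)) (-Real.exp (-u)) u := by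
      exact ((Real.hasDerivAt_exp (-u)).comp u (hasDerivAt_neg u)).congr_deriv (by ring)
    refine (h4.comp u h5).congr_deriv ?_
    norm_num; ring

/-- The zeros lie in a single orbit of the period lattice, a countable set. -/
lemma ae_pos (hw : QuadraticWell h p₀ A B C) : ∀ᵐ p : ℝ × ℝ, 0 < h p := by
  have hcount : {p : ℝ × ℝ | SamePoint p₀ p}.Countable := by
    refine (countable_range fun k : ℤ × ℤ =>
      ((p₀.1 + k.1 * (2 * Real.pi), p₀.2 + k.2 * (2 * Real.pi)) : ℝ × ℝ)).mono ?_
    rintro p ⟨k, l, rfl⟩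
    exact ⟨(k, l), rfl⟩
  filter_upwards [compl_mem_ae_iff.2 (hcount.measure_zero volume)] with p hp
  exact lt_of_le_of_ne (hw.nonneg p) fun h0 => hp (hw.eq_zero p h0.symm)

/-- Subcritical averages stay bounded. -/
lemma exists_powAvg_le (hw : QuadraticWell h p₀ A B C) {r : ℝ} (hr : 0 < r) (hr1 : r < 1) :
    ∃ c, ∀ δ ∈ Ioc (0 : ℝ) 1, powAvg h r δ ≤ c := by
  -- Near 0 this is the supercritical limit for the exponent r + 1; away from 0 the crude bound δ⁻¹
  -- suffices.
  obtain ⟨k, hk⟩ : ∃ k, ∀ δ ∈ Ioc (0 : ℝ) 1, δ ^ r * powAvg h (r + 1) δ ≤ k := by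
    have h1 := hw.tendsto_rpow_mul_powAvg (r := r + 1) (by linarith)
    rw [add_sub_cancel_right] at h1
    have h2 := (h1.eventually (ge_mem_nhds (lt_add_one _)))
    obtain ⟨d, hd, hd1⟩ := (mem_nhdsGT_iff_exists_Ioo_subset).1 h2
    refine ⟨max (1 / (2 * Real.pi * √(A * C - B ^ 2)) / r + 1) d⁻¹, fun δ hδ => ?_⟩
    rcases lt_or_ge δ d with h3 | h3
    · exact le_max_of_le_left (hd1 ⟨hδ.1, h3⟩)
    · refine le_max_of_le_right ?_
      calc δ ^ r * powAvg h (r + 1) δ ≤ δ ^ r * δ ^ (-(r + 1)) := by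
            have := hδ.1
            gcongr
            exact hw.powAvg_le (by linarith) hδ.1
        _ = δ⁻¹ := by
            rw [← Real.rpow_add hδ.1, ← Real.rpow_neg_one]; congr 1; ring
        _ ≤ d⁻¹ := by have hd' : 0 < d := hd; gcongr
  have hk0 : 0 ≤ k := le_trans (mul_nonneg (Real.rpow_nonneg zero_le_one _)
    (hw.powAvg_pos (by linarith) one_pos).le) (hk 1 ⟨one_pos, le_rfl⟩)
  have h1r : 0 < 1 - r := by linarith
  -- The derivative of the average is at least -r k δ^(-r), integrable at 0 because r < 1. Adding
  -- the corresponding primitive gives an increasing function, bounded by its value at 1.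
  have hmono : MonotoneOn (fun δ => powAvg h r δ + r * k / (1 - r) * δ ^ (1 - r)) (Ioc 0 1) := by
    have hder : ∀ δ ∈ Ioc (0 : ℝ) 1,
        HasDerivAt (fun δ => powAvg h r δ + r * k / (1 - r) * δ ^ (1 - r))
        (-r * powAvg h (r + 1) δ + r * k * δ ^ (-r)) δ := by
      intro δ hδ
      refine ((hw.hasDerivAt_powAvg hr.le hδ.1).add
        ((Real.hasDerivAt_rpow_const (p := 1 - r) (Or.inl hδ.1.ne')).const_mul _)).congr_deriv ?_
      rw [show 1 - r - 1 = -r by ring]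
      field_simp
    refine monotoneOn_of_deriv_nonneg (convex_Ioc 0 1)
      (fun δ hδ => (hder δ hδ).continuousAt.continuousWithinAt)
      (fun δ hδ => (hder δ (interior_subset hδ)).differentiableAt.differentiableWithinAt)
      fun δ hδ => ?_
    have hδ' := interior_subset hδ
    rw [(hder δ hδ').deriv]
    have h2 := hk δ hδ'
    have h3 : powAvg h (r + 1) δ ≤ k * δ ^ (-r) := by
      rw [Real.rpow_neg hδ'.1.le, ← div_eq_mul_inv, le_div_iff₀ (Real.rpow_pos_of_pos hδ'.1 _)]
      linarith
    nlinarith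
  refine ⟨powAvg h r 1 + r * k / (1 - r) * 1 ^ (1 - r), fun δ hδ => ?_⟩
  have h1 := hmono hδ ⟨one_pos, le_rfl⟩ hδ.2
  have h2 : 0 ≤ r * k / (1 - r) * δ ^ (1 - r) := by
    have := hδ.1
    positivity
  simp only at h1
  linarith

lemma tendsto_rpow_add (hw : QuadraticWell h p₀ A B C) (r : ℝ) :
    ∀ᵐ p : ℝ × ℝ, Tendsto (fun δ => (h p + δ) ^ (-r)) (𝓝[>] 0) (𝓝 (h p ^ (-r))) := by
  filter_upwards [hw.ae_pos] with p hp
  have h1 : Tendsto (fun δ : ℝ => h p + δ) (𝓝[>] 0) (𝓝 (h p)) := by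
    have : Tendsto (fun δ : ℝ => h p + δ) (𝓝 0) (𝓝 (h p + 0)) :=
      (continuous_const.add continuous_id).tendsto 0
    rw [add_zero] at this
    exact this.mono_left nhdsWithin_le_nhds
  exact h1.rpow_const (Or.inl hp.ne')

/-- Subcritical negative powers of a quadratic well are integrable. -/
lemma integrableOn_rpow_neg (hw : QuadraticWell h p₀ A B C) {r : ℝ} (hr : 0 < r) (hr1 : r < 1) :
    IntegrableOn (fun p => h p ^ (-r)) cell := by
  obtain ⟨c, hc⟩ := hw.exists_powAvg_le hr hr1
  refine ⟨(hw.measurable.pow_const _).aestronglyMeasurable.restrict, ?_⟩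
  -- Fatou's lemma along δ = 1/(n+1) turns the uniform bound on the averages into integrability of
  -- the limit.
  have hseq : Tendsto (fun n : ℕ => 1 / ((n : ℝ) + 1)) atTop (𝓝[>] 0) :=
    tendsto_nhdsWithin_iff.2 ⟨tendsto_one_div_add_atTop_nhds_zero_nat,
      Eventually.of_forall fun n => mem_Ioi.2 (by positivity)⟩
  have hlim : ∀ᵐ p ∂(volume.restrict cell), ‖h p ^ (-r)‖ₑ =
      liminf (fun n : ℕ => ‖(h p + 1 / ((n : ℝ) + 1)) ^ (-r)‖ₑ) atTop := by
    filter_upwards [ae_restrict_of_ae (hw.tendsto_rpow_add r)] with p hp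
    exact ((continuous_enorm.tendsto _).comp (hp.comp hseq)).liminf_eq.symm
  rw [hasFiniteIntegral_iff_enorm, lintegral_congr_ae hlim]
  refine (lintegral_liminf_le' fun n : ℕ =>
    (hw.aestronglyMeasurable_rpow r (1 / ((n : ℝ) + 1))).restrict.enorm).trans_lt ?_
  refine lt_of_le_of_lt (b := ENNReal.ofReal (4 * Real.pi ^ 2 * c)) ?_ ENNReal.ofReal_lt_top
  refine liminf_le_of_le (by isBoundedDefault) fun b hb => ?_
  obtain ⟨n, hn⟩ := hb.exists
  refine hn.trans ?_
  have hn0 : (0 : ℝ) < 1 / ((n : ℝ) + 1) := by positivity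
  rw [← ofReal_integral_norm_eq_lintegral_enorm (hw.integrableOn_rpow hr.le hn0)]
  refine ENNReal.ofReal_le_ofReal ?_
  have h1 := hc (1 / ((n : ℝ) + 1)) ⟨hn0, by
    rw [div_le_one (by positivity)]; linarith [Nat.cast_nonneg (α := ℝ) n]⟩
  have h2 : ∀ p, ‖(h p + 1 / ((n : ℝ) + 1)) ^ (-r)‖ = (h p + 1 / ((n : ℝ) + 1)) ^ (-r) :=
    fun p => Real.norm_of_nonneg (Real.rpow_nonneg (by linarith [hw.nonneg p]) _)
  simp only [h2]
  rw [powAvg, torusAvg, inv_mul_le_iff₀ four_pi_sq_pos] at h1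
  exact h1

/-- Subcritical averages converge to the average of the negative power itself. -/
lemma tendsto_powAvg (hw : QuadraticWell h p₀ A B C) {r : ℝ} (hr : 0 < r) (hr1 : r < 1) :
    Tendsto (powAvg h r) (𝓝[>] 0) (𝓝 (torusAvg fun p => h p ^ (-r))) := by
  refine Tendsto.const_mul _ (tendsto_integral_filter_of_dominated_convergence
    (fun p => h p ^ (-r)) ?_ ?_ (hw.integrableOn_rpow_neg hr hr1)
    (ae_restrict_of_ae (hw.tendsto_rpow_add r)))
  · exact Eventually.of_forall fun δ => (hw.aestronglyMeasurable_rpow r δ).restrict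
  · filter_upwards [self_mem_nhdsWithin] with δ hδ
    filter_upwards [ae_restrict_of_ae hw.ae_pos] with p hp
    have hδ' : 0 < δ := hδ
    rw [Real.norm_of_nonneg (Real.rpow_nonneg (by linarith) _)]
    exact Real.rpow_le_rpow_of_nonpos hp (by linarith) (by linarith)

lemma torusAvg_rpow_pos (hw : QuadraticWell h p₀ A B C) {r : ℝ} (hr : 0 < r) (hr1 : r < 1) :
    0 < torusAvg fun p => h p ^ (-r) := by
  refine lt_of_lt_of_le (hw.powAvg_pos hr.le one_pos) ?_
  refine mul_le_mul_of_nonneg_left ?_ (inv_nonneg.2 four_pi_sq_pos.le)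
  refine integral_mono_ae (hw.integrableOn_rpow hr.le one_pos) (hw.integrableOn_rpow_neg hr hr1) ?_
  filter_upwards [ae_restrict_of_ae hw.ae_pos] with p hp
  exact Real.rpow_le_rpow_of_nonpos hp (by linarith) (by linarith)

end QuadraticWell

/-! ### The scalar equation for `S` -/

/-- The average `⟨(1 + (λ+1) γ₀ s)^(-1/(λ+1))⟩`. -/
def jacAvg (lam : ℝ) (γ₀ : ℝ × ℝ → ℝ) (s : ℝ) : ℝ :=
  torusAvg fun p => (1 + (lam + 1) * γ₀ p * s) ^ (-(1 / (lam + 1)))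

lemma sRate_eq_jacAvg (lam : ℝ) (γ₀ : ℝ × ℝ → ℝ) (s : ℝ) :
    sRate lam γ₀ s = jacAvg lam γ₀ s ^ (-(2 * (lam + 1))) := rfl

/-- The reciprocal of `sRate`, extended by its value at `0` to negative arguments. -/
def slowness (lam : ℝ) (γ₀ : ℝ × ℝ → ℝ) (s : ℝ) : ℝ := (sRate lam γ₀ (max s 0))⁻¹

/-- The time at which a solution of the scalar equation reaches `s`. -/
def travelTime (lam : ℝ) (γ₀ : ℝ × ℝ → ℝ) (s : ℝ) : ℝ := ∫ σ in (0 : ℝ)..s, slowness lam γ₀ σ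

/-- The distance to criticality `δ = 1 / ((λ+1) s) - m`, which vanishes at `s = S_*`. -/
def gap (lam m s : ℝ) : ℝ := 1 / ((lam + 1) * s) - m

/-- Data of the scalar equation: `γ₀ = h - m` with a quadratic well `h` and `m > 0`. -/
structure WellData (lam : ℝ) (γ₀ h : ℝ × ℝ → ℝ) (p₀ : ℝ × ℝ) (m A B C : ℝ) : Prop where
  lam_gt : -(1 / 2) < lam
  m_pos : 0 < m
  well : QuadraticWell h p₀ A B C
  eq_sub : ∀ p, γ₀ p = h p - m

namespace WellData

variable {lam : ℝ} {γ₀ h : ℝ × ℝ → ℝ} {p₀ : ℝ × ℝ} {m A B C : ℝ}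

lemma lam_pos (hd : WellData lam γ₀ h p₀ m A B C) : 0 < lam + 1 := by linarith [hd.lam_gt]

lemma inv_pos (hd : WellData lam γ₀ h p₀ m A B C) : 0 < 1 / (lam + 1) := by
  have := hd.lam_pos; positivity

lemma sStar_eq (hd : WellData lam γ₀ h p₀ m A B C) : sStar lam γ₀ = 1 / ((lam + 1) * m) := by
  have : ⨅ p, γ₀ p = -m := by
    have h1 : IsLeast (range γ₀) (-m) :=
      ⟨⟨p₀, by rw [hd.eq_sub, hd.well.zero]; ring⟩, by
        rintro _ ⟨p, rfl⟩; rw [hd.eq_sub]; linarith [hd.well.nonneg p]⟩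
    exact h1.csInf_eq
  rw [sStar, this]; congr 1; ring

lemma sStar_pos (hd : WellData lam γ₀ h p₀ m A B C) : 0 < sStar lam γ₀ := by
  have := hd.lam_pos
  have := hd.m_pos
  rw [hd.sStar_eq]; positivity

lemma lt_sStar_iff (hd : WellData lam γ₀ h p₀ m A B C) {s : ℝ} :
    s < sStar lam γ₀ ↔ (lam + 1) * m * s < 1 := by
  have := hd.lam_pos
  have := hd.m_pos
  rw [hd.sStar_eq, lt_div_iff₀ (by positivity), mul_comm]

lemma gap_pos (hd : WellData lam γ₀ h p₀ m A B C) {s : ℝ} (h0 : 0 < s) (hs : s < sStar lam γ₀) :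
    0 < gap lam m s := by
  have := hd.lam_pos
  rw [hd.lt_sStar_iff] at hs
  rw [gap, sub_pos, lt_div_iff₀ (by positivity)]
  linarith

/-- The change of variables behind the proof: the factor (λ+1)s is the same at all points, so
averages depend on s through the gap, up to a power of this factor. -/
lemma one_add_eq (hd : WellData lam γ₀ h p₀ m A B C) {s : ℝ} (h0 : 0 < s) (p : ℝ × ℝ) :
    1 + (lam + 1) * γ₀ p * s = (lam + 1) * s * (h p + gap lam m s) := by
  have := hd.lam_pos
  rw [gap, hd.eq_sub]
  field_simp
  ring

lemma base_lower (hd : WellData lam γ₀ h p₀ m A B C) {s s₁ : ℝ} (h0 : 0 ≤ s) (hs : s ≤ s₁)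
    (p : ℝ × ℝ) : 1 - (lam + 1) * m * s₁ ≤ 1 + (lam + 1) * γ₀ p * s := by
  have h1 := hd.lam_pos
  have h2 := hd.m_pos
  have h3 := hd.well.nonneg p
  have h4 : 0 ≤ (lam + 1) * h p * s := by positivity
  have h5 : (lam + 1) * m * s ≤ (lam + 1) * m * s₁ := by gcongr
  rw [hd.eq_sub]
  nlinarith

lemma base_pos (hd : WellData lam γ₀ h p₀ m A B C) {s : ℝ} (h0 : 0 ≤ s) (hs : s < sStar lam γ₀)
    (p : ℝ × ℝ) : 0 < 1 + (lam + 1) * γ₀ p * s := by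
  have := hd.base_lower h0 le_rfl p
  rw [hd.lt_sStar_iff] at hs
  linarith

lemma measurable (hd : WellData lam γ₀ h p₀ m A B C) : AEMeasurable γ₀ volume := by
  rw [show γ₀ = fun p => h p - m from funext hd.eq_sub]
  exact hd.well.measurable.sub_const m

lemma aestronglyMeasurable_base (hd : WellData lam γ₀ h p₀ m A B C) (s : ℝ) :
    AEStronglyMeasurable (fun p => (1 + (lam + 1) * γ₀ p * s) ^ (-(1 / (lam + 1)))) volume :=
  ((((hd.measurable.const_mul _).mul_const s).const_add 1).pow_const _).aestronglyMeasurable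

lemma norm_base_le (hd : WellData lam γ₀ h p₀ m A B C) {s s₁ : ℝ} (h0 : 0 ≤ s) (hs : s ≤ s₁)
    (hs₁ : s₁ < sStar lam γ₀) (p : ℝ × ℝ) :
    ‖(1 + (lam + 1) * γ₀ p * s) ^ (-(1 / (lam + 1)))‖
      ≤ (1 - (lam + 1) * m * s₁) ^ (-(1 / (lam + 1))) := by
  have h1 := hd.base_lower h0 hs p
  rw [hd.lt_sStar_iff] at hs₁
  rw [Real.norm_of_nonneg (Real.rpow_nonneg (by linarith) _)]
  exact Real.rpow_le_rpow_of_nonpos (by linarith) h1 (by linarith [hd.inv_pos])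

lemma jacAvg_pos (hd : WellData lam γ₀ h p₀ m A B C) {s : ℝ} (h0 : 0 ≤ s)
    (hs : s < sStar lam γ₀) : 0 < jacAvg lam γ₀ s :=
  torusAvg_pos (Measure.integrableOn_of_bounded volume_cell_lt_top.ne
    (hd.aestronglyMeasurable_base s) (ae_of_all _ (hd.norm_base_le h0 le_rfl hs)))
    fun p => Real.rpow_pos_of_pos (hd.base_pos h0 hs p) _

lemma sRate_pos (hd : WellData lam γ₀ h p₀ m A B C) {s : ℝ} (h0 : 0 ≤ s)
    (hs : s < sStar lam γ₀) : 0 < sRate lam γ₀ s :=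
  Real.rpow_pos_of_pos (hd.jacAvg_pos h0 hs) _

lemma sRate_zero : sRate lam γ₀ 0 = 1 := by
  simp only [sRate, mul_zero, add_zero, Real.one_rpow, torusAvg_const]

/-- On [0, s₁] with s₁ < S_* the base of the power is bounded away from 0 uniformly in space, which
gives a constant majorant. -/
lemma continuousOn_jacAvg (hd : WellData lam γ₀ h p₀ m A B C) :
    ContinuousOn (jacAvg lam γ₀) (Ico 0 (sStar lam γ₀)) := by
  intro s hs
  obtain ⟨s₁, h1, h2⟩ := exists_between hs.2
  have : ContinuousOn (jacAvg lam γ₀) (Icc 0 s₁) := by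
    refine ContinuousOn.mul continuousOn_const (MeasureTheory.continuousOn_of_dominated
      (bound := fun _ => (1 - (lam + 1) * m * s₁) ^ (-(1 / (lam + 1))))
      (fun s _ => (hd.aestronglyMeasurable_base s).restrict)
      (fun s hs => ae_of_all _ (hd.norm_base_le hs.1 hs.2 h2))
      (integrable_const _) (ae_of_all _ fun p s hs => ?_))
    refine ContinuousWithinAt.rpow_const (by fun_prop) (Or.inl ?_)
    exact (hd.base_pos hs.1 (hs.2.trans_lt h2) p).ne'
  refine (this s ⟨hs.1, h1.le⟩).mono_of_mem_nhdsWithin ?_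
  rw [mem_nhdsWithin]
  exact ⟨Iio s₁, isOpen_Iio, h1, fun x hx => ⟨hx.2.1, le_of_lt hx.1⟩⟩

lemma slowness_pos (hd : WellData lam γ₀ h p₀ m A B C) {s : ℝ} (hs : s < sStar lam γ₀) :
    0 < slowness lam γ₀ s :=
  _root_.inv_pos.2 (hd.sRate_pos (le_max_right _ _) (max_lt hs hd.sStar_pos))

lemma continuousOn_slowness (hd : WellData lam γ₀ h p₀ m A B C) :
    ContinuousOn (slowness lam γ₀) (Iio (sStar lam γ₀)) := by
  have h1 : ContinuousOn (sRate lam γ₀) (Ico 0 (sStar lam γ₀)) := fun s hs =>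
    (hd.continuousOn_jacAvg s hs).rpow_const (Or.inl (hd.jacAvg_pos hs.1 hs.2).ne')
  have h2 : ContinuousOn (fun s => sRate lam γ₀ (max s 0)) (Iio (sStar lam γ₀)) :=
    h1.comp (by fun_prop) fun s hs => ⟨le_max_right _ _, max_lt hs hd.sStar_pos⟩
  exact h2.inv₀ fun s hs => (hd.sRate_pos (le_max_right _ _) (max_lt hs hd.sStar_pos)).ne'

lemma hasDerivAt_travelTime (hd : WellData lam γ₀ h p₀ m A B C) {s : ℝ}
    (hs : s < sStar lam γ₀) : HasDerivAt (travelTime lam γ₀) (slowness lam γ₀ s) s := by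
  have hc := hd.continuousOn_slowness
  refine intervalIntegral.integral_hasDerivAt_right (hc.mono ?_).intervalIntegrable
    (hc.stronglyMeasurableAtFilter isOpen_Iio _ hs) (hc.continuousAt (Iio_mem_nhds hs))
  intro x hx
  rw [mem_Iio]
  exact hx.2.trans_lt (max_lt hd.sStar_pos hs)

lemma strictMonoOn_travelTime (hd : WellData lam γ₀ h p₀ m A B C) :
    StrictMonoOn (travelTime lam γ₀) (Iio (sStar lam γ₀)) := by
  refine strictMonoOn_of_deriv_pos (convex_Iio _)
    (fun s hs => (hd.hasDerivAt_travelTime hs).continuousAt.continuousWithinAt) fun s hs => ?_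
  rw [interior_Iio] at hs
  rw [(hd.hasDerivAt_travelTime hs).deriv]
  exact hd.slowness_pos hs

lemma travelTime_zero : travelTime lam γ₀ 0 = 0 := intervalIntegral.integral_same

lemma sRate_eq (hd : WellData lam γ₀ h p₀ m A B C) {s : ℝ} (h0 : 0 < s) (hs : s < sStar lam γ₀) :
    sRate lam γ₀ s = ((lam + 1) * s) ^ 2
      * powAvg h (1 / (lam + 1)) (gap lam m s) ^ (-(2 * (lam + 1))) := by
  have hl := hd.lam_pos
  have hg := hd.gap_pos h0 hs
  have has : 0 < (lam + 1) * s := by positivity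
  have h1 : jacAvg lam γ₀ s
      = ((lam + 1) * s) ^ (-(1 / (lam + 1))) * powAvg h (1 / (lam + 1)) (gap lam m s) := by
    rw [jacAvg, powAvg, ← torusAvg_const_mul]
    congr 1; ext p
    rw [hd.one_add_eq h0, Real.mul_rpow has.le (by linarith [hd.well.nonneg p])]
  rw [sRate_eq_jacAvg, h1, Real.mul_rpow (Real.rpow_nonneg has.le _)
    (hd.well.powAvg_pos hd.inv_pos.le hg).le, ← Real.rpow_mul has.le]
  congr 1
  rw [show -(1 / (lam + 1)) * -(2 * (lam + 1)) = (2 : ℕ) by field_simp; norm_num,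
    Real.rpow_natCast]

lemma hasDerivAt_gap (hd : WellData lam γ₀ h p₀ m A B C) {s : ℝ} (h0 : 0 < s) :
    HasDerivAt (gap lam m) (-((lam + 1) / ((lam + 1) * s) ^ 2)) s := by
  have hl := hd.lam_pos
  have h1 : HasDerivAt (fun s => (lam + 1) * s) (lam + 1) s := by
    simpa using (hasDerivAt_id s).const_mul (lam + 1)
  have h2 := (h1.inv (by positivity)).sub_const m
  refine (h2.congr_deriv (by ring)).congr_of_eventuallyEq (Eventually.of_forall fun x => ?_)
  simp [gap]

lemma tendsto_gap (hd : WellData lam γ₀ h p₀ m A B C) :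
    Tendsto (gap lam m) (𝓝[<] (sStar lam γ₀)) (𝓝[>] 0) := by
  have h0 := hd.sStar_pos
  refine tendsto_nhdsWithin_iff.2 ⟨?_, ?_⟩
  · have h1 := (hd.hasDerivAt_gap h0).continuousAt.tendsto.mono_left
      (nhdsWithin_le_nhds (s := Iio (sStar lam γ₀)))
    have h2 : gap lam m (sStar lam γ₀) = 0 := by
      have := hd.lam_pos
      have := hd.m_pos
      rw [gap, hd.sStar_eq]; field_simp; ring
    rwa [h2] at h1
  · filter_upwards [Ioo_mem_nhdsLT h0] with s hs using hd.gap_pos hs.1 hs.2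

/-- Values of solutions of the scalar equation stay in `[0, S_*)`. -/
lemma solution_nonneg {T : ℝ} {S : ℝ → ℝ} (hS : IsSolutionUpTo lam γ₀ T S) {t : ℝ}
    (ht : t ∈ Ico 0 T) : 0 ≤ S t := by
  have hsub : Icc 0 t ⊆ Ico 0 T := fun x hx => ⟨hx.1, hx.2.trans_lt ht.2⟩
  -- Wherever S = 0 its derivative is `sRate lam γ₀ 0` = 1 > 0, so -S cannot cross the barrier 0
  -- upwards.
  have key := image_le_of_deriv_right_lt_deriv_boundary (f := fun x => -S x)
    (f' := fun x => -sRate lam γ₀ (S x)) (a := 0) (b := t)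
    (fun x hx => ((hS.ode x (hsub hx)).continuousWithinAt.mono hsub).neg)
    (fun x hx => ?_) (B := fun _ => 0) (B' := fun _ => 0) (by simp [hS.zero])
    (fun x => hasDerivAt_const _ _) (fun x hx h0 => ?_) (right_mem_Icc.2 ht.1)
  · simpa using key
  · refine ((hS.ode x (hsub (Ico_subset_Icc_self hx))).neg).mono_of_mem_nhdsWithin ?_
    have : x < T := hx.2.trans ht.2
    filter_upwards [Ico_mem_nhdsGE this] with y hy using ⟨hx.1.trans hy.1, hy.2⟩
  · have : S x = 0 := by simpa using h0
    rw [this, sRate_zero]; norm_num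

/-- Separation of variables. As the travel time is strictly increasing, this determines the solution
and takes the place of a Lipschitz uniqueness theorem. -/
lemma travelTime_solution (hd : WellData lam γ₀ h p₀ m A B C) {T : ℝ} {S : ℝ → ℝ}
    (hS0 : S 0 = 0) (hode : ∀ t ∈ Ico 0 T, HasDerivWithinAt S (sRate lam γ₀ (S t)) (Ico 0 T) t)
    (hnn : ∀ t ∈ Ico 0 T, 0 ≤ S t) (hlt : ∀ t ∈ Ico 0 T, S t < sStar lam γ₀) {t : ℝ}
    (ht : t ∈ Ico 0 T) : travelTime lam γ₀ (S t) = t := by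
  have hder : ∀ x ∈ Ico 0 T,
      HasDerivWithinAt (fun x => travelTime lam γ₀ (S x) - x) 0 (Ico 0 T) x := by
    intro x hx
    have h1 := (hd.hasDerivAt_travelTime (hlt x hx)).comp_hasDerivWithinAt x (hode x hx)
    have h2 := h1.sub (hasDerivWithinAt_id x (Ico 0 T))
    refine h2.congr_deriv ?_
    have h3 := hd.sRate_pos (hnn x hx) (hlt x hx)
    rw [slowness, max_eq_left (hnn x hx), inv_mul_cancel₀ h3.ne', sub_self]
  have h0 : (0 : ℝ) ∈ Ico 0 T := ⟨le_rfl, ht.1.trans_lt ht.2⟩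
  have := (convex_Ico 0 T).norm_image_sub_le_of_norm_hasDerivWithin_le (C := 0) hder
    (fun x _ => by simp) h0 ht
  simp only [zero_mul, norm_le_zero_iff, hS0, travelTime_zero, sub_zero] at this
  linarith

/-! ### Time profiles -/

/-- A primitive of the reciprocal speed of the gap, up to a factor tending to `1`. -/
def IsTimeProfile (lam : ℝ) (h : ℝ × ℝ → ℝ) (f f' : ℝ → ℝ) : Prop :=
  (∀ᶠ δ in 𝓝[>] 0, HasDerivAt f (f' δ) δ) ∧ Tendsto f (𝓝[>] 0) (𝓝 0) ∧
    Tendsto (fun δ => (lam + 1) * f' δ * powAvg h (1 / (lam + 1)) δ ^ (-(2 * (lam + 1))))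
      (𝓝[>] 0) (𝓝 1)

/-- Finiteness of the singularity time. The product (λ+1) f' K^(-2(λ+1)) tends to 1, so near S_* it
is at least 1/2 and the reciprocal speed of the gap is at most 2f'. Hence the travel time plus
2f(gap) decreases there, while f(gap) tends to 0. -/
lemma bddAbove_travelTime (hd : WellData lam γ₀ h p₀ m A B C) {f f' : ℝ → ℝ}
    (hf : IsTimeProfile lam h f f') : BddAbove (travelTime lam γ₀ '' Iio (sStar lam γ₀)) := by
  obtain ⟨hf1, hf2, hf3⟩ := hf
  have hl := hd.lam_pos
  have hS := hd.sStar_pos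
  have hgap := hd.tendsto_gap
  have e1 := hgap.eventually hf1
  have e2 := (hf2.comp hgap).eventually (le_mem_nhds (show (-1 : ℝ) < 0 by norm_num))
  have e3 := (hf3.comp hgap).eventually (le_mem_nhds (show (1 / 2 : ℝ) < 1 by norm_num))
  obtain ⟨s₁, hs₁, hI⟩ := (mem_nhdsLT_iff_exists_Ioo_subset' hS).1
    ((e1.and (e2.and e3)).and (Ioo_mem_nhdsLT hS))
  have hder : ∀ s ∈ Ioo s₁ (sStar lam γ₀),
      HasDerivAt (fun s => travelTime lam γ₀ s + 2 * f (gap lam m s))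
        (slowness lam γ₀ s + 2 * (f' (gap lam m s) * (-((lam + 1) / ((lam + 1) * s) ^ 2)))) s := by
    intro s hs
    obtain ⟨⟨h1, -, -⟩, h4⟩ := hI hs
    exact (hd.hasDerivAt_travelTime h4.2).add ((h1.comp s (hd.hasDerivAt_gap h4.1)).const_mul 2)
  have hanti : AntitoneOn (fun s => travelTime lam γ₀ s + 2 * f (gap lam m s))
      (Ioo s₁ (sStar lam γ₀)) := by
    refine antitoneOn_of_deriv_nonpos (convex_Ioo _ _)
      (fun s hs => (hder s hs).continuousAt.continuousWithinAt)
      (fun s hs => (hder s (interior_subset hs)).differentiableAt.differentiableWithinAt)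
      fun s hs => ?_
    have hs' := interior_subset hs
    rw [(hder s hs').deriv]
    obtain ⟨⟨-, -, h3⟩, h4⟩ := hI hs'
    have hK := hd.well.powAvg_pos hd.inv_pos.le (hd.gap_pos h4.1 h4.2)
    simp only [Function.comp] at h3
    rw [slowness, max_eq_left h4.1.le, hd.sRate_eq h4.1 h4.2, Real.rpow_neg hK.le]
    rw [Real.rpow_neg hK.le] at h3
    have hKp := Real.rpow_pos_of_pos hK (2 * (lam + 1))
    set P := powAvg h (1 / (lam + 1)) (gap lam m s) ^ (2 * (lam + 1))
    have has : 0 < (lam + 1) * s := mul_pos hl h4.1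
    rw [← div_eq_mul_inv, le_div_iff₀ hKp] at h3
    have : (((lam + 1) * s) ^ 2 * P⁻¹)⁻¹
        + 2 * (f' (gap lam m s) * -((lam + 1) / ((lam + 1) * s) ^ 2))
        = (P - 2 * ((lam + 1) * f' (gap lam m s))) / ((lam + 1) * s) ^ 2 := by
      field_simp
      ring
    rw [this]
    exact div_nonpos_of_nonpos_of_nonneg (by linarith) (by positivity)
  obtain ⟨s₂, hs₂, hs₂'⟩ := exists_between (show s₁ < sStar lam γ₀ from hs₁)
  -- The final 2 comes from f ≥ -1 near S_*.
  refine ⟨travelTime lam γ₀ s₂ + 2 * f (gap lam m s₂) + 2, ?_⟩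
  have hbig : ∀ s ∈ Ioo s₂ (sStar lam γ₀),
      travelTime lam γ₀ s ≤ travelTime lam γ₀ s₂ + 2 * f (gap lam m s₂) + 2 := by
    intro s hs
    have h1 := hanti ⟨hs₂, hs₂'⟩ ⟨hs₂.trans hs.1, hs.2⟩ hs.1.le
    have h2 := (hI (show s ∈ Ioo s₁ _ from ⟨hs₂.trans hs.1, hs.2⟩)).1.2.1
    simp only [Function.comp] at h1 h2
    linarith
  rintro _ ⟨s, hs, rfl⟩
  obtain ⟨s₃, h3, h3'⟩ := exists_between (max_lt hs₂' hs)
  have h4 := hbig s₃ ⟨(le_max_left _ _).trans_lt h3, h3'⟩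
  exact (hd.strictMonoOn_travelTime.monotoneOn hs h3' ((le_max_right _ _).trans h3.le)).trans h4

lemma tendsto_travelTime (hd : WellData lam γ₀ h p₀ m A B C) {f f' : ℝ → ℝ}
    (hf : IsTimeProfile lam h f f') :
    Tendsto (travelTime lam γ₀) (𝓝[<] (sStar lam γ₀))
      (𝓝 (sSup (travelTime lam γ₀ '' Iio (sStar lam γ₀)))) :=
  hd.strictMonoOn_travelTime.monotoneOn.tendsto_nhdsLT (hd.bddAbove_travelTime hf)

/-- The solution is the inverse function of the travel time. -/
lemma exists_solution (hd : WellData lam γ₀ h p₀ m A B C) {f f' : ℝ → ℝ}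
    (hf : IsTimeProfile lam h f f') :
    IsSingularityTime lam γ₀ (sSup (travelTime lam γ₀ '' Iio (sStar lam γ₀))) := by
  set T := sSup (travelTime lam γ₀ '' Iio (sStar lam γ₀)) with hT
  have hbdd := hd.bddAbove_travelTime hf
  have hmono := hd.strictMonoOn_travelTime
  have hpos := hd.sStar_pos
  have hlt : ∀ s < sStar lam γ₀, travelTime lam γ₀ s < T := by
    intro s hs
    obtain ⟨s', h1, h2⟩ := exists_between hs
    exact (hmono hs h2 h1).trans_le (le_csSup hbdd ⟨s', h2, rfl⟩)
  have hT0 : 0 < T := by simpa [travelTime_zero] using hlt 0 hpos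
  have hcont : ContinuousOn (travelTime lam γ₀) (Iio (sStar lam γ₀)) :=
    fun s hs => (hd.hasDerivAt_travelTime hs).continuousAt.continuousWithinAt
  -- The slowness is 1 at negative arguments, so the travel time is the identity there. The inverse
  -- therefore exists on both sides of t = 0 and can be differentiated at t = 0.
  have hneg : ∀ s ≤ 0, travelTime lam γ₀ s = s := by
    intro s hs
    have h1 : EqOn (slowness lam γ₀) (fun _ => 1) (uIcc 0 s) := fun x hx => by
      rw [uIcc_of_ge hs] at hx
      simp [slowness, max_eq_right hx.2, sRate_zero]
    rw [travelTime, intervalIntegral.integral_congr h1]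
    simp
  have hsurj : ∀ t < T, ∃ s ∈ Iio (sStar lam γ₀), travelTime lam γ₀ s = t := by
    intro t ht
    obtain ⟨_, ⟨s, hs, rfl⟩, h1⟩ := exists_lt_of_lt_csSup 
      ⟨travelTime lam γ₀ 0, mem_image_of_mem _ (mem_Iio.2 hpos)⟩ ht
    have h2 : t ∈ Icc (travelTime lam γ₀ (min t 0 ⊓ s)) (travelTime lam γ₀ s) := by
      refine ⟨?_, h1.le⟩
      rw [hneg _ (inf_le_left.trans (min_le_right _ _))]
      exact inf_le_left.trans (min_le_left _ _)
    have h3 : Icc (min t 0 ⊓ s) s ⊆ Iio (sStar lam γ₀) := fun x hx => lt_of_le_of_lt hx.2 hs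
    obtain ⟨x, hx, hxt⟩ := intermediate_value_Icc inf_le_right (hcont.mono h3) h2
    exact ⟨x, h3 hx, hxt⟩
  set S := Function.invFunOn (travelTime lam γ₀) (Iio (sStar lam γ₀)) with hSdef
  have hSmem : ∀ t < T, S t < sStar lam γ₀ := fun t ht => Function.invFunOn_mem (hsurj t ht)
  have hSeq : ∀ t < T, travelTime lam γ₀ (S t) = t := fun t ht =>
    Function.invFunOn_eq (hsurj t ht)
  have hSinv : ∀ s < sStar lam γ₀, S (travelTime lam γ₀ s) = s := fun s hs =>
    hmono.injOn.leftInvOn_invFunOn hs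
  have hS0 : S 0 = 0 := by simpa [travelTime_zero] using hSinv 0 hpos
  have hSmono : StrictMonoOn S (Iio T) := by
    intro t ht t' ht' htt
    rw [← hSeq t ht, ← hSeq t' ht'] at htt
    exact (hmono.lt_iff_lt (hSmem t ht) (hSmem t' ht')).1 htt
  have hSimg : S '' Iio T = Iio (sStar lam γ₀) := by
    ext s
    constructor
    · rintro ⟨t, ht, rfl⟩; exact hSmem t ht
    · intro hs; exact ⟨_, hlt s hs, hSinv s hs⟩
  have hScont : ∀ t < T, ContinuousAt S t := fun t ht =>
    hSmono.continuousAt_of_image_mem_nhds (Iio_mem_nhds ht)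
      (by rw [hSimg]; exact Iio_mem_nhds (hSmem t ht))
  refine ⟨S, hT0, hS0, fun t ht => ?_, fun t ht => hSmem t ht.2, ?_⟩
  · have hnn : 0 ≤ S t := by
      rw [← hS0]; exact hSmono.monotoneOn hT0 ht.2 ht.1
    have h1 := HasDerivAt.of_local_left_inverse (hScont t ht.2)
      (hd.hasDerivAt_travelTime (hSmem t ht.2)) (hd.slowness_pos (hSmem t ht.2)).ne'
      (by filter_upwards [Iio_mem_nhds ht.2] with y hy using hSeq y hy)
    rw [slowness, inv_inv, max_eq_left hnn] at h1
    exact h1.hasDerivWithinAt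
  · have := hSmono.monotoneOn.tendsto_nhdsLT (by rw [hSimg]; exact bddAbove_Iio)
    rwa [hSimg, csSup_Iio] at this

/-- For any solution the travel time of S(t) is t; both sides are compared in the limit t → T. -/
lemma singularityTime_unique (hd : WellData lam γ₀ h p₀ m A B C) {f f' : ℝ → ℝ}
    (hf : IsTimeProfile lam h f f') {T : ℝ} (hT : IsSingularityTime lam γ₀ T) :
    T = sSup (travelTime lam γ₀ '' Iio (sStar lam γ₀)) := by
  obtain ⟨S, hS⟩ := hT
  have h1 : Tendsto S (𝓝[<] T) (𝓝[<] (sStar lam γ₀)) := by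
    refine tendsto_nhdsWithin_iff.2 ⟨hS.reach, ?_⟩
    filter_upwards [Ioo_mem_nhdsLT hS.pos] with t ht using hS.before t (Ioo_subset_Ico_self ht)
  have h2 := (hd.tendsto_travelTime hf).comp h1
  have h3 : Tendsto (fun t : ℝ => t) (𝓝[<] T) (𝓝 T) := nhdsWithin_le_nhds
  refine tendsto_nhds_unique (h3.congr' ?_) h2
  filter_upwards [Ioo_mem_nhdsLT hS.pos] with t ht
  exact (hd.travelTime_solution hS.zero hS.ode (fun t ht => solution_nonneg hS ht) hS.before
    (Ioo_subset_Ico_self ht)).symm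

/-- Uniqueness for the scalar equation. -/
lemma solution_unique (hd : WellData lam γ₀ h p₀ m A B C) {T T' : ℝ} {S S' : ℝ → ℝ}
    (hS : IsSolutionUpTo lam γ₀ T S) (hS0 : S' 0 = 0)
    (hode : ∀ t ∈ Ico 0 T', HasDerivWithinAt S' (sRate lam γ₀ (S' t)) (Ico 0 T') t)
    (hnn : ∀ t ∈ Ico 0 T', 0 ≤ S' t) (hlt : ∀ t ∈ Ico 0 T', S' t < sStar lam γ₀) {t : ℝ}
    (ht : t ∈ Ico 0 T) (ht' : t ∈ Ico 0 T') : S' t = S t :=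
  hd.strictMonoOn_travelTime.injOn (hlt t ht') (hS.before t ht) <| by
    rw [hd.travelTime_solution hS0 hode hnn hlt ht', hd.travelTime_solution hS.zero hS.ode
      (fun t ht => solution_nonneg hS ht) hS.before ht]

/-! ### The gap along a solution -/

section Solution

variable {T : ℝ} {S : ℝ → ℝ}

lemma solution_hasDerivAt (hS : IsSolutionUpTo lam γ₀ T S) {t : ℝ} (ht : t ∈ Ioo 0 T) :
    HasDerivAt S (sRate lam γ₀ (S t)) t :=
  (hS.ode t (Ioo_subset_Ico_self ht)).hasDerivAt (Ico_mem_nhds ht.1 ht.2)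

lemma solution_pos (hd : WellData lam γ₀ h p₀ m A B C) (hS : IsSolutionUpTo lam γ₀ T S) {t : ℝ}
    (ht : t ∈ Ioo 0 T) : 0 < S t := by
  refine lt_of_le_of_ne (solution_nonneg hS (Ioo_subset_Ico_self ht)) fun h0 => ?_
  have := hd.travelTime_solution hS.zero hS.ode (fun t ht => solution_nonneg hS ht) hS.before
    (Ioo_subset_Ico_self ht)
  rw [← h0, travelTime_zero] at this
  exact ht.1.ne this

lemma solution_gap_pos (hd : WellData lam γ₀ h p₀ m A B C) (hS : IsSolutionUpTo lam γ₀ T S)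
    {t : ℝ} (ht : t ∈ Ioo 0 T) : 0 < gap lam m (S t) :=
  hd.gap_pos (hd.solution_pos hS ht) (hS.before t (Ioo_subset_Ico_self ht))

/-- The factor ((λ+1)S)² of the rate cancels against the derivative of the gap, leaving an
autonomous equation. -/
lemma hasDerivAt_gap_solution (hd : WellData lam γ₀ h p₀ m A B C)
    (hS : IsSolutionUpTo lam γ₀ T S) {t : ℝ} (ht : t ∈ Ioo 0 T) :
    HasDerivAt (fun t => gap lam m (S t))
      (-((lam + 1) * powAvg h (1 / (lam + 1)) (gap lam m (S t)) ^ (-(2 * (lam + 1))))) t := by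
  have hl := hd.lam_pos
  have h0 := hd.solution_pos hS ht
  refine ((hd.hasDerivAt_gap h0).comp t (solution_hasDerivAt hS ht)).congr_deriv ?_
  rw [hd.sRate_eq h0 (hS.before t (Ioo_subset_Ico_self ht))]
  field_simp

lemma tendsto_gap_solution (hd : WellData lam γ₀ h p₀ m A B C)
    (hS : IsSolutionUpTo lam γ₀ T S) :
    Tendsto (fun t => gap lam m (S t)) (𝓝[<] T) (𝓝[>] 0) := by
  refine hd.tendsto_gap.comp (tendsto_nhdsWithin_iff.2 ⟨hS.reach, ?_⟩)
  filter_upwards [Ioo_mem_nhdsLT hS.pos] with t ht using hS.before t (Ioo_subset_Ico_self ht)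

/-- The remaining time is equivalent to the time profile of the gap. -/
lemma tendsto_profile_div (hd : WellData lam γ₀ h p₀ m A B C)
    (hS : IsSolutionUpTo lam γ₀ T S) {f f' : ℝ → ℝ} (hf : IsTimeProfile lam h f f') :
    Tendsto (fun t => f (gap lam m (S t)) / (T - t)) (𝓝[<] T) (𝓝 1) := by
  obtain ⟨hf1, hf2, hf3⟩ := hf
  have hg := hd.tendsto_gap_solution hS
  have hmem := Ioo_mem_nhdsLT hS.pos
  -- Numerator and denominator vanish at T, and the quotient of their derivatives is (λ+1) f'
  -- K^(-2(λ+1)), which tends to 1 for a time profile.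
  refine HasDerivAt.lhopital_zero_nhdsLT
    (f' := fun t => f' (gap lam m (S t)) *
      (-((lam + 1) * powAvg h (1 / (lam + 1)) (gap lam m (S t)) ^ (-(2 * (lam + 1))))))
    (g' := fun _ => -1) ?_ ?_ ?_ (hf2.comp hg) ?_ ?_
  · filter_upwards [hg.eventually hf1, hmem] with t h1 ht
    exact h1.comp t (hd.hasDerivAt_gap_solution hS ht)
  · exact Eventually.of_forall fun t => by simpa using (hasDerivAt_id t).const_sub T
  · exact Eventually.of_forall fun t => by norm_num
  · have : Tendsto (fun t => T - t) (𝓝 T) (𝓝 (T - T)) :=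
      (continuous_const.sub continuous_id).tendsto T
    rw [sub_self] at this
    exact this.mono_left nhdsWithin_le_nhds
  · refine (hf3.comp hg).congr fun t => ?_
    simp only [Function.comp]; ring

end Solution

end WellData

/-! ### The fields as functions of elevation and gap -/

/-- The stretching rate on the pathline starting at elevation `x` above the minimum, in terms of
the gap `δ`. -/
def stretchVal (lam : ℝ) (h : ℝ × ℝ → ℝ) (x δ : ℝ) : ℝ :=
  powAvg h (1 / (lam + 1)) δ ^ (-(2 * (lam + 1))) *
    (powAvg h (1 / (lam + 1) + 1) δ / powAvg h (1 / (lam + 1)) δ - 1 / (x + δ))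

/-- The amplification of the vorticity on the pathline starting at elevation `x` above the minimum,
in terms of the gap `δ`. -/
def vortVal (lam : ℝ) (h : ℝ × ℝ → ℝ) (x δ : ℝ) : ℝ :=
  (x + δ) ^ (1 / (lam + 1)) * powAvg h (1 / (lam + 1)) δ

lemma tendsto_rpow_nhdsGT_zero {r : ℝ} (hr : 0 < r) :
    Tendsto (fun x : ℝ => x ^ r) (𝓝[>] 0) (𝓝 0) := by
  have := (Real.continuousAt_rpow_const 0 r (Or.inr hr.le)).tendsto
  rw [Real.zero_rpow hr.ne'] at this
  exact this.mono_left nhdsWithin_le_nhds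

lemma tendsto_id_nhdsGT_zero : Tendsto (fun x : ℝ => x) (𝓝[>] 0) (𝓝 0) := nhdsWithin_le_nhds

lemma tendsto_div_add {x : ℝ} (hx : 0 < x) :
    Tendsto (fun δ : ℝ => δ / (x + δ)) (𝓝[>] 0) (𝓝 0) := by
  have h1 : Tendsto (fun δ : ℝ => x + δ) (𝓝[>] 0) (𝓝 (x + 0)) :=
    tendsto_id_nhdsGT_zero.const_add x
  rw [add_zero] at h1
  have h2 := tendsto_id_nhdsGT_zero.div h1 hx.ne'
  rw [zero_div] at h2
  exact h2

namespace WellData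

variable {lam : ℝ} {γ₀ h : ℝ × ℝ → ℝ} {p₀ : ℝ × ℝ} {m A B C : ℝ}

lemma coef_pos (hd : WellData lam γ₀ h p₀ m A B C) :
    0 < 1 / (2 * Real.pi * √(A * C - B ^ 2)) := by
  have := Real.sqrt_pos.2 hd.well.det_pos
  have := Real.pi_pos
  positivity

lemma powAvg_pos (hd : WellData lam γ₀ h p₀ m A B C) {δ : ℝ} (hδ : 0 < δ) :
    0 < powAvg h (1 / (lam + 1)) δ := hd.well.powAvg_pos hd.inv_pos.le hδ

/-- The exponent 1/(λ+1) + 1 exceeds 1, so this average is supercritical in all three regimes. -/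
lemma tendsto_powAvg_succ (hd : WellData lam γ₀ h p₀ m A B C) :
    Tendsto (fun δ => δ ^ (1 / (lam + 1)) * powAvg h (1 / (lam + 1) + 1) δ) (𝓝[>] 0)
      (𝓝 (1 / (2 * Real.pi * √(A * C - B ^ 2)) * (lam + 1))) := by
  have := hd.well.tendsto_rpow_mul_powAvg (r := 1 / (lam + 1) + 1) (by linarith [hd.inv_pos])
  rwa [add_sub_cancel_right, div_div_eq_mul_div, div_one] at this

/-! ### Explicit time profiles -/

/-- If K ~ k δ^(-θ), the reciprocal speed is equivalent to a power of δ, and the condition on θ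
makes that power integrable at 0. It serves θ = -λ/(λ+1) for λ < 0 and θ = 0 for λ > 0. -/
lemma isTimeProfile_rpow (hd : WellData lam γ₀ h p₀ m A B C) {θ k : ℝ} (hk : 0 < k)
    (hθ : 0 < 1 - 2 * (lam + 1) * θ)
    (hK : Tendsto (fun δ => δ ^ θ * powAvg h (1 / (lam + 1)) δ) (𝓝[>] 0) (𝓝 k)) :
    IsTimeProfile lam h
      (fun δ => k ^ (2 * (lam + 1)) / ((lam + 1) * (1 - 2 * (lam + 1) * θ))
        * δ ^ (1 - 2 * (lam + 1) * θ))
      (fun δ => k ^ (2 * (lam + 1)) / (lam + 1) * δ ^ (-(2 * (lam + 1) * θ))) := by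
  have hl := hd.lam_pos
  refine ⟨?_, ?_, ?_⟩
  · filter_upwards [self_mem_nhdsWithin] with δ hδ
    refine ((Real.hasDerivAt_rpow_const (p := 1 - 2 * (lam + 1) * θ)
      (Or.inl (ne_of_gt hδ))).const_mul _).congr_deriv ?_
    rw [show 1 - 2 * (lam + 1) * θ - 1 = -(2 * (lam + 1) * θ) by ring]
    field_simp
  · simpa using (tendsto_rpow_nhdsGT_zero hθ).const_mul
      (k ^ (2 * (lam + 1)) / ((lam + 1) * (1 - 2 * (lam + 1) * θ)))
  · have h1 := (hK.rpow_const (p := -(2 * (lam + 1))) (Or.inl hk.ne')).const_mul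
      (k ^ (2 * (lam + 1)))
    rw [← Real.rpow_add hk, add_neg_cancel, Real.rpow_zero] at h1
    refine h1.congr' ?_
    filter_upwards [self_mem_nhdsWithin] with δ hδ
    have hδ' : 0 < δ := hδ
    rw [Real.mul_rpow (Real.rpow_nonneg hδ'.le _) (hd.powAvg_pos hδ').le, ← Real.rpow_mul hδ'.le]
    rw [show θ * -(2 * (lam + 1)) = -(2 * (lam + 1) * θ) by ring]
    field_simp

/-- Here K ~ c log(1/δ), so the reciprocal speed is equivalent to c² log²δ; the term 2 log δ in the
derivative of δ log²δ is of lower order. -/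
lemma isTimeProfile_log (hd : WellData lam γ₀ h p₀ m A B C) (h0 : lam = 0) :
    IsTimeProfile lam h
      (fun δ => (1 / (2 * Real.pi * √(A * C - B ^ 2))) ^ 2 * (δ * Real.log δ ^ 2))
      (fun δ => (1 / (2 * Real.pi * √(A * C - B ^ 2))) ^ 2
        * (Real.log δ ^ 2 + 2 * Real.log δ)) := by
  have hc := hd.coef_pos
  set c := 1 / (2 * Real.pi * √(A * C - B ^ 2)) with hcdef
  have hlog : Tendsto (fun δ : ℝ => -Real.log δ) (𝓝[>] 0) atTop :=
    tendsto_neg_atBot_atTop.comp Real.tendsto_log_nhdsGT_zero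
  refine ⟨?_, ?_, ?_⟩
  · filter_upwards [self_mem_nhdsWithin] with δ hδ
    have hδ' : δ ≠ 0 := ne_of_gt hδ
    have h1 := ((hasDerivAt_id δ).mul ((Real.hasDerivAt_log hδ').pow 2)).const_mul (c ^ 2)
    refine h1.congr_deriv ?_
    simp only [id]
    field_simp
    norm_num
    ring
  · have h1 : Tendsto (fun δ : ℝ => Real.log δ * δ ^ (1 / 2 : ℝ)) (𝓝[>] 0) (𝓝 0) :=
      tendsto_log_mul_rpow_nhdsGT_zero (by norm_num)
    have h2 := (h1.pow 2).const_mul (c ^ 2)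
    norm_num at h2
    refine h2.congr' ?_
    filter_upwards [self_mem_nhdsWithin] with δ hδ
    have hδ' : 0 < δ := hδ
    rw [mul_pow, ← Real.rpow_natCast (δ ^ (1 / 2 : ℝ)), ← Real.rpow_mul hδ'.le,
      show (1 / 2 : ℝ) * ((2 : ℕ) : ℝ) = 1 by norm_num, Real.rpow_one]
    ring
  · have hK := hd.well.tendsto_powAvg_one_div_log
    rw [← hcdef] at hK
    have h1 := ((hK.inv₀ hc.ne').pow 2).const_mul (c ^ 2)
    have h2 : Tendsto (fun δ : ℝ => 1 - 2 * (-Real.log δ)⁻¹) (𝓝[>] 0) (𝓝 (1 - 2 * 0)) :=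
      (hlog.inv_tendsto_atTop.const_mul 2).const_sub 1
    have h3 := h1.mul h2
    rw [show c ^ 2 * c⁻¹ ^ 2 * (1 - 2 * 0) = 1 by field_simp; norm_num] at h3
    refine h3.congr' ?_
    filter_upwards [Ioo_mem_nhdsGT (zero_lt_one' ℝ)] with δ hδ
    have hlδ : Real.log δ < 0 := Real.log_neg hδ.1 hδ.2
    have hKpos := hd.well.powAvg_pos zero_le_one hδ.1
    rw [show 1 / (lam + 1) = 1 by rw [h0]; norm_num,
      show -(2 * (lam + 1)) = -((2 : ℕ) : ℝ) by rw [h0]; norm_num, Real.rpow_neg hKpos.le,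
      Real.rpow_natCast, h0]
    have := hlδ.ne
    field_simp
    ring

/-! ### The three regimes -/

/-- The constant `1 / (2π √Δ)`. -/
lemma tendsto_powAvg_neg (hd : WellData lam γ₀ h p₀ m A B C) (h0 : lam < 0) :
    Tendsto (fun δ => δ ^ (-lam / (lam + 1)) * powAvg h (1 / (lam + 1)) δ) (𝓝[>] 0)
      (𝓝 (1 / (2 * Real.pi * √(A * C - B ^ 2)) * (lam + 1) / -lam)) := by
  have hl := hd.lam_pos
  have h1 : 1 < 1 / (lam + 1) := by rw [lt_div_iff₀ hl]; linarith
  have h2 := hd.well.tendsto_rpow_mul_powAvg h1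
  have e : 1 / (lam + 1) - 1 = -lam / (lam + 1) := by field_simp; ring
  rw [e, div_div_eq_mul_div] at h2
  exact h2

lemma tendsto_powAvg_of_pos (hd : WellData lam γ₀ h p₀ m A B C) (h0 : 0 < lam) :
    Tendsto (powAvg h (1 / (lam + 1))) (𝓝[>] 0)
      (𝓝 (torusAvg fun p => h p ^ (-(1 / (lam + 1))))) :=
  hd.well.tendsto_powAvg hd.inv_pos (by rw [div_lt_one hd.lam_pos]; linarith)

lemma avg_pos (hd : WellData lam γ₀ h p₀ m A B C) (h0 : 0 < lam) :
    0 < torusAvg fun p => h p ^ (-(1 / (lam + 1))) :=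
  hd.well.torusAvg_rpow_pos hd.inv_pos (by rw [div_lt_one hd.lam_pos]; linarith)

lemma tendsto_powAvg_zero (hd : WellData lam γ₀ h p₀ m A B C) (h0 : lam = 0) :
    Tendsto (fun δ => powAvg h (1 / (lam + 1)) δ / -Real.log δ) (𝓝[>] 0)
      (𝓝 (1 / (2 * Real.pi * √(A * C - B ^ 2)))) := by
  rw [show 1 / (lam + 1) = 1 by rw [h0]; norm_num]
  exact hd.well.tendsto_powAvg_one_div_log

lemma coef_neg_pos (hd : WellData lam γ₀ h p₀ m A B C) (h0 : lam < 0) :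
    0 < 1 / (2 * Real.pi * √(A * C - B ^ 2)) * (lam + 1) / -lam :=
  div_pos (mul_pos hd.coef_pos hd.lam_pos) (by linarith)

lemma isTimeProfile_neg (hd : WellData lam γ₀ h p₀ m A B C) (h0 : lam < 0) :
    IsTimeProfile lam h
      (fun δ => (1 / (2 * Real.pi * √(A * C - B ^ 2)) * (lam + 1) / -lam) ^ (2 * (lam + 1))
        / ((lam + 1) * (2 * lam + 1)) * δ ^ (2 * lam + 1))
      (fun δ => (1 / (2 * Real.pi * √(A * C - B ^ 2)) * (lam + 1) / -lam) ^ (2 * (lam + 1))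
        / (lam + 1) * δ ^ (2 * lam)) := by
  have hl := hd.lam_pos
  have e1 : 1 - 2 * (lam + 1) * (-lam / (lam + 1)) = 2 * lam + 1 := by field_simp; ring
  have e2 : -(2 * (lam + 1) * (-lam / (lam + 1))) = 2 * lam := by field_simp
  -- This is where λ > -1/2 enters: it makes δ^(2λ) integrable at 0.
  have := hd.isTimeProfile_rpow (hd.coef_neg_pos h0) (by rw [e1]; linarith [hd.lam_gt])
    (hd.tendsto_powAvg_neg h0)
  rwa [e1, e2] at this

lemma isTimeProfile_pos (hd : WellData lam γ₀ h p₀ m A B C) (h0 : 0 < lam) :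
    IsTimeProfile lam h
      (fun δ => (torusAvg fun p => h p ^ (-(1 / (lam + 1)))) ^ (2 * (lam + 1)) / (lam + 1) * δ)
      (fun _ => (torusAvg fun p => h p ^ (-(1 / (lam + 1)))) ^ (2 * (lam + 1)) / (lam + 1)) := by
  have := hd.isTimeProfile_rpow (θ := 0) (hd.avg_pos h0) (by norm_num)
    (by simpa using hd.tendsto_powAvg_of_pos h0)
  simpa using this

lemma exists_isTimeProfile (hd : WellData lam γ₀ h p₀ m A B C) :
    ∃ f f', IsTimeProfile lam h f f' := by
  rcases lt_trichotomy lam 0 with h0 | h0 | h0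
  · exact ⟨_, _, hd.isTimeProfile_neg h0⟩
  · exact ⟨_, _, hd.isTimeProfile_log h0⟩
  · exact ⟨_, _, hd.isTimeProfile_pos h0⟩

theorem existsUnique_singularityTime (hd : WellData lam γ₀ h p₀ m A B C) :
    ∃! T, IsSingularityTime lam γ₀ T := by
  obtain ⟨f, f', hf⟩ := hd.exists_isTimeProfile
  exact ⟨_, hd.exists_solution hf, fun T hT => hd.singularityTime_unique hf hT⟩

/-! ### Asymptotics in time -/

section Solution

variable {T : ℝ} {S : ℝ → ℝ}

lemma eventually_gap_pos (hd : WellData lam γ₀ h p₀ m A B C) (hS : IsSolutionUpTo lam γ₀ T S) :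
    ∀ᶠ t in 𝓝[<] T, 0 < T - t ∧ 0 < gap lam m (S t) := by
  filter_upwards [Ioo_mem_nhdsLT hS.pos] with t ht
  exact ⟨sub_pos.2 ht.2, hd.solution_gap_pos hS ht⟩

lemma tendsto_sub_nhdsLT (T : ℝ) : Tendsto (fun t => T - t) (𝓝[<] T) (𝓝[>] 0) := by
  refine tendsto_nhdsWithin_iff.2 ⟨?_, ?_⟩
  · have : Tendsto (fun t => T - t) (𝓝 T) (𝓝 (T - T)) :=
      (continuous_const.sub continuous_id).tendsto T
    rw [sub_self] at this
    exact this.mono_left nhdsWithin_le_nhds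
  · filter_upwards [self_mem_nhdsWithin] with t ht using sub_pos.2 (mem_Iio.1 ht)

/-- The product `(T - t) K^(-2(λ+1)) / δ` converges as soon as its time profile version does. -/
lemma tendsto_remaining_mul (hd : WellData lam γ₀ h p₀ m A B C) (hS : IsSolutionUpTo lam γ₀ T S)
    {f f' g : ℝ → ℝ} {κ : ℝ} (hf : IsTimeProfile lam h f f')
    (hg : Tendsto (fun δ => f δ * g δ) (𝓝[>] 0) (𝓝 κ)) (hne : ∀ᶠ δ in 𝓝[>] 0, f δ ≠ 0) :
    Tendsto (fun t => (T - t) * g (gap lam m (S t))) (𝓝[<] T) (𝓝 κ) := by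
  have hgap := hd.tendsto_gap_solution hS
  have h1 := ((hd.tendsto_profile_div hS hf).inv₀ one_ne_zero).mul (hg.comp hgap)
  rw [inv_one, one_mul] at h1
  refine h1.congr' ?_
  filter_upwards [hgap.eventually hne] with t h3
  simp only [Function.comp]
  field_simp

lemma tendsto_remaining_neg (hd : WellData lam γ₀ h p₀ m A B C) (hS : IsSolutionUpTo lam γ₀ T S)
    (h0 : lam < 0) :
    Tendsto (fun t => (T - t) / gap lam m (S t) ^ (2 * lam + 1)) (𝓝[<] T)
      (𝓝 ((1 / (2 * Real.pi * √(A * C - B ^ 2)) * (lam + 1) / -lam) ^ (2 * (lam + 1))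
        / ((lam + 1) * (2 * lam + 1)))) := by
  have hl := hd.lam_pos
  have hl2 : 0 < 2 * lam + 1 := by linarith [hd.lam_gt]
  have hk := Real.rpow_pos_of_pos (hd.coef_neg_pos h0) (2 * (lam + 1))
  refine hd.tendsto_remaining_mul hS (hd.isTimeProfile_neg h0)
    (g := fun δ => (δ ^ (2 * lam + 1))⁻¹) ?_ ?_
  · refine tendsto_const_nhds.congr' ?_
    filter_upwards [self_mem_nhdsWithin] with δ hδ
    have := Real.rpow_pos_of_pos (show 0 < δ from hδ) (2 * lam + 1)
    field_simp
  · filter_upwards [self_mem_nhdsWithin] with δ hδ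
    have := Real.rpow_pos_of_pos (show 0 < δ from hδ) (2 * lam + 1)
    positivity

lemma tendsto_remaining_pos (hd : WellData lam γ₀ h p₀ m A B C) (hS : IsSolutionUpTo lam γ₀ T S)
    (h0 : 0 < lam) :
    Tendsto (fun t => (T - t) / gap lam m (S t)) (𝓝[<] T)
      (𝓝 ((torusAvg fun p => h p ^ (-(1 / (lam + 1)))) ^ (2 * (lam + 1)) / (lam + 1))) := by
  have hl := hd.lam_pos
  have hk := Real.rpow_pos_of_pos (hd.avg_pos h0) (2 * (lam + 1))
  refine hd.tendsto_remaining_mul hS (hd.isTimeProfile_pos h0) (g := fun δ => δ⁻¹) ?_ ?_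
  · refine tendsto_const_nhds.congr' ?_
    filter_upwards [self_mem_nhdsWithin] with δ hδ
    have : 0 < δ := hδ
    field_simp
  · filter_upwards [self_mem_nhdsWithin] with δ hδ
    have : 0 < δ := hδ
    positivity

lemma tendsto_remaining_zero (hd : WellData lam γ₀ h p₀ m A B C) (hS : IsSolutionUpTo lam γ₀ T S)
    (h0 : lam = 0) :
    Tendsto (fun t => (T - t) / (gap lam m (S t) * Real.log (gap lam m (S t)) ^ 2)) (𝓝[<] T)
      (𝓝 ((1 / (2 * Real.pi * √(A * C - B ^ 2))) ^ 2)) := by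
  have hk := hd.coef_pos
  refine hd.tendsto_remaining_mul hS (hd.isTimeProfile_log h0)
    (g := fun δ => (δ * Real.log δ ^ 2)⁻¹) ?_ ?_
  · refine tendsto_const_nhds.congr' ?_
    filter_upwards [Ioo_mem_nhdsGT (zero_lt_one' ℝ)] with δ hδ
    have h1 := hδ.1.ne'
    have h2 := (Real.log_neg hδ.1 hδ.2).ne
    field_simp
  · filter_upwards [Ioo_mem_nhdsGT (zero_lt_one' ℝ)] with δ hδ
    have h1 := hδ.1.ne'
    have h2 := (Real.log_neg hδ.1 hδ.2).ne
    positivity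

/-- Limit of `(T - t) K^(-2(λ+1)) / δ`. -/
lemma tendsto_speed (hd : WellData lam γ₀ h p₀ m A B C) (hS : IsSolutionUpTo lam γ₀ T S) :
    Tendsto (fun t => (T - t) * (powAvg h (1 / (lam + 1)) (gap lam m (S t))
        ^ (-(2 * (lam + 1))) / gap lam m (S t))) (𝓝[<] T)
      (𝓝 (if lam ≤ 0 then 1 / ((lam + 1) * (2 * lam + 1)) else 1 / (lam + 1))) := by
  have hl := hd.lam_pos
  have hgap := hd.tendsto_gap_solution hS
  have hl2 : 0 < 2 * lam + 1 := by linarith [hd.lam_gt]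
  rcases lt_trichotomy lam 0 with h0 | h0 | h0
  · rw [if_pos h0.le]
    have hk := hd.coef_neg_pos h0
    -- T - t is of order δ^(2λ+1) and K^(-2(λ+1)) of order δ^(-2λ). The constants k^(±2(λ+1))
    -- cancel, so the limit does not depend on the well.
    have h1 := (hd.tendsto_remaining_neg hS h0).mul
      (((hd.tendsto_powAvg_neg h0).rpow_const (p := -(2 * (lam + 1))) (Or.inl hk.ne')).comp hgap)
    rw [div_mul_eq_mul_div, ← Real.rpow_add hk, add_neg_cancel, Real.rpow_zero] at h1
    refine h1.congr' ?_
    filter_upwards [hd.eventually_gap_pos hS] with t ht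
    have hg := ht.2
    simp only [Function.comp]
    rw [Real.mul_rpow (Real.rpow_nonneg hg.le _) (hd.powAvg_pos hg).le, ← Real.rpow_mul hg.le,
      show -lam / (lam + 1) * -(2 * (lam + 1)) = 2 * lam by field_simp,
      Real.rpow_add_one hg.ne']
    have := Real.rpow_pos_of_pos hg (2 * lam)
    field_simp
  · rw [if_pos h0.le, show 1 / ((lam + 1) * (2 * lam + 1)) = 1 by rw [h0]; norm_num]
    have hk := hd.coef_pos
    have h1 := (hd.tendsto_remaining_zero hS h0).mul
      ((((hd.tendsto_powAvg_zero h0).inv₀ hk.ne').pow 2).comp hgap)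
    rw [inv_pow, mul_inv_cancel₀ (pow_pos hk 2).ne'] at h1
    refine h1.congr' ?_
    filter_upwards [hgap (Ioo_mem_nhdsGT (zero_lt_one' ℝ))] with t ht
    have hg : 0 < gap lam m (S t) := ht.1
    have hlog := (Real.log_neg hg ht.2).ne
    have hK := hd.powAvg_pos hg
    simp only [Function.comp]
    rw [show -(2 * (lam + 1)) = -((2 : ℕ) : ℝ) by rw [h0]; norm_num, Real.rpow_neg hK.le,
      Real.rpow_natCast]
    field_simp
  · rw [if_neg h0.not_ge]
    have hk := hd.avg_pos h0
    have h1 := (hd.tendsto_remaining_pos hS h0).mul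
      (((hd.tendsto_powAvg_of_pos h0).rpow_const (p := -(2 * (lam + 1))) (Or.inl hk.ne')).comp hgap)
    rw [div_mul_eq_mul_div, ← Real.rpow_add hk, add_neg_cancel, Real.rpow_zero] at h1
    refine h1.congr' ?_
    filter_upwards [hd.eventually_gap_pos hS] with t ht
    simp only [Function.comp]
    ring

/-- Limit of `δ L / K`. -/
lemma tendsto_ratio (hd : WellData lam γ₀ h p₀ m A B C) :
    Tendsto (fun δ => δ * (powAvg h (1 / (lam + 1) + 1) δ / powAvg h (1 / (lam + 1)) δ))
      (𝓝[>] 0) (𝓝 (if lam ≤ 0 then -lam else 0)) := by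
  have hl := hd.lam_pos
  have hL := hd.tendsto_powAvg_succ
  have hc := hd.coef_pos
  rcases lt_trichotomy lam 0 with h0 | h0 | h0
  · rw [if_pos h0.le]
    have hk := hd.coef_neg_pos h0
    have h1 := hL.div (hd.tendsto_powAvg_neg h0) hk.ne'
    have h0' : -lam ≠ 0 := by linarith
    rw [show 1 / (2 * Real.pi * √(A * C - B ^ 2)) * (lam + 1) /
      (1 / (2 * Real.pi * √(A * C - B ^ 2)) * (lam + 1) / -lam) = -lam by
        generalize 1 / (2 * Real.pi * √(A * C - B ^ 2)) = c at hc ⊢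
        field_simp] at h1
    refine h1.congr' ?_
    filter_upwards [self_mem_nhdsWithin] with δ hδ
    have hδ' : 0 < δ := hδ
    have e : δ ^ (1 / (lam + 1)) = δ ^ (-lam / (lam + 1)) * δ := by
      rw [← Real.rpow_add_one hδ'.ne']; congr 1; field_simp; ring
    have h2 := Real.rpow_pos_of_pos hδ' (-lam / (lam + 1))
    have h3 := hd.powAvg_pos hδ'
    simp only [Pi.div_apply]
    rw [e]
    field_simp
  · rw [if_pos h0.le, show -lam = 0 by linarith]
    have hlog : Tendsto (fun δ : ℝ => -Real.log δ) (𝓝[>] 0) atTop :=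
      tendsto_neg_atBot_atTop.comp Real.tendsto_log_nhdsGT_zero
    have h1 := (hL.div (hd.tendsto_powAvg_zero h0) hc.ne').mul hlog.inv_tendsto_atTop
    rw [mul_zero] at h1
    refine h1.congr' ?_
    filter_upwards [Ioo_mem_nhdsGT (zero_lt_one' ℝ)] with δ hδ
    have h2 := (Real.log_neg hδ.1 hδ.2).ne
    have h3 := hd.powAvg_pos hδ.1
    have e : δ ^ (1 / (lam + 1)) = δ := by rw [h0]; norm_num
    simp only [Pi.div_apply, Pi.inv_apply]
    rw [e]
    field_simp
  · rw [if_neg h0.not_ge]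
    have hk := hd.avg_pos h0
    have h1 := (hL.div (hd.tendsto_powAvg_of_pos h0) hk.ne').mul
      (tendsto_rpow_nhdsGT_zero (show 0 < lam / (lam + 1) by positivity))
    rw [mul_zero] at h1
    refine h1.congr' ?_
    filter_upwards [self_mem_nhdsWithin] with δ hδ
    have hδ' : 0 < δ := hδ
    have e : δ = δ ^ (1 / (lam + 1)) * δ ^ (lam / (lam + 1)) := by
      rw [← Real.rpow_add hδ', show 1 / (lam + 1) + lam / (lam + 1) = 1 by field_simp; ring,
        Real.rpow_one]
    simp only [Pi.div_apply]
    linear_combination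
      (-(powAvg h (1 / (lam + 1) + 1) δ / powAvg h (1 / (lam + 1)) δ)) * e

end Solution

end WellData

/-! ### The Lambert function -/

/-- A preimage exists by the intermediate value theorem for x e^(-x), which falls from 1/e at x = 1
to 0 at infinity. The asymptotics use only this equation and w ≤ -1, not the injectivity of the
branch. -/
lemma abs_lambertWm1_spec {z : ℝ} (hz : 0 < z) (hz1 : z ≤ Real.exp (-1)) :
    1 ≤ |lambertWm1 (-z)| ∧ |lambertWm1 (-z)| * Real.exp (-|lambertWm1 (-z)|) = z := by
  have hex : ∃ w ∈ Iic (-1 : ℝ), w * Real.exp w = -z := by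
    have h1 : Tendsto (fun x : ℝ => x * Real.exp (-x)) atTop (𝓝 0) := by
      simpa using Real.tendsto_pow_mul_exp_neg_atTop_nhds_zero 1
    obtain ⟨x, hx, hx1⟩ := ((h1.eventually (gt_mem_nhds hz)).and (eventually_ge_atTop 1)).exists
    have hc : ContinuousOn (fun x : ℝ => x * Real.exp (-x)) (Icc 1 x) := by fun_prop
    obtain ⟨y, hy, hyz⟩ := intermediate_value_Icc' hx1 hc ⟨hx.le, by simpa using hz1⟩
    exact ⟨-y, neg_le_neg hy.1, by simp only at hyz; rw [← hyz]; ring⟩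
  have h1 : lambertWm1 (-z) ∈ Iic (-1 : ℝ) := Function.invFunOn_mem hex
  have h2 : lambertWm1 (-z) * Real.exp (lambertWm1 (-z)) = -z := Function.invFunOn_eq hex
  have h3 : lambertWm1 (-z) < 0 := lt_of_le_of_lt h1 (by norm_num)
  rw [abs_of_neg h3, neg_neg]
  exact ⟨by linarith [mem_Iic.1 h1], by linarith⟩

section AbsW

variable {S Δ : ℝ} (T : ℝ)

lemma eventually_absW (hSΔ : 0 < S * Δ) : ∀ᶠ t in 𝓝[<] T, 1 ≤ absW S Δ T t ∧
    absW S Δ T t - Real.log (absW S Δ T t)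
      = -Real.log (Real.pi * √(S * Δ)) + 1 / 2 * -Real.log (T - t) := by
  have hk : 0 < Real.pi * √(S * Δ) := mul_pos Real.pi_pos (Real.sqrt_pos.2 hSΔ)
  have h1 : Tendsto (fun t => Real.pi * √(S * Δ) * (T - t) ^ (1 / 2 : ℝ)) (𝓝[<] T) (𝓝 0) := by
    have := ((tendsto_rpow_nhdsGT_zero (r := 1 / 2) (by norm_num)).comp
      (WellData.tendsto_sub_nhdsLT T)).const_mul (Real.pi * √(S * Δ))
    rwa [mul_zero] at this
  filter_upwards [h1.eventually (ge_mem_nhds (Real.exp_pos (-1))), self_mem_nhdsWithin] with t ht htT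
  have hT : 0 < T - t := sub_pos.2 (mem_Iio.1 htT)
  have hp := Real.rpow_pos_of_pos hT (1 / 2)
  obtain ⟨h2, h3⟩ := abs_lambertWm1_spec (mul_pos hk hp) ht
  have e : absW S Δ T t = |lambertWm1 (-(Real.pi * √(S * Δ) * (T - t) ^ (1 / 2 : ℝ)))| := by
    rw [absW]; congr 2; ring
  rw [← e] at h2 h3
  refine ⟨h2, ?_⟩
  have h4 := congrArg Real.log h3
  rw [Real.log_mul (by linarith) (Real.exp_ne_zero _), Real.log_exp, Real.log_mul hk.ne' hp.ne',
    Real.log_rpow hT] at h4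
  linarith

lemma tendsto_absW_atTop (hSΔ : 0 < S * Δ) : Tendsto (absW S Δ T) (𝓝[<] T) atTop := by
  have h1 : Tendsto (fun t => -Real.log (T - t)) (𝓝[<] T) atTop :=
    tendsto_neg_atBot_atTop.comp
      (Real.tendsto_log_nhdsGT_zero.comp (WellData.tendsto_sub_nhdsLT T))
  refine tendsto_atTop_mono' _ ?_ (tendsto_atTop_add_const_left _
    (-Real.log (Real.pi * √(S * Δ))) (h1.const_mul_atTop (show (0 : ℝ) < 1 / 2 by norm_num)))
  filter_upwards [eventually_absW T hSΔ] with t ht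
  rw [← ht.2]
  linarith [Real.log_nonneg ht.1]

/-- Dividing the logarithm of the Lambert equation by w removes log w / w and the constant, so the
product SΔ does not affect the leading order. -/
lemma tendsto_log_div_absW (hSΔ : 0 < S * Δ) :
    Tendsto (fun t => -Real.log (T - t) / absW S Δ T t) (𝓝[<] T) (𝓝 2) := by
  have hw := tendsto_absW_atTop T hSΔ
  have h1 : Tendsto (fun x : ℝ => Real.log x / x) atTop (𝓝 0) :=
    Real.isLittleO_log_id_atTop.tendsto_div_nhds_zero
  have h2 := (((h1.comp hw).const_sub 1).add
    ((hw.inv_tendsto_atTop).const_mul (Real.log (Real.pi * √(S * Δ))))).const_mul 2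
  rw [mul_zero, sub_zero, add_zero, mul_one] at h2
  refine h2.congr' ?_
  filter_upwards [eventually_absW T hSΔ] with t ht
  have h3 : absW S Δ T t ≠ 0 := by linarith [ht.1]
  have h4 := ht.2
  simp only [Function.comp, Pi.inv_apply]
  field_simp
  linarith

end AbsW

lemma isEquivalent_of_tendsto_div {l : Filter ℝ} {u v : ℝ → ℝ}
    (h : Tendsto (fun t => u t / v t) l (𝓝 1)) : Asymptotics.IsEquivalent l u v :=
  Asymptotics.isEquivalent_of_tendsto_one h

namespace WellData

variable {lam : ℝ} {γ₀ h : ℝ × ℝ → ℝ} {p₀ : ℝ × ℝ} {m A B C : ℝ} {T : ℝ} {S : ℝ → ℝ}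

/-- Taking logarithms in T - t ~ c² δ log²δ gives log(T - t) = log δ + 2 log|log δ| + O(1). -/
lemma tendsto_log_gap_div_log (hd : WellData lam γ₀ h p₀ m A B C)
    (hS : IsSolutionUpTo lam γ₀ T S) (h0 : lam = 0) :
    Tendsto (fun t => Real.log (gap lam m (S t)) / Real.log (T - t)) (𝓝[<] T) (𝓝 1) := by
  have hgap := hd.tendsto_gap_solution hS
  have hlog : Tendsto (fun δ : ℝ => -Real.log δ) (𝓝[>] 0) atTop :=
    tendsto_neg_atBot_atTop.comp Real.tendsto_log_nhdsGT_zero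
  have hk := pow_pos hd.coef_pos 2
  have h1 := (Real.continuousAt_log hk.ne').tendsto.comp (hd.tendsto_remaining_zero hS h0)
  have h2 := h1.mul ((hlog.comp hgap).inv_tendsto_atTop)
  rw [mul_zero] at h2
  have h3 : Tendsto (fun x : ℝ => Real.log x / x) atTop (𝓝 0) :=
    Real.isLittleO_log_id_atTop.tendsto_div_nhds_zero
  have h4 := (h3.comp (hlog.comp hgap)).const_mul 2
  rw [mul_zero] at h4
  have h5 := (h2.add h4).const_sub 1
  rw [add_zero, sub_zero] at h5
  have h6 := h5.inv₀ one_ne_zero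
  rw [inv_one] at h6
  refine h6.congr' ?_
  filter_upwards [hgap (Ioo_mem_nhdsGT (zero_lt_one' ℝ)), hd.eventually_gap_pos hS,
    (tendsto_sub_nhdsLT T) (Ioo_mem_nhdsGT (zero_lt_one' ℝ))] with t ht ht' htT
  have hg : 0 < gap lam m (S t) := ht.1
  have hlg := Real.log_neg hg ht.2
  have hlT := Real.log_neg htT.1 htT.2
  simp only [Function.comp, Pi.inv_apply, Real.log_neg_eq_log]
  rw [Real.log_div ht'.1.ne' (mul_ne_zero hg.ne' (pow_ne_zero 2 hlg.ne)),
    Real.log_mul hg.ne' (pow_ne_zero 2 hlg.ne), Real.log_pow,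
    inv_eq_iff_eq_inv, inv_div]
  have := hlg.ne
  field_simp
  push_cast
  ring

lemma tendsto_log_gap_div_absW (hd : WellData lam γ₀ h p₀ m A B C)
    (hS : IsSolutionUpTo lam γ₀ T S) (h0 : lam = 0) {s Δ : ℝ} (hsΔ : 0 < s * Δ) :
    Tendsto (fun t => -Real.log (gap lam m (S t)) / absW s Δ T t) (𝓝[<] T) (𝓝 2) := by
  have h1 := (hd.tendsto_log_gap_div_log hS h0).mul (tendsto_log_div_absW T hsΔ)
  rw [one_mul] at h1
  refine h1.congr' ?_
  filter_upwards [(tendsto_sub_nhdsLT T) (Ioo_mem_nhdsGT (zero_lt_one' ℝ))] with t htT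
  have hlT := (Real.log_neg htT.1 htT.2).ne
  field_simp

/-! ### Rates of the stretching rate -/

/-- With R = T - t the first factor converges to a universal constant. In the second, δ/(x+δ) equals
1 at x = 0 but tends to 0 for x > 0, which separates the infimum from every other pathline. -/
lemma stretchVal_mul_eq {x δ R : ℝ} (hδ : δ ≠ 0) :
    R * stretchVal lam h x δ = (R * (powAvg h (1 / (lam + 1)) δ ^ (-(2 * (lam + 1))) / δ)) *
      (δ * (powAvg h (1 / (lam + 1) + 1) δ / powAvg h (1 / (lam + 1)) δ) - δ / (x + δ)) := by
  rw [stretchVal]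
  field_simp

lemma stretchVal_zero_equiv (hd : WellData lam γ₀ h p₀ m A B C)
    (hS : IsSolutionUpTo lam γ₀ T S) :
    Asymptotics.IsEquivalent (𝓝[<] T) (fun t => stretchVal lam h 0 (gap lam m (S t)))
      (infRate lam T) := by
  have hl := hd.lam_pos
  have hl2 : 0 < 2 * lam + 1 := by linarith [hd.lam_gt]
  have hgap := hd.tendsto_gap_solution hS
  have h1 := (hd.tendsto_speed hS).mul ((hd.tendsto_ratio.comp hgap).sub_const 1)
  have h2 : Tendsto (fun t => (T - t) * stretchVal lam h 0 (gap lam m (S t))) (𝓝[<] T)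
      (𝓝 (if lam ≤ 0 then -(1 / (2 * lam + 1)) else -(1 / (lam + 1)))) := by
    have e : (if lam ≤ 0 then -(1 / (2 * lam + 1)) else -(1 / (lam + 1)))
        = (if lam ≤ 0 then 1 / ((lam + 1) * (2 * lam + 1)) else 1 / (lam + 1))
          * ((if lam ≤ 0 then -lam else 0) - 1) := by
      split_ifs
      · field_simp; ring
      · ring
    rw [e]
    refine h1.congr' ?_
    filter_upwards [hd.eventually_gap_pos hS] with t ht
    rw [stretchVal_mul_eq ht.2.ne', zero_add, div_self ht.2.ne']
    rfl
  refine isEquivalent_of_tendsto_div ?_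
  have hne : (if lam ≤ 0 then -(1 / (2 * lam + 1)) else -(1 / (lam + 1))) ≠ 0 := by
    split_ifs
    · exact (neg_neg_of_pos (by positivity)).ne
    · exact (neg_neg_of_pos (by positivity)).ne
  have h3 := h2.div_const (if lam ≤ 0 then -(1 / (2 * lam + 1)) else -(1 / (lam + 1)))
  rw [div_self hne] at h3
  refine h3.congr' ?_
  filter_upwards [hd.eventually_gap_pos hS] with t ht
  have h4 := ht.1.ne'
  rw [infRate]
  split_ifs <;> field_simp

lemma stretchVal_pos_equiv (hd : WellData lam γ₀ h p₀ m A B C)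
    (hS : IsSolutionUpTo lam γ₀ T S) {x : ℝ} (hx : 0 < x) :
    Asymptotics.IsEquivalent (𝓝[<] T) (fun t => stretchVal lam h x (gap lam m (S t)))
      (supRate lam (sStar lam γ₀) (A * C - B ^ 2)
        (torusAvg fun p => h p ^ (-(1 / (lam + 1)))) T) := by
  have hl := hd.lam_pos
  have hl2 : 0 < 2 * lam + 1 := by linarith [hd.lam_gt]
  have hgap := hd.tendsto_gap_solution hS
  have hx0 := (tendsto_div_add hx).comp hgap
  have hc := hd.coef_pos
  have hspeed := hd.tendsto_speed hS
  refine isEquivalent_of_tendsto_div ?_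
  rcases lt_trichotomy lam 0 with h0 | h0 | h0
  · have h1 := hspeed.mul ((hd.tendsto_ratio.comp hgap).sub hx0)
    rw [if_pos h0.le, if_pos h0.le, sub_zero] at h1
    have h2 := h1.div_const (|lam| / ((lam + 1) * (2 * lam + 1)))
    have h0' : -lam ≠ 0 := by linarith
    have hP : (lam + 1) * (2 * lam + 1) ≠ 0 := by positivity
    rw [abs_of_neg h0, show 1 / ((lam + 1) * (2 * lam + 1)) * -lam /
      (-lam / ((lam + 1) * (2 * lam + 1))) = 1 by
        rw [one_div_mul_eq_div, div_self (div_ne_zero h0' hP)]] at h2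
    refine h2.congr' ?_
    filter_upwards [hd.eventually_gap_pos hS] with t ht
    simp only [Function.comp]
    rw [← stretchVal_mul_eq ht.2.ne', supRate, if_pos h0, abs_of_neg h0]
    have := ht.1.ne'
    field_simp
  · have hsΔ := mul_pos hd.sStar_pos hd.well.det_pos
    have hlog : Tendsto (fun δ : ℝ => -Real.log δ) (𝓝[>] 0) atTop :=
      tendsto_neg_atBot_atTop.comp Real.tendsto_log_nhdsGT_zero
    -- At λ = 0 and x > 0 the bracket tends to 0 and must be resolved to order 1/log(1/δ). Both δL
    -- and K/log(1/δ) tend to the same constant, while δ/(x+δ) is negligible even after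
    -- multiplication by log δ.
    have hA : Tendsto (fun δ => -Real.log δ * (δ *
        (powAvg h (1 / (lam + 1) + 1) δ / powAvg h (1 / (lam + 1)) δ))) (𝓝[>] 0) (𝓝 1) := by
      have h1 := hd.tendsto_powAvg_succ.div (hd.tendsto_powAvg_zero h0) hc.ne'
      rw [show 1 / (2 * Real.pi * √(A * C - B ^ 2)) * (lam + 1) /
        (1 / (2 * Real.pi * √(A * C - B ^ 2))) = 1 by
          rw [show lam + 1 = 1 by linarith, mul_one, div_self hc.ne']] at h1
      refine h1.congr' ?_
      filter_upwards [Ioo_mem_nhdsGT (zero_lt_one' ℝ)] with δ hδ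
      have h2 := (Real.log_neg hδ.1 hδ.2).ne
      have h3 := (hd.well.powAvg_pos zero_le_one hδ.1).ne'
      simp only [Pi.div_apply, h0]
      norm_num
      field_simp
    have hB : Tendsto (fun δ : ℝ => -Real.log δ * (δ / (x + δ))) (𝓝[>] 0) (𝓝 0) := by
      have h1 : Tendsto (fun δ : ℝ => Real.log δ * δ ^ (1 : ℝ)) (𝓝[>] 0) (𝓝 0) :=
        tendsto_log_mul_rpow_nhdsGT_zero one_pos
      have h2 : Tendsto (fun δ : ℝ => (x + δ)⁻¹) (𝓝[>] 0) (𝓝 (x + 0)⁻¹) :=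
        (tendsto_id_nhdsGT_zero.const_add x).inv₀ (by linarith)
      have h3 := (h1.mul h2).neg
      rw [zero_mul, neg_zero] at h3
      refine h3.congr fun δ => ?_
      rw [Real.rpow_one]; ring
    have h1 := (hspeed.mul ((hA.sub hB).comp hgap)).mul
      ((hd.tendsto_log_gap_div_absW hS h0 hsΔ).inv₀ two_ne_zero)
    rw [if_pos h0.le, show 1 / ((lam + 1) * (2 * lam + 1)) * (1 - 0) * (2 : ℝ)⁻¹ = 1 / 2 by
      rw [h0]; norm_num] at h1
    have h2 := h1.mul_const 2
    rw [show (1 / 2 : ℝ) * 2 = 1 by norm_num] at h2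
    refine h2.congr' ?_
    filter_upwards [hd.eventually_gap_pos hS, eventually_absW T hsΔ,
      hgap (Ioo_mem_nhdsGT (zero_lt_one' ℝ))] with t ht hw hg
    have hlg : Real.log (gap lam m (S t)) ≠ 0 := (Real.log_neg hg.1 hg.2).ne
    have hT := ht.1.ne'
    have hw0 : absW (sStar lam γ₀) (A * C - B ^ 2) T t ≠ 0 := by linarith [hw.1]
    rw [supRate, if_neg h0.not_lt, if_pos h0,
      show ∀ v w : ℝ, w ≠ 0 → v / (1 / (2 * w) * (T - t)⁻¹) = ((T - t) * v) * (2 * w) from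
        fun v w hw => by field_simp,
      stretchVal_mul_eq ht.2.ne']
    · simp only [Function.comp]
      field_simp
      ring
    · exact hw0
  · have hk := hd.avg_pos h0
    set M := torusAvg fun p => h p ^ (-(1 / (lam + 1))) with hM
    have hq : 0 < 1 / (lam + 1) := hd.inv_pos
    have hKM := hd.tendsto_powAvg_of_pos h0
    rw [← hM] at hKM
    -- For λ > 0, L diverges like δ^(-1/(λ+1)) and dominates the bounded term 1/(x+δ), whereas K
    -- converges; T - t is of order δ.
    have hA : Tendsto (fun δ => δ ^ (1 / (lam + 1)) *
        (powAvg h (1 / (lam + 1) + 1) δ / powAvg h (1 / (lam + 1)) δ - 1 / (x + δ)))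
        (𝓝[>] 0) (𝓝 (1 / (2 * Real.pi * √(A * C - B ^ 2)) * (lam + 1) / M)) := by
      have h1 := hd.tendsto_powAvg_succ.div hKM hk.ne'
      have h2 : Tendsto (fun δ : ℝ => (x + δ)⁻¹) (𝓝[>] 0) (𝓝 (x + 0)⁻¹) :=
        (tendsto_id_nhdsGT_zero.const_add x).inv₀ (by linarith)
      have h3 := h1.sub ((tendsto_rpow_nhdsGT_zero hq).mul h2)
      rw [zero_mul, sub_zero] at h3
      refine h3.congr fun δ => ?_
      simp only [Pi.div_apply]
      ring
    have h1 := (((hKM.rpow_const (p := -(2 * (lam + 1))) (Or.inl hk.ne')).mul hA).comp hgap).mul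
      ((hd.tendsto_remaining_pos hS h0).rpow_const (p := 1 / (lam + 1)) (Or.inr hq.le))
    have h2 := h1.div_const ((lam + 1) ^ (lam / (lam + 1)) /
      (2 * Real.pi * √(A * C - B ^ 2) * M ^ (2 * lam + 1)))
    have hsD := Real.sqrt_pos.2 hd.well.det_pos
    have hpi := Real.pi_pos
    have e1 : M ^ (-(2 * (lam + 1))) * (1 / (2 * Real.pi * √(A * C - B ^ 2)) * (lam + 1) / M) *
        (M ^ (2 * (lam + 1)) / (lam + 1)) ^ (1 / (lam + 1)) /
        ((lam + 1) ^ (lam / (lam + 1)) / (2 * Real.pi * √(A * C - B ^ 2) * M ^ (2 * lam + 1)))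
        = 1 := by
      rw [Real.div_rpow (Real.rpow_nonneg hk.le _) hl.le, ← Real.rpow_mul hk.le,
        show 2 * (lam + 1) * (1 / (lam + 1)) = ((2 : ℕ) : ℝ) by field_simp; norm_num,
        Real.rpow_natCast, show 2 * lam + 1 = 2 * (lam + 1) - 1 by ring, Real.rpow_sub_one hk.ne',
        Real.rpow_neg hk.le]
      have e2 : lam + 1 = (lam + 1) ^ (1 / (lam + 1)) * (lam + 1) ^ (lam / (lam + 1)) := by
        rw [← Real.rpow_add hl, show 1 / (lam + 1) + lam / (lam + 1) = 1 by field_simp; ring,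
          Real.rpow_one]
      have hP := Real.rpow_pos_of_pos hk (2 * (lam + 1))
      have hX := Real.rpow_pos_of_pos hl (1 / (lam + 1))
      have hY := Real.rpow_pos_of_pos hl (lam / (lam + 1))
      generalize M ^ (2 * (lam + 1)) = P at *
      generalize (lam + 1) ^ (1 / (lam + 1)) = X at *
      generalize (lam + 1) ^ (lam / (lam + 1)) = Y at *
      rw [e2]
      field_simp
    rw [e1] at h2
    refine h2.congr' ?_
    filter_upwards [hd.eventually_gap_pos hS] with t ht
    simp only [Function.comp]
    rw [supRate, if_neg h0.le.not_gt, if_neg h0.ne', Real.div_rpow ht.1.le ht.2.le,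
      Real.rpow_neg ht.1.le, stretchVal]
    have h3 := Real.rpow_pos_of_pos ht.1 (1 / (lam + 1))
    have h4 := Real.rpow_pos_of_pos ht.2 (1 / (lam + 1))
    generalize gap lam m (S t) ^ (1 / (lam + 1)) = X at *
    generalize (T - t) ^ (1 / (lam + 1)) = Y at *
    field_simp

end WellData

namespace WellData

variable {lam : ℝ} {γ₀ h : ℝ × ℝ → ℝ} {p₀ : ℝ × ℝ} {m A B C : ℝ} {T : ℝ} {S : ℝ → ℝ}

/-! ### Rates of the vorticity -/

lemma tendsto_add_rpow {q x : ℝ} (hq : 0 < q) :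
    Tendsto (fun δ : ℝ => (x + δ) ^ q) (𝓝[>] 0) (𝓝 (x ^ q)) := by
  have h1 := tendsto_id_nhdsGT_zero.const_add x
  rw [add_zero] at h1
  exact h1.rpow_const (Or.inr hq.le)

lemma rpow_gap_regime (hd : WellData lam γ₀ h p₀ m A B C) {δ : ℝ} (hδ : 0 < δ) :
    δ ^ (1 / (lam + 1)) = δ ^ (-lam / (lam + 1)) * δ := by
  have := hd.lam_pos
  rw [← Real.rpow_add_one hδ.ne']
  congr 1
  field_simp
  ring

/-- The constant in the rates for negative `λ`. -/
lemma neg_rate_const (hd : WellData lam γ₀ h p₀ m A B C) (h0 : lam < 0) :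
    2 * Real.pi * |lam| * (2 * lam + 1) * √(A * C - B ^ 2)
      = (lam + 1) * (2 * lam + 1)
        / (1 / (2 * Real.pi * √(A * C - B ^ 2)) * (lam + 1) / -lam) := by
  have := hd.lam_pos
  have := Real.sqrt_pos.2 hd.well.det_pos
  have := Real.pi_pos
  have h0' : lam ≠ 0 := h0.ne
  rw [abs_of_neg h0]
  field_simp

/-- At x = 0 the amplification is δ^(1/(λ+1)) K, which for λ < 0 is equivalent to kδ; δ is then
expressed through T - t in each regime. -/
lemma vortVal_zero_equiv (hd : WellData lam γ₀ h p₀ m A B C)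
    (hS : IsSolutionUpTo lam γ₀ T S) :
    Asymptotics.IsEquivalent (𝓝[<] T) (fun t => vortVal lam h 0 (gap lam m (S t)))
      (vortMinRate lam (sStar lam γ₀) (A * C - B ^ 2)
        (torusAvg fun p => h p ^ (-(1 / (lam + 1)))) T) := by
  have hl := hd.lam_pos
  have hl2 : 0 < 2 * lam + 1 := by linarith [hd.lam_gt]
  have hgap := hd.tendsto_gap_solution hS
  have hc := hd.coef_pos
  refine isEquivalent_of_tendsto_div ?_
  rcases lt_trichotomy lam 0 with h0 | h0 | h0
  · have hk := hd.coef_neg_pos h0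
    have hW := hd.neg_rate_const h0
    have hK := (hd.tendsto_powAvg_neg h0).comp hgap
    have hR := hd.tendsto_remaining_neg hS h0
    set k := 1 / (2 * Real.pi * √(A * C - B ^ 2)) * (lam + 1) / -lam
    have hP : 0 < (lam + 1) * (2 * lam + 1) := by positivity
    have hk2 := Real.rpow_pos_of_pos hk (2 * (lam + 1))
    have hWp : 0 < (lam + 1) * (2 * lam + 1) / k := by positivity
    have h1 := (hK.mul (hR.rpow_const (p := -(1 / (2 * lam + 1)))
      (Or.inl (by positivity)))).div_const (((lam + 1) * (2 * lam + 1) / k) ^ (1 / (2 * lam + 1)))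
    -- With W = (λ+1)(2λ+1)/k, the inner quotient is k^(2λ+1)/W, so its power -1/(2λ+1) is
    -- W^(1/(2λ+1))/k.
    have e1 : k * (k ^ (2 * (lam + 1)) / ((lam + 1) * (2 * lam + 1))) ^ (-(1 / (2 * lam + 1)))
        / ((lam + 1) * (2 * lam + 1) / k) ^ (1 / (2 * lam + 1)) = 1 := by
      have e2 : k ^ (2 * (lam + 1)) = k ^ (2 * lam + 1) * k := by
        rw [← Real.rpow_add_one hk.ne']; congr 1; ring
      have hkp := Real.rpow_pos_of_pos hk (2 * lam + 1)
      rw [Real.rpow_neg (by positivity), e2, show k ^ (2 * lam + 1) * k /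
        ((lam + 1) * (2 * lam + 1)) = k ^ (2 * lam + 1) * ((lam + 1) * (2 * lam + 1) / k)⁻¹ by
          field_simp, Real.mul_rpow hkp.le (by positivity), ← Real.rpow_mul hk.le,
        mul_one_div_cancel hl2.ne', Real.rpow_one, Real.inv_rpow hWp.le]
      have := Real.rpow_pos_of_pos hWp (1 / (2 * lam + 1))
      generalize ((lam + 1) * (2 * lam + 1) / k) ^ (1 / (2 * lam + 1)) = X at *
      field_simp
    rw [e1] at h1
    refine h1.congr' ?_
    filter_upwards [hd.eventually_gap_pos hS] with t ht
    have hg := Real.rpow_pos_of_pos ht.2 (2 * lam + 1)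
    simp only [Function.comp]
    rw [vortMinRate, if_pos h0, hW, vortVal, zero_add, hd.rpow_gap_regime ht.2,
      Real.rpow_neg (div_pos ht.1 hg).le, Real.div_rpow ht.1.le hg.le, ← Real.rpow_mul ht.2.le,
      mul_one_div_cancel hl2.ne', Real.rpow_one, inv_div]
    have := ht.2
    have := Real.rpow_pos_of_pos hWp (1 / (2 * lam + 1))
    have := Real.rpow_pos_of_pos ht.1 (1 / (2 * lam + 1))
    field_simp
  · have hsΔ := mul_pos hd.sStar_pos hd.well.det_pos
    have hsp := hd.tendsto_speed hS
    rw [if_pos h0.le, show 1 / ((lam + 1) * (2 * lam + 1)) = 1 by rw [h0]; norm_num] at hsp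
    have hpi := Real.pi_pos
    have hsD := Real.sqrt_pos.2 hd.well.det_pos
    -- As (T - t)/(K²δ) tends to 1, δK ~ (T - t)/K, and K ~ -log δ/(2π√Δ) ~ w/(π√Δ).
    have h1 := ((hsp.inv₀ one_ne_zero).mul (((hd.tendsto_powAvg_zero h0).comp hgap).inv₀ hc.ne')).mul
      ((hd.tendsto_log_gap_div_absW hS h0 hsΔ).inv₀ two_ne_zero)
    have h2 := h1.mul_const (Real.pi * √(A * C - B ^ 2))⁻¹
    rw [show (1 : ℝ)⁻¹ * (1 / (2 * Real.pi * √(A * C - B ^ 2)))⁻¹ * 2⁻¹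
      * (Real.pi * √(A * C - B ^ 2))⁻¹ = 1 by field_simp] at h2
    refine h2.congr' ?_
    filter_upwards [hd.eventually_gap_pos hS, eventually_absW T hsΔ,
      hgap (Ioo_mem_nhdsGT (zero_lt_one' ℝ))] with t ht hw hg
    have hlg : Real.log (gap lam m (S t)) ≠ 0 := (Real.log_neg hg.1 hg.2).ne
    have hw0 : absW (sStar lam γ₀) (A * C - B ^ 2) T t ≠ 0 := by linarith [hw.1]
    have hK := hd.powAvg_pos ht.2
    have hT := ht.1
    have hg0 := ht.2
    simp only [Function.comp]
    rw [vortMinRate, if_neg h0.not_lt, if_pos h0, vortVal, zero_add,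
      show -(2 * (lam + 1)) = -((2 : ℕ) : ℝ) by rw [h0]; norm_num, Real.rpow_neg hK.le,
      Real.rpow_natCast,
      show ∀ y : ℝ, y ^ (1 / (lam + 1)) = y from fun y => by rw [h0]; norm_num]
    field_simp
  · have hk := hd.avg_pos h0
    have hKM := (hd.tendsto_powAvg_of_pos h0).comp hgap
    have hR := hd.tendsto_remaining_pos hS h0
    set M := torusAvg fun p => h p ^ (-(1 / (lam + 1))) with hM
    have hP := Real.rpow_pos_of_pos hk (2 * (lam + 1))
    have h1 := (hKM.mul (hR.rpow_const (p := -(1 / (lam + 1))) (Or.inl (by positivity)))).div_const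
      ((lam + 1) ^ (1 / (lam + 1)) / M)
    have hX := Real.rpow_pos_of_pos hl (1 / (lam + 1))
    rw [Real.rpow_neg (by positivity), Real.div_rpow hP.le hl.le, ← Real.rpow_mul hk.le,
      show 2 * (lam + 1) * (1 / (lam + 1)) = ((2 : ℕ) : ℝ) by field_simp; norm_num,
      Real.rpow_natCast, show M * (M ^ 2 / (lam + 1) ^ (1 / (lam + 1)))⁻¹ /
        ((lam + 1) ^ (1 / (lam + 1)) / M) = 1 by field_simp] at h1
    refine h1.congr' ?_
    filter_upwards [hd.eventually_gap_pos hS] with t ht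
    simp only [Function.comp]
    rw [vortMinRate, if_neg h0.le.not_gt, if_neg h0.ne', vortVal, zero_add,
      Real.rpow_neg (div_pos ht.1 ht.2).le, Real.div_rpow ht.1.le ht.2.le]
    have h3 := Real.rpow_pos_of_pos ht.1 (1 / (lam + 1))
    have h4 := Real.rpow_pos_of_pos ht.2 (1 / (lam + 1))
    field_simp

lemma vortVal_pos_equiv (hd : WellData lam γ₀ h p₀ m A B C)
    (hS : IsSolutionUpTo lam γ₀ T S) (hle : lam ≤ 0) {x : ℝ} (hx : 0 < x) :
    Asymptotics.IsEquivalent (𝓝[<] T) (fun t => vortVal lam h x (gap lam m (S t)))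
      (vortOtherRate lam (sStar lam γ₀) (A * C - B ^ 2) x T) := by
  have hl := hd.lam_pos
  have hl2 : 0 < 2 * lam + 1 := by linarith [hd.lam_gt]
  have hgap := hd.tendsto_gap_solution hS
  have hc := hd.coef_pos
  have hxq := (tendsto_add_rpow (x := x) hd.inv_pos).comp hgap
  have hxp := Real.rpow_pos_of_pos hx (1 / (lam + 1))
  refine isEquivalent_of_tendsto_div ?_
  rcases hle.lt_or_eq with h0 | h0
  · have hk := hd.coef_neg_pos h0
    have hW := hd.neg_rate_const h0
    have hK := (hd.tendsto_powAvg_neg h0).comp hgap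
    have hR := hd.tendsto_remaining_neg hS h0
    set k := 1 / (2 * Real.pi * √(A * C - B ^ 2)) * (lam + 1) / -lam
    have hP : 0 < (lam + 1) * (2 * lam + 1) := by positivity
    have hk2 := Real.rpow_pos_of_pos hk (2 * (lam + 1))
    have hWp : 0 < (lam + 1) * (2 * lam + 1) / k := by positivity
    -- The amplification is of order δ^(λ/(λ+1)) and δ of order (T - t)^(1/(2λ+1)), whence the
    -- exponent -e. The constants match because 1/(2λ+1) equals both 1 + 2(λ+1)e and 1/(λ+1) + e.
    set e := -lam / ((lam + 1) * (2 * lam + 1)) with he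
    have h1 := ((hxq.mul hK).mul (hR.rpow_const (p := e) (Or.inl (by positivity)))).div_const
      (((lam + 1) * (2 * lam + 1) * x) ^ (1 / (lam + 1))
        / ((lam + 1) * (2 * lam + 1) / k) ^ (1 / (2 * lam + 1)))
    have hne := hl2.ne'
    have e1 : x ^ (1 / (lam + 1)) * k * (k ^ (2 * (lam + 1)) / ((lam + 1) * (2 * lam + 1))) ^ e /
        (((lam + 1) * (2 * lam + 1) * x) ^ (1 / (lam + 1))
          / ((lam + 1) * (2 * lam + 1) / k) ^ (1 / (2 * lam + 1))) = 1 := by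
      rw [Real.mul_rpow hP.le hx.le, Real.div_rpow hk2.le hP.le, Real.div_rpow hP.le hk.le,
        ← Real.rpow_mul hk.le]
      have e2 : k ^ (1 / (2 * lam + 1)) = k * k ^ (2 * (lam + 1) * e) := by
        nth_rewrite 2 [← Real.rpow_one k]
        rw [← Real.rpow_add hk]
        congr 1
        rw [he]
        have := hl.ne'
        rw [show 2 * (lam + 1) * (-lam / ((lam + 1) * (2 * lam + 1))) = 2 * -lam / (2 * lam + 1) by
          rw [mul_div_assoc', mul_comm 2 (lam + 1), mul_assoc (lam + 1),
            mul_div_mul_left _ _ this]]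
        rw [eq_comm, ← sub_eq_zero]
        have : 1 + 2 * -lam / (2 * lam + 1) - 1 / (2 * lam + 1)
          = ((2 * lam + 1) + 2 * -lam - 1) / (2 * lam + 1) := by
          rw [sub_div, add_div, div_self hne]
        rw [this, show 2 * lam + 1 + 2 * -lam - 1 = 0 by ring, zero_div]
      have e3 : ((lam + 1) * (2 * lam + 1)) ^ (1 / (2 * lam + 1))
          = ((lam + 1) * (2 * lam + 1)) ^ (1 / (lam + 1)) * ((lam + 1) * (2 * lam + 1)) ^ e := by
        rw [← Real.rpow_add hP]
        congr 1
        have := hl.ne'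
        rw [he, div_add_div _ _ this hP.ne', div_eq_div_iff hne (mul_ne_zero this hP.ne')]
        ring
      rw [e2, e3]
      have a1 := Real.rpow_pos_of_pos hP (1 / (lam + 1))
      have a2 := Real.rpow_pos_of_pos hP e
      have a3 := Real.rpow_pos_of_pos hk (2 * (lam + 1) * e)
      generalize ((lam + 1) * (2 * lam + 1)) ^ (1 / (lam + 1)) = X1 at *
      generalize ((lam + 1) * (2 * lam + 1)) ^ e = X2 at *
      generalize k ^ (2 * (lam + 1) * e) = X3 at *
      generalize x ^ (1 / (lam + 1)) = X4 at *
      field_simp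
    rw [e1] at h1
    refine h1.congr' ?_
    filter_upwards [hd.eventually_gap_pos hS] with t ht
    have hg := Real.rpow_pos_of_pos ht.2 (2 * lam + 1)
    simp only [Function.comp]
    rw [vortOtherRate, if_pos h0, hW, vortVal, abs_of_neg h0, ← he,
      Real.div_rpow ht.1.le hg.le, ← Real.rpow_mul ht.2.le,
      show (2 * lam + 1) * e = -lam / (lam + 1) by
        rw [he, mul_div_assoc', mul_comm (lam + 1), mul_div_mul_left _ _ hne],
      Real.rpow_neg ht.1.le]
    have a1 := Real.rpow_pos_of_pos ht.2 (-lam / (lam + 1))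
    have a2 := Real.rpow_pos_of_pos ht.1 e
    generalize gap lam m (S t) ^ (-lam / (lam + 1)) = X1 at *
    generalize (T - t) ^ e = X2 at *
    have a3 : ((lam + 1) * (2 * lam + 1) * x) ^ (1 / (lam + 1)) ≠ 0 :=
      (Real.rpow_pos_of_pos (mul_pos hP hx) _).ne'
    have a4 := (Real.rpow_pos_of_pos hWp (1 / (2 * lam + 1))).ne'
    generalize ((lam + 1) * (2 * lam + 1) * x) ^ (1 / (lam + 1)) = X3 at *
    generalize ((lam + 1) * (2 * lam + 1) / k) ^ (1 / (2 * lam + 1)) = X4 at *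
    field_simp
  · have hsΔ := mul_pos hd.sStar_pos hd.well.det_pos
    have hpi := Real.pi_pos
    have hsD := Real.sqrt_pos.2 hd.well.det_pos
    have h1 := (hxq.mul ((hd.tendsto_powAvg_zero h0).comp hgap)).mul
      (hd.tendsto_log_gap_div_absW hS h0 hsΔ)
    have h2 := h1.div_const (x / (Real.pi * √(A * C - B ^ 2)))
    rw [show x ^ (1 / (lam + 1)) = x by rw [h0]; norm_num,
      show x * (1 / (2 * Real.pi * √(A * C - B ^ 2))) * 2
      / (x / (Real.pi * √(A * C - B ^ 2))) = 1 by field_simp] at h2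
    refine h2.congr' ?_
    filter_upwards [hd.eventually_gap_pos hS, eventually_absW T hsΔ,
      hgap (Ioo_mem_nhdsGT (zero_lt_one' ℝ))] with t ht hw hg
    have hlg : Real.log (gap lam m (S t)) ≠ 0 := (Real.log_neg hg.1 hg.2).ne
    have hw0 : absW (sStar lam γ₀) (A * C - B ^ 2) T t ≠ 0 := by linarith [hw.1]
    simp only [Function.comp]
    rw [vortOtherRate, if_neg h0.not_lt, vortVal]
    field_simp

lemma tendsto_vortVal_zero (hd : WellData lam γ₀ h p₀ m A B C) :
    Tendsto (vortVal lam h 0) (𝓝[>] 0) (𝓝 0) := by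
  have hl := hd.lam_pos
  rw [show vortVal lam h 0 = fun δ => δ ^ (1 / (lam + 1)) * powAvg h (1 / (lam + 1)) δ from
    funext fun δ => by rw [vortVal, zero_add]]
  rcases lt_trichotomy lam 0 with h0 | h0 | h0
  · have h1 := (hd.tendsto_powAvg_neg h0).mul tendsto_id_nhdsGT_zero
    rw [mul_zero] at h1
    refine h1.congr' ?_
    filter_upwards [self_mem_nhdsWithin] with δ hδ
    rw [hd.rpow_gap_regime hδ]
    ring
  · have h1 : Tendsto (fun δ : ℝ => Real.log δ * δ ^ (1 : ℝ)) (𝓝[>] 0) (𝓝 0) :=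
      tendsto_log_mul_rpow_nhdsGT_zero one_pos
    have h2 := ((hd.tendsto_powAvg_zero h0).mul h1).neg
    rw [mul_zero, neg_zero] at h2
    refine h2.congr' ?_
    filter_upwards [Ioo_mem_nhdsGT (zero_lt_one' ℝ)] with δ hδ
    have := (Real.log_neg hδ.1 hδ.2).ne
    rw [show (1 : ℝ) / (lam + 1) = 1 by rw [h0]; norm_num]
    field_simp
  · have h1 := (tendsto_rpow_nhdsGT_zero hd.inv_pos).mul (hd.tendsto_powAvg_of_pos h0)
    rwa [zero_mul] at h1

lemma tendsto_vortVal_atTop (hd : WellData lam γ₀ h p₀ m A B C) (hle : lam ≤ 0) {x : ℝ}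
    (hx : 0 < x) : Tendsto (vortVal lam h x) (𝓝[>] 0) atTop := by
  have hl := hd.lam_pos
  have hxq := tendsto_add_rpow (x := x) hd.inv_pos
  have hxp := Real.rpow_pos_of_pos hx (1 / (lam + 1))
  suffices Tendsto (powAvg h (1 / (lam + 1))) (𝓝[>] 0) atTop from hxq.pos_mul_atTop hxp this
  rcases hle.lt_or_eq with h0 | h0
  · have he : 0 < -lam / (lam + 1) := div_pos (by linarith) hl
    have h1 : Tendsto (fun δ : ℝ => (δ ^ (-lam / (lam + 1)))⁻¹) (𝓝[>] 0) atTop := by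
      refine tendsto_inv_nhdsGT_zero.comp
        (tendsto_nhdsWithin_iff.2 ⟨tendsto_rpow_nhdsGT_zero he, ?_⟩)
      filter_upwards [self_mem_nhdsWithin] with δ hδ using Real.rpow_pos_of_pos hδ _
    refine ((hd.tendsto_powAvg_neg h0).pos_mul_atTop (hd.coef_neg_pos h0) h1).congr' ?_
    filter_upwards [self_mem_nhdsWithin] with δ hδ
    have := Real.rpow_pos_of_pos (show 0 < δ from hδ) (-lam / (lam + 1))
    generalize δ ^ (-lam / (lam + 1)) = X at *
    field_simp
  · have hlog : Tendsto (fun δ : ℝ => -Real.log δ) (𝓝[>] 0) atTop :=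
      tendsto_neg_atBot_atTop.comp Real.tendsto_log_nhdsGT_zero
    refine ((hd.tendsto_powAvg_zero h0).pos_mul_atTop hd.coef_pos hlog).congr' ?_
    filter_upwards [Ioo_mem_nhdsGT (zero_lt_one' ℝ)] with δ hδ
    have := (Real.log_neg hδ.1 hδ.2).ne
    field_simp

lemma vortVal_nonneg (hd : WellData lam γ₀ h p₀ m A B C) {x δ : ℝ} (hx : 0 ≤ x) (hδ : 0 < δ) :
    0 ≤ vortVal lam h x δ :=
  mul_nonneg (Real.rpow_nonneg (by linarith) _) (hd.powAvg_pos hδ).le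

/-- All gaps must be covered, since δ is large for small t. For δ ≤ 1 the average K is bounded; for
δ ≥ 1 the decay K ≤ δ^(-1/(λ+1)) compensates the growth of the other factor. -/
lemma exists_vortVal_le (hd : WellData lam γ₀ h p₀ m A B C) (h0 : 0 < lam) {x : ℝ} (hx : 0 ≤ x) :
    ∃ c, ∀ δ > 0, vortVal lam h x δ ≤ c := by
  have hl := hd.lam_pos
  have hq := hd.inv_pos
  obtain ⟨c, hc⟩ := hd.well.exists_powAvg_le hq (by rw [div_lt_one hl]; linarith)
  refine ⟨(x + 1) ^ (1 / (lam + 1)) * max c 1, fun δ hδ => ?_⟩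
  rcases le_total δ 1 with h1 | h1
  · have h2 := (hc δ ⟨hδ, h1⟩).trans (le_max_left c 1)
    have h3 := (hd.powAvg_pos hδ).le
    exact mul_le_mul (Real.rpow_le_rpow (by linarith) (by linarith) hq.le) h2 h3 (by positivity)
  · have h2 := hd.well.powAvg_le hq.le hδ
    calc vortVal lam h x δ ≤ (x + δ) ^ (1 / (lam + 1)) * δ ^ (-(1 / (lam + 1))) := by
          unfold vortVal; gcongr
      _ = ((x + δ) / δ) ^ (1 / (lam + 1)) := by
          rw [Real.rpow_neg hδ.le, Real.div_rpow (by positivity) hδ.le, ← div_eq_mul_inv]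
      _ ≤ (x + 1) ^ (1 / (lam + 1)) := by
          refine Real.rpow_le_rpow (by positivity) ?_ hq.le
          rw [div_le_iff₀ hδ]
          nlinarith
      _ ≤ (x + 1) ^ (1 / (lam + 1)) * max c 1 :=
          le_mul_of_one_le_right (by positivity) (le_max_right _ _)

lemma stretchVal_mono {x x' δ : ℝ} (hd : WellData lam γ₀ h p₀ m A B C) (hδ : 0 < δ) (hx : 0 ≤ x)
    (hxx : x ≤ x') : stretchVal lam h x δ ≤ stretchVal lam h x' δ := by
  have hK := hd.powAvg_pos hδ
  unfold stretchVal
  gcongr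

end WellData

/-! ### Conservation of integrals over the torus -/

lemma cell_ae_eq_Icc :
    cell =ᵐ[volume] Icc ((0, 0) : ℝ × ℝ) (2 * Real.pi, 2 * Real.pi) := by
  rw [← Icc_prod_Icc, Measure.volume_eq_prod]
  exact Measure.set_prod_ae_eq Ico_ae_eq_Icc Ico_ae_eq_Icc

lemma cell_subset_Icc : cell ⊆ Icc ((0, 0) : ℝ × ℝ) (2 * Real.pi, 2 * Real.pi) := by
  rw [← Icc_prod_Icc]
  exact prod_mono Ico_subset_Icc_self Ico_subset_Icc_self

/-- The divergence of a periodic field has integral zero. -/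
lemma setIntegral_div_eq_zero {v₁ v₂ : ℝ × ℝ → ℝ} (p₁ : TorusPeriodic v₁) (p₂ : TorusPeriodic v₂)
    (d₁ : Differentiable ℝ v₁) (d₂ : Differentiable ℝ v₂)
    (hc : Continuous fun p => dx v₁ p + dy v₂ p) :
    ∫ p in cell, (dx v₁ p + dy v₂ p) = 0 := by
  have hpi := Real.pi_pos
  rw [setIntegral_congr_set cell_ae_eq_Icc]
  have := integral_divergence_prod_Icc_of_hasFDerivAt_of_le v₁ v₂ (fderiv ℝ v₁) (fderiv ℝ v₂)
    (0, 0) (2 * Real.pi, 2 * Real.pi) ⟨by simp [hpi.le], by simp [hpi.le]⟩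
    d₁.continuous.continuousOn d₂.continuous.continuousOn
    (fun x _ => (d₁ x).hasFDerivAt) (fun x _ => (d₂ x).hasFDerivAt)
    (hc.continuousOn.integrableOn_compact isCompact_Icc)
  simp only [dx, dy]
  rw [this]
  have e₁ : ∀ y, v₁ (2 * Real.pi, y) = v₁ (0, y) := fun y => by simpa using p₁.left y 0
  have e₂ : ∀ x, v₂ (x, 2 * Real.pi) = v₂ (x, 0) := fun x => by simpa using p₂.right x 0
  simp [e₁, e₂]

/-- A function with vanishing derivative in the interior is constant. -/
lemma eq_of_hasDerivAt_zero {f : ℝ → ℝ} {a b : ℝ} (hab : a ≤ b) (hc : ContinuousOn f (Icc a b))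
    (hd : ∀ t ∈ Ioo a b, HasDerivAt f 0 t) : f b = f a := by
  rcases hab.eq_or_lt with rfl | hlt
  · rfl
  · obtain ⟨c, -, h⟩ := exists_hasDerivAt_eq_slope f (fun _ => 0) hlt hc hd
    rw [eq_comm, div_eq_zero_iff] at h
    rcases h with h | h <;> linarith

/-- If the time derivative of a field has zero integral, the integral of the field is conserved. -/
lemma setIntegral_conserved {τ : ℝ} (hτ : 0 ≤ τ) {F F' : ℝ → ℝ × ℝ → ℝ}
    (hc : ContinuousOn (fun z : ℝ × (ℝ × ℝ) => F z.1 z.2) (Icc 0 τ ×ˢ univ))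
    (hF : ∀ t ∈ Ioo 0 τ, ∀ p, HasDerivAt (fun s => F s p) (F' t p) t)
    (hc' : ContinuousOn (fun z : ℝ × (ℝ × ℝ) => F' z.1 z.2) (Ioo 0 τ ×ˢ univ))
    (h0 : ∀ t ∈ Ioo 0 τ, ∫ p in cell, F' t p = 0) :
    ∫ p in cell, F τ p = ∫ p in cell, F 0 p := by
  set Q := Icc ((0, 0) : ℝ × ℝ) (2 * Real.pi, 2 * Real.pi) with hQ
  have hmF : ∀ t ∈ Icc 0 τ, Continuous (F t) := fun t ht =>
    continuousOn_univ.1 (hc.comp (f := fun p : ℝ × ℝ => (t, p)) (by fun_prop)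
      fun p _ => ⟨ht, mem_univ _⟩)
  have hmF' : ∀ t ∈ Ioo 0 τ, Continuous (F' t) := fun t ht =>
    continuousOn_univ.1 (hc'.comp (f := fun p : ℝ × ℝ => (t, p)) (by fun_prop)
      fun p _ => ⟨ht, mem_univ _⟩)
  -- The time derivative is available only in the open interval, so continuity up to the endpoints
  -- is proved separately.
  refine eq_of_hasDerivAt_zero (f := fun t => ∫ p in cell, F t p) hτ ?_ fun t ht => ?_
  · obtain ⟨k, hk⟩ := (isCompact_Icc.prod (isCompact_Icc (a := ((0, 0) : ℝ × ℝ))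
      (b := (2 * Real.pi, 2 * Real.pi)))).exists_bound_of_continuousOn
      (hc.mono (prod_mono_right (subset_univ _)))
    refine MeasureTheory.continuousOn_of_dominated (bound := fun _ => k)
      (fun t ht => (hmF t ht).aestronglyMeasurable)
      (fun t ht => (ae_restrict_iff' measurableSet_cell).2
        (ae_of_all _ fun p hp => hk (t, p) ⟨ht, cell_subset_Icc hp⟩))
      (integrable_const _) (ae_of_all _ fun p => ?_)
    exact hc.comp (f := fun t : ℝ => (t, p)) (by fun_prop) fun t ht => ⟨ht, mem_univ _⟩
  · obtain ⟨t₁, ht₁, ht₁'⟩ := exists_between ht.1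
    obtain ⟨t₂, ht₂, ht₂'⟩ := exists_between ht.2
    have hsub : Icc t₁ t₂ ⊆ Ioo 0 τ := fun s hs => ⟨ht₁.trans_le hs.1, hs.2.trans_lt ht₂'⟩
    obtain ⟨k, hk⟩ := (isCompact_Icc.prod (isCompact_Icc (a := ((0, 0) : ℝ × ℝ))
      (b := (2 * Real.pi, 2 * Real.pi)))).exists_bound_of_continuousOn
      (hc'.mono (prod_mono hsub (subset_univ _)))
    have hder := hasDerivAt_integral_of_dominated_loc_of_deriv_le (μ := volume.restrict cell)
      (F := F) (F' := F') (x₀ := t) (s := Icc t₁ t₂) (bound := fun _ => k)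
      (Icc_mem_nhds ht₁' ht₂)
      (by
        filter_upwards [Ioo_mem_nhds ht.1 ht.2] with s hs
        exact (hmF s (Ioo_subset_Icc_self hs)).aestronglyMeasurable)
      ((((hmF t (Ioo_subset_Icc_self ht)).continuousOn).integrableOn_compact
        isCompact_Icc).mono_set cell_subset_Icc)
      (hmF' t ht).aestronglyMeasurable
      ((ae_restrict_iff' measurableSet_cell).2
        (ae_of_all _ fun p hp s hs => hk (s, p) ⟨hs, cell_subset_Icc hp⟩))
      (integrable_const _) (ae_of_all _ fun p _ hs => hF _ (hsub hs) p)
    rw [h0 t ht] at hder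
    exact hder.2

/-- Linear scalar equations. -/
lemma eq_mul_exp_of_hasDerivAt {f g : ℝ → ℝ} {τ : ℝ} (hg : Continuous g)
    (hc : ContinuousOn f (Icc 0 τ)) (hd : ∀ t ∈ Ioo 0 τ, HasDerivAt f (g t * f t) t) {t : ℝ}
    (ht : t ∈ Icc 0 τ) : f t = f 0 * Real.exp (∫ s in (0 : ℝ)..t, g s) := by
  have hG : ∀ s, HasDerivAt (fun s => ∫ r in (0 : ℝ)..s, g r) (g s) s := fun s =>
    intervalIntegral.integral_hasDerivAt_right (hg.intervalIntegrable _ _)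
      hg.aestronglyMeasurable.stronglyMeasurableAtFilter hg.continuousAt
  have hGc : Continuous fun s => ∫ r in (0 : ℝ)..s, g r :=
    continuous_iff_continuousAt.2 fun s => (hG s).continuousAt
  have key := eq_of_hasDerivAt_zero (f := fun s => f s * Real.exp (-∫ r in (0 : ℝ)..s, g r)) ht.1
    ((hc.mono (Icc_subset_Icc_right ht.2)).mul (by fun_prop)) fun _ hs => by
      refine ((hd _ ⟨hs.1, hs.2.trans_le ht.2⟩).mul (hG _).neg.exp).congr_deriv ?_
      ring
  simp only [intervalIntegral.integral_same, neg_zero, Real.exp_zero, mul_one] at key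
  rw [← key, mul_assoc, ← Real.exp_add, neg_add_cancel, Real.exp_zero, mul_one]

/-! ### Pathlines of classical solutions -/

/-- `X` is a pathline on the closed interval `[0, τ]`. -/
def IsPathlineOn (τ : ℝ) (u : ℝ → ℝ × ℝ → ℝ × ℝ) (X : ℝ → ℝ × ℝ) : Prop :=
  ∀ t ∈ Icc 0 τ, HasDerivWithinAt X (u t (X t)) (Icc 0 τ) t

lemma IsPathline.isPathlineOn {T τ : ℝ} {u : ℝ → ℝ × ℝ → ℝ × ℝ} {x₀ : ℝ × ℝ} {X : ℝ → ℝ × ℝ}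
    (hX : IsPathline T u x₀ X) (hτ : τ < T) : IsPathlineOn τ u X := fun t ht =>
  (hX.ode t ⟨ht.1, ht.2.trans_lt hτ⟩).mono fun _ hs => ⟨hs.1, hs.2.trans_lt hτ⟩

lemma IsPathlineOn.continuousOn {τ : ℝ} {u : ℝ → ℝ × ℝ → ℝ × ℝ} {X : ℝ → ℝ × ℝ}
    (hX : IsPathlineOn τ u X) : ContinuousOn X (Icc 0 τ) := fun t ht =>
  (hX t ht).continuousWithinAt

lemma exists_samePoint_cell (p : ℝ × ℝ) : ∃ q ∈ cell, SamePoint p q := by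
  have h : ∀ x : ℝ, ∃ n : ℤ, x + n * (2 * Real.pi) ∈ Ico 0 (2 * Real.pi) := fun x => by
    obtain ⟨n, hn, -⟩ := existsUnique_add_zsmul_mem_Ico (show 0 < 2 * Real.pi by
      linarith [Real.pi_pos]) x 0
    exact ⟨n, by simpa using hn⟩
  obtain ⟨k, hk⟩ := h p.1
  obtain ⟨l, hl⟩ := h p.2
  exact ⟨_, ⟨hk, hl⟩, k, l, rfl⟩

/-- Pathlines of a `C¹` periodic velocity exist through every point of space-time. -/
lemma exists_isPathlineOn {T τ : ℝ} {u : ℝ → ℝ × ℝ → ℝ × ℝ}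
    (hper : ∀ t ∈ Ico 0 T, TorusPeriodic (u t))
    (hu : ContDiffOn ℝ 1 (fun z : ℝ × (ℝ × ℝ) => u z.1 z.2) (Ico 0 T ×ˢ univ)) (hτ : τ < T)
    {t₀ : ℝ} (ht₀ : t₀ ∈ Icc 0 τ) (p : ℝ × ℝ) : ∃ X, X t₀ = p ∧ IsPathlineOn τ u X := by
  have hsub : Icc 0 τ ⊆ Ico 0 T := fun t ht => ⟨ht.1, ht.2.trans_lt hτ⟩
  have hτ0 : 0 ≤ τ := ht₀.1.trans ht₀.2
  obtain ⟨k, hk⟩ := (isCompact_Icc.prod (isCompact_Icc (a := ((0, 0) : ℝ × ℝ))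
      (b := (2 * Real.pi, 2 * Real.pi)))).exists_bound_of_continuousOn
      (hu.continuousOn.mono (prod_mono hsub (subset_univ _)))
  have hbound : ∀ t ∈ Icc 0 τ, ∀ x, ‖u t x‖ ≤ max k 0 := by
    intro t ht x
    obtain ⟨q, hq, hxq⟩ := exists_samePoint_cell x
    rw [← hper t (hsub ht) x q hxq]
    exact (hk (t, q) ⟨ht, cell_subset_Icc hq⟩).trans (le_max_left _ _)
  set L : NNReal := ⟨max k 0, le_max_right _ _⟩ with hL
  -- By periodicity the speed bound L is global, so a ball of radius Lτ holds every trajectory over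
  -- [0, τ], and Picard–Lindelöf covers the whole interval at once.
  set a : NNReal := L * ⟨τ, hτ0⟩ with ha
  obtain ⟨K, hK⟩ : ∃ K : NNReal, LipschitzOnWith K (fun z : ℝ × (ℝ × ℝ) => u z.1 z.2)
      (Icc 0 τ ×ˢ Metric.closedBall p a) := by
    have hloc : LocallyLipschitzOn (Icc 0 τ ×ˢ Metric.closedBall p a)
        (fun z : ℝ × (ℝ × ℝ) => u z.1 z.2) := by
      intro z hz
      obtain ⟨K, s, hs, hl⟩ := ((hu.mono (prod_mono hsub (subset_univ _))) z
        hz).exists_lipschitzOnWith ((convex_Icc 0 τ).prod (convex_closedBall p a))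
      exact ⟨K, s, hs, hl⟩
    exact hloc.exists_lipschitzOnWith_of_compact
      (isCompact_Icc.prod (isCompact_closedBall p _))
  have hPL : IsPicardLindelof u (tmin := 0) (tmax := τ) ⟨t₀, ht₀⟩ p a 0 L K := by
    refine ⟨fun t ht => ?_, fun x _ => ?_, fun t ht x _ => hbound t ht x, ?_⟩
    · have := hK.comp (f := fun x : ℝ × ℝ => (t, x)) (K := 1)
        (s := Metric.closedBall p a) (LipschitzWith.prodMk_left t).lipschitzOnWith
        fun x hx => ⟨ht, hx⟩
      rw [mul_one] at this
      exact this
    · exact hu.continuousOn.comp (f := fun t : ℝ => (t, x)) (by fun_prop)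
        fun t ht => ⟨hsub ht, mem_univ _⟩
    · have h1 : max (τ - t₀) (t₀ - 0) ≤ τ := max_le (by linarith [ht₀.1]) (by linarith [ht₀.2])
      simp only [ha, NNReal.coe_zero, sub_zero] at h1 ⊢
      exact mul_le_mul_of_nonneg_left h1 L.2
  obtain ⟨X, hX0, hX⟩ := hPL.exists_eq_forall_mem_Icc_hasDerivWithinAt₀
  exact ⟨X, hX0, hX⟩

section Field

variable {T t : ℝ} {f : ℝ → ℝ × ℝ → ℝ}
  (hf : ContDiffOn ℝ 1 (fun z : ℝ × (ℝ × ℝ) => f z.1 z.2) (Ico 0 T ×ˢ univ))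

include hf

lemma hasFDerivAt_field (ht : t ∈ Ioo 0 T) (p : ℝ × ℝ) :
    HasFDerivAt (fun z : ℝ × (ℝ × ℝ) => f z.1 z.2)
      (fderiv ℝ (fun z : ℝ × (ℝ × ℝ) => f z.1 z.2) (t, p)) (t, p) :=
  ((hf.contDiffAt (prod_mem_nhds (Ico_mem_nhds ht.1 ht.2) univ_mem)).differentiableAt
    one_ne_zero).hasFDerivAt

lemma hasFDerivAt_slice (ht : t ∈ Ioo 0 T) (p : ℝ × ℝ) :
    HasFDerivAt (f t) ((fderiv ℝ (fun z : ℝ × (ℝ × ℝ) => f z.1 z.2) (t, p)).comp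
      (ContinuousLinearMap.inr ℝ ℝ (ℝ × ℝ))) p :=
  (hasFDerivAt_field hf ht p).comp (f := fun q : ℝ × ℝ => (t, q)) p (hasFDerivAt_prodMk_right t p)

lemma dx_slice (ht : t ∈ Ioo 0 T) (p : ℝ × ℝ) :
    dx (f t) p = fderiv ℝ (fun z : ℝ × (ℝ × ℝ) => f z.1 z.2) (t, p) (0, (1, 0)) := by
  rw [dx, (hasFDerivAt_slice hf ht p).fderiv]; rfl

lemma dy_slice (ht : t ∈ Ioo 0 T) (p : ℝ × ℝ) :
    dy (f t) p = fderiv ℝ (fun z : ℝ × (ℝ × ℝ) => f z.1 z.2) (t, p) (0, (0, 1)) := by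
  rw [dy, (hasFDerivAt_slice hf ht p).fderiv]; rfl

lemma hasDerivAt_time (ht : t ∈ Ioo 0 T) (p : ℝ × ℝ) : HasDerivAt (fun s => f s p)
    (fderiv ℝ (fun z : ℝ × (ℝ × ℝ) => f z.1 z.2) (t, p) (1, 0)) t :=
  (hasFDerivAt_field hf ht p).comp_hasDerivAt (f := fun s : ℝ => (s, p)) t
    ((hasDerivAt_id t).prodMk (hasDerivAt_const t p))

/-- The material derivative of a `C¹` field. -/
lemma hasDerivAt_along (ht : t ∈ Ioo 0 T) {X : ℝ → ℝ × ℝ} {v : ℝ × ℝ} (hX : HasDerivAt X v t) :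
    HasDerivAt (fun s => f s (X s)) (deriv (fun s => f s (X t)) t
      + (v.1 * dx (f t) (X t) + v.2 * dy (f t) (X t))) t := by
  have h1 := (hasFDerivAt_field hf ht (X t)).comp_hasDerivAt (f := fun s : ℝ => (s, X s)) t
    ((hasDerivAt_id t).prodMk hX)
  refine h1.congr_deriv ?_
  rw [(hasDerivAt_time hf ht (X t)).deriv, dx_slice hf ht, dy_slice hf ht]
  have : ((1 : ℝ), v) = (1, (0, 0)) + v.1 • ((0 : ℝ), ((1 : ℝ), (0 : ℝ)))
      + v.2 • ((0 : ℝ), ((0 : ℝ), (1 : ℝ))) := by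
    ext <;> simp
  rw [this, map_add, map_add, map_smul, map_smul, smul_eq_mul, smul_eq_mul, add_assoc]
  rfl

lemma continuousOn_fderiv_field :
    ContinuousOn (fderiv ℝ (fun z : ℝ × (ℝ × ℝ) => f z.1 z.2)) (Ioo 0 T ×ˢ univ) :=
  (hf.mono (prod_mono_left Ioo_subset_Ico_self)).continuousOn_fderiv_of_isOpen
    (isOpen_Ioo.prod isOpen_univ) le_rfl

lemma continuousOn_dx :
    ContinuousOn (fun z : ℝ × (ℝ × ℝ) => dx (f z.1) z.2) (Ioo 0 T ×ˢ univ) :=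
  ((continuousOn_fderiv_field hf).clm_apply continuousOn_const).congr
    fun z hz => dx_slice hf hz.1 z.2

lemma continuousOn_dy :
    ContinuousOn (fun z : ℝ × (ℝ × ℝ) => dy (f z.1) z.2) (Ioo 0 T ×ˢ univ) :=
  ((continuousOn_fderiv_field hf).clm_apply continuousOn_const).congr
    fun z hz => dy_slice hf hz.1 z.2

end Field

/-! ### Integrating factors along a base pathline -/

/-- The exponential `exp (a ∫₀ᵗ Y)`. -/
def expFactor (a : ℝ) (Y : ℝ → ℝ) (t : ℝ) : ℝ := Real.exp (a * ∫ s in (0 : ℝ)..t, Y s)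

/-- The integral of `exp (a ∫ Y)^(-2)`. -/
def innerTime (a : ℝ) (Y : ℝ → ℝ) (t : ℝ) : ℝ := ∫ s in (0 : ℝ)..t, (expFactor a Y s ^ 2)⁻¹

section Factors

variable {a : ℝ} {Y : ℝ → ℝ}

lemma expFactor_pos (t : ℝ) : 0 < expFactor a Y t := Real.exp_pos _

lemma expFactor_zero : expFactor a Y 0 = 1 := by simp [expFactor]

lemma innerTime_zero : innerTime a Y 0 = 0 := intervalIntegral.integral_same

lemma hasDerivAt_expFactor (hY : Continuous Y) (t : ℝ) :
    HasDerivAt (expFactor a Y) (a * Y t * expFactor a Y t) t := by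
  have h1 := (intervalIntegral.integral_hasDerivAt_right (hY.intervalIntegrable 0 t)
    hY.aestronglyMeasurable.stronglyMeasurableAtFilter hY.continuousAt).const_mul a
  exact h1.exp.congr_deriv (mul_comm _ _)

lemma continuous_expFactor (hY : Continuous Y) : Continuous (expFactor a Y) :=
  continuous_iff_continuousAt.2 fun t => (hasDerivAt_expFactor hY t).continuousAt

lemma hasDerivAt_innerTime (hY : Continuous Y) (t : ℝ) :
    HasDerivAt (innerTime a Y) ((expFactor a Y t ^ 2)⁻¹) t := by
  have hc : Continuous fun t => (expFactor a Y t ^ 2)⁻¹ :=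
    ((continuous_expFactor hY).pow 2).inv₀ fun t => (pow_pos (expFactor_pos t) 2).ne'
  exact intervalIntegral.integral_hasDerivAt_right (hc.intervalIntegrable 0 t)
    hc.aestronglyMeasurable.stronglyMeasurableAtFilter hc.continuousAt

lemma continuous_innerTime (hY : Continuous Y) : Continuous (innerTime a Y) :=
  continuous_iff_continuousAt.2 fun t => (hasDerivAt_innerTime hY t).continuousAt

lemma strictMono_innerTime (hY : Continuous Y) : StrictMono (innerTime a Y) := by
  refine strictMono_of_deriv_pos fun t => ?_
  rw [(hasDerivAt_innerTime hY t).deriv]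
  exact _root_.inv_pos.2 (pow_pos (expFactor_pos t) 2)

lemma innerTime_nonneg (hY : Continuous Y) {t : ℝ} (ht : 0 ≤ t) : 0 ≤ innerTime a Y t := by
  rw [← innerTime_zero (a := a) (Y := Y)]
  exact (strictMono_innerTime hY).monotone ht

lemma innerTime_pos (hY : Continuous Y) {t : ℝ} (ht : 0 < t) : 0 < innerTime a Y t := by
  rw [← innerTime_zero (a := a) (Y := Y)]
  exact strictMono_innerTime hY ht

end Factors

lemma exists_continuous_extension {f : ℝ → ℝ} {τ : ℝ} (hτ : 0 ≤ τ)
    (hf : ContinuousOn f (Icc 0 τ)) : ∃ Y, Continuous Y ∧ EqOn Y f (Icc 0 τ) :=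
  ⟨IccExtend hτ ((Icc 0 τ).domRestrict f), hf.domRestrict.Icc_extend',
    fun _ ht => IccExtend_of_mem hτ _ ht⟩

/-! ### Fields along pathlines of a classical solution -/

namespace IsClassicalSolution

variable {lam T : ℝ} {γ₀ ω₀ : ℝ × ℝ → ℝ} {u : ℝ → ℝ × ℝ → ℝ × ℝ} {γ ω : ℝ → ℝ × ℝ → ℝ}

lemma hasDerivAt_pathline {τ : ℝ} {X : ℝ → ℝ × ℝ} (hX : IsPathlineOn τ u X) {t : ℝ}
    (ht : t ∈ Ioo 0 τ) : HasDerivAt X (u t (X t)) t :=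
  (hX t (Ioo_subset_Icc_self ht)).hasDerivAt (Icc_mem_nhds ht.1 ht.2)

lemma continuousOn_along {f : ℝ → ℝ × ℝ → ℝ}
    (hf : ContDiffOn ℝ 1 (fun z : ℝ × (ℝ × ℝ) => f z.1 z.2) (Ico 0 T ×ˢ univ)) {τ : ℝ}
    (hτ : τ < T) {X : ℝ → ℝ × ℝ} (hX : IsPathlineOn τ u X) :
    ContinuousOn (fun t => f t (X t)) (Icc 0 τ) :=
  hf.continuousOn.comp (f := fun t : ℝ => (t, X t)) (continuousOn_id.prodMk hX.continuousOn)
    fun _ ht => ⟨⟨ht.1, ht.2.trans_lt hτ⟩, mem_univ _⟩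

lemma hasDerivAt_stretch (hcl : IsClassicalSolution lam T γ₀ ω₀ u γ ω) {τ : ℝ} (hτ : τ < T)
    {X : ℝ → ℝ × ℝ} (hX : IsPathlineOn τ u X) {t : ℝ} (ht : t ∈ Ioo 0 τ) :
    HasDerivAt (fun s => γ s (X s))
      ((lam + 2) * torusAvg (fun q => γ t q ^ 2) - (lam + 1) * γ t (X t) ^ 2) t := by
  have ht' : t ∈ Ioo 0 T := ⟨ht.1, ht.2.trans hτ⟩
  refine (hasDerivAt_along hcl.smooth_γ ht' (hasDerivAt_pathline hX ht)).congr_deriv ?_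
  rw [hcl.γ_eq t ht' (X t)]
  ring

lemma hasDerivAt_vort (hcl : IsClassicalSolution lam T γ₀ ω₀ u γ ω) {τ : ℝ} (hτ : τ < T)
    {X : ℝ → ℝ × ℝ} (hX : IsPathlineOn τ u X) {t : ℝ} (ht : t ∈ Ioo 0 τ) :
    HasDerivAt (fun s => ω s (X s)) (γ t (X t) * ω t (X t)) t := by
  have ht' : t ∈ Ioo 0 T := ⟨ht.1, ht.2.trans hτ⟩
  refine (hasDerivAt_along hcl.smooth_ω ht' (hasDerivAt_pathline hX ht)).congr_deriv ?_
  rw [hcl.ω_eq t ht' (X t)]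

/-- The base pathline with a continuous extension `Y` of the stretching rate along it. -/
structure Base (τ : ℝ) (u : ℝ → ℝ × ℝ → ℝ × ℝ) (γ : ℝ → ℝ × ℝ → ℝ) (p₀ : ℝ × ℝ)
    (X : ℝ → ℝ × ℝ) (Y : ℝ → ℝ) : Prop where
  start : X 0 = p₀
  path : IsPathlineOn τ u X
  cont : Continuous Y
  eqOn : EqOn Y (fun t => γ t (X t)) (Icc 0 τ)

variable {τ : ℝ} {p₀ : ℝ × ℝ} {X : ℝ → ℝ × ℝ} {Y : ℝ → ℝ}

lemma Base.hasDerivAt (hB : Base τ u γ p₀ X Y) (hcl : IsClassicalSolution lam T γ₀ ω₀ u γ ω)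
    (hτ : τ < T) {t : ℝ} (ht : t ∈ Ioo 0 τ) : HasDerivAt Y
      ((lam + 2) * torusAvg (fun q => γ t q ^ 2) - (lam + 1) * Y t ^ 2) t := by
  have h1 := hcl.hasDerivAt_stretch hτ hB.path ht
  have e : Y t = γ t (X t) := hB.eqOn (Ioo_subset_Icc_self ht)
  rw [← e] at h1
  refine h1.congr_of_eventuallyEq ?_
  filter_upwards [Icc_mem_nhds ht.1 ht.2] with s hs using hB.eqOn hs

/-- The field whose power `-1/(λ+1)` is transported as a density. -/
def carrier (lam : ℝ) (γ : ℝ → ℝ × ℝ → ℝ) (Y : ℝ → ℝ) (τ₁ t : ℝ) (p : ℝ × ℝ) : ℝ :=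
  (lam + 1) * expFactor (lam + 1) Y t * (Y t - γ t p)
    * (innerTime (lam + 1) Y t - innerTime (lam + 1) Y τ₁) + (expFactor (lam + 1) Y t)⁻¹

lemma carrier_continuousOn (hcl : IsClassicalSolution lam T γ₀ ω₀ u γ ω) (hY : Continuous Y)
    (hτ : τ < T) (τ₁ : ℝ) :
    ContinuousOn (fun z : ℝ × (ℝ × ℝ) => carrier lam γ Y τ₁ z.1 z.2) (Icc 0 τ ×ˢ univ) := by
  have h1 : ContinuousOn (fun z : ℝ × (ℝ × ℝ) => γ z.1 z.2) (Icc 0 τ ×ˢ univ) :=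
    hcl.smooth_γ.continuousOn.mono
      (prod_mono_left fun t ht => ⟨ht.1, ht.2.trans_lt hτ⟩)
  have h2 := continuous_expFactor (a := lam + 1) hY
  have h3 := continuous_innerTime (a := lam + 1) hY
  have h4 : Continuous fun t => (expFactor (lam + 1) Y t)⁻¹ := h2.inv₀ fun t => (expFactor_pos t).ne'
  exact (((continuousOn_const.mul (h2.comp continuous_fst).continuousOn).mul
    ((hY.comp continuous_fst).continuousOn.sub h1)).mul
    ((h3.comp continuous_fst).continuousOn.sub continuousOn_const)).add
    (h4.comp continuous_fst).continuousOn

/-- The time derivative of the carrier, for a stretching rate moving by `c` in place of the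
material derivative. -/
lemma hasDerivAt_carrier_aux (hB : Base τ u γ p₀ X Y)
    (hcl : IsClassicalSolution lam T γ₀ ω₀ u γ ω) (hτ : τ < T) (τ₁ : ℝ) {t : ℝ} (ht : t ∈ Ioo 0 τ)
    {z : ℝ → ℝ} {c : ℝ} (hz : HasDerivAt z
      ((lam + 2) * torusAvg (fun q => γ t q ^ 2) - (lam + 1) * z t ^ 2 - c) t) :
    HasDerivAt (fun s => (lam + 1) * expFactor (lam + 1) Y s * (Y s - z s)
        * (innerTime (lam + 1) Y s - innerTime (lam + 1) Y τ₁) + (expFactor (lam + 1) Y s)⁻¹)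
      (-(lam + 1) * z t * ((lam + 1) * expFactor (lam + 1) Y t * (Y t - z t)
        * (innerTime (lam + 1) Y t - innerTime (lam + 1) Y τ₁) + (expFactor (lam + 1) Y t)⁻¹)
        + (lam + 1) * expFactor (lam + 1) Y t
          * (innerTime (lam + 1) Y t - innerTime (lam + 1) Y τ₁) * c) t := by
  have hφ := hasDerivAt_expFactor (a := lam + 1) hB.cont t
  have hR := hasDerivAt_innerTime (a := lam + 1) hB.cont t
  have hYd := hB.hasDerivAt hcl hτ ht
  have hp := (expFactor_pos (a := lam + 1) (Y := Y) t).ne'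
  refine ((((hφ.const_mul (lam + 1)).mul (hYd.sub hz)).mul (hR.sub_const _)).add
    (hφ.inv hp)).congr_deriv ?_
  simp only [Pi.mul_apply, Pi.sub_apply]
  field_simp
  ring

/-- Along the pathline through the given point the carrier N solves N' = -(λ+1)γN, so it keeps its
sign, and at t = τ₁ it equals 1/φ > 0. Positivity allows real powers of N to be differentiated. -/
lemma carrier_pos (hB : Base τ u γ p₀ X Y) (hcl : IsClassicalSolution lam T γ₀ ω₀ u γ ω)
    (hτ : τ < T) {τ₁ : ℝ} (hτ₁ : τ₁ ∈ Icc 0 τ) {t : ℝ} (ht : t ∈ Icc 0 τ) (p : ℝ × ℝ) :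
    0 < carrier lam γ Y τ₁ t p := by
  obtain ⟨Z, hZt, hZ⟩ := exists_isPathlineOn hcl.periodic_u hcl.smooth_u hτ ht p
  have hτ0 : 0 ≤ τ := ht.1.trans ht.2
  obtain ⟨W, hW, hWeq⟩ := exists_continuous_extension hτ0 (continuousOn_along hcl.smooth_γ hτ hZ)
  have hc : ContinuousOn (fun s => carrier lam γ Y τ₁ s (Z s)) (Icc 0 τ) :=
    (hcl.carrier_continuousOn hB.cont hτ τ₁).comp (f := fun s : ℝ => (s, Z s))
      (continuousOn_id.prodMk hZ.continuousOn) fun s hs => ⟨hs, mem_univ _⟩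
  have key := fun s hs => eq_mul_exp_of_hasDerivAt (g := fun s => -(lam + 1) * W s)
    (f := fun s => carrier lam γ Y τ₁ s (Z s)) (τ := τ) (by fun_prop) hc (fun s hs => by
      have h1 := hcl.hasDerivAt_stretch hτ hZ hs
      have h2 := hasDerivAt_carrier_aux hB hcl hτ τ₁ hs (z := fun s => γ s (Z s)) (c := 0)
        (h1.congr_deriv (by ring))
      rw [hWeq (Ioo_subset_Icc_self hs)]
      exact h2.congr_deriv (by simp only [carrier]; ring)) (t := s) hs
  have h1 := key τ₁ hτ₁
  have h2 := key t ht
  rw [hZt] at h2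
  have h3 : carrier lam γ Y τ₁ τ₁ (Z τ₁) = (expFactor (lam + 1) Y τ₁)⁻¹ := by
    simp [carrier]
  rw [h3] at h1
  have h4 : 0 < carrier lam γ Y τ₁ 0 (Z 0) := by
    have h5 := _root_.inv_pos.2 (expFactor_pos (a := lam + 1) (Y := Y) τ₁)
    rw [h1] at h5
    exact (pos_iff_pos_of_mul_pos h5).2 (Real.exp_pos _)
  rw [h2]
  positivity

/-- Conservation of the integral of the transported density. -/
lemma setIntegral_carrier (hB : Base τ u γ p₀ X Y)
    (hcl : IsClassicalSolution lam T γ₀ ω₀ u γ ω) (hl : 0 < lam + 1) (hτ : τ < T) {τ₁ : ℝ}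
    (hτ₁ : τ₁ ∈ Icc 0 τ) :
    ∫ p in cell, carrier lam γ Y τ₁ τ₁ p ^ (-(1 / (lam + 1)))
      = ∫ p in cell, carrier lam γ Y τ₁ 0 p ^ (-(1 / (lam + 1))) := by
  set φ := expFactor (lam + 1) Y with hφ
  set σ := fun t => innerTime (lam + 1) Y t - innerTime (lam + 1) Y τ₁ with hσ
  set N := carrier lam γ Y τ₁ with hN
  set q := 1 / (lam + 1) with hq
  have hqa : q * (lam + 1) = 1 := by rw [hq]; field_simp
  have hsub : Icc 0 τ₁ ⊆ Icc 0 τ := Icc_subset_Icc_right hτ₁.2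
  have hτ₁T : τ₁ < T := hτ₁.2.trans_lt hτ
  have hNpos : ∀ t ∈ Icc 0 τ₁, ∀ p, 0 < N t p := fun t ht p =>
    carrier_pos hB hcl hτ hτ₁ (hsub ht) p
  have hNc : ContinuousOn (fun z : ℝ × (ℝ × ℝ) => N z.1 z.2) (Icc 0 τ₁ ×ˢ univ) :=
    hcl.carrier_continuousOn hB.cont hτ₁T τ₁
  have hIoo : ∀ t ∈ Ioo 0 τ₁, t ∈ Ioo 0 T := fun t ht => ⟨ht.1, ht.2.trans hτ₁T⟩
  have hIoo' : Ioo (0 : ℝ) τ₁ ×ˢ (univ : Set (ℝ × ℝ)) ⊆ Ioo 0 T ×ˢ univ :=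
    prod_mono_left fun t ht => hIoo t ht
  have hIco' : Ioo (0 : ℝ) τ₁ ×ˢ (univ : Set (ℝ × ℝ)) ⊆ Ico 0 T ×ˢ univ :=
    prod_mono_left fun t ht => Ioo_subset_Ico_self (hIoo t ht)
  have hpow : ∀ e : ℝ, ContinuousOn (fun z : ℝ × (ℝ × ℝ) => N z.1 z.2 ^ e) (Icc 0 τ₁ ×ˢ univ) :=
    fun e => hNc.rpow_const fun z hz => Or.inl (hNpos z.1 hz.1 z.2).ne'
  have hu₁ : ContDiffOn ℝ 1 (fun z : ℝ × (ℝ × ℝ) => (u z.1 z.2).1) (Ico 0 T ×ˢ univ) :=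
    hcl.smooth_u.fst
  have hu₂ : ContDiffOn ℝ 1 (fun z : ℝ × (ℝ × ℝ) => (u z.1 z.2).2) (Ico 0 T ×ˢ univ) :=
    hcl.smooth_u.snd
  have hF'c : ContinuousOn (fun z : ℝ × (ℝ × ℝ) => γ z.1 z.2 * N z.1 z.2 ^ (-q)
      - N z.1 z.2 ^ (-q - 1) * φ z.1 * σ z.1
        * ((u z.1 z.2).1 * dx (γ z.1) z.2 + (u z.1 z.2).2 * dy (γ z.1) z.2))
      (Ioo 0 τ₁ ×ˢ univ) := by
    have c1 := (hpow (-q)).mono (prod_mono_left (t := (univ : Set (ℝ × ℝ))) Ioo_subset_Icc_self)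
    have c2 := (hpow (-q - 1)).mono
      (prod_mono_left (t := (univ : Set (ℝ × ℝ))) Ioo_subset_Icc_self)
    have c3 := hcl.smooth_γ.continuousOn.mono hIco'
    have c4 := (continuousOn_dx hcl.smooth_γ).mono hIoo'
    have c5 := (continuousOn_dy hcl.smooth_γ).mono hIoo'
    have c6 := hu₁.continuousOn.mono hIco'
    have c7 := hu₂.continuousOn.mono hIco'
    have c8 : Continuous φ := continuous_expFactor hB.cont
    have c9 : Continuous σ := (continuous_innerTime hB.cont).sub continuous_const
    exact (c3.mul c1).sub (((c2.mul (c8.comp continuous_fst).continuousOn).mul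
      (c9.comp continuous_fst).continuousOn).mul ((c6.mul c4).add (c7.mul c5)))
  -- The density n = N^(-q) satisfies ∂ₜn + u·∇n = γn = -(∇·u)n, so its time derivative is -∇·(un),
  -- of zero integral. The two goals are the formula for ∂ₜn and this divergence form.
  refine setIntegral_conserved hτ₁.1 (F := fun t p => N t p ^ (-q))
    (F' := fun t p => γ t p * N t p ^ (-q) - N t p ^ (-q - 1) * φ t * σ t
        * ((u t p).1 * dx (γ t) p + (u t p).2 * dy (γ t) p)) (hpow (-q)) ?_ hF'c ?_
  · intro t ht p
    have hγt := hasDerivAt_time hcl.smooth_γ (hIoo t ht) p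
    have heq := hcl.γ_eq t (hIoo t ht) p
    rw [hγt.deriv] at heq
    have hNd := hasDerivAt_carrier_aux hB hcl hτ τ₁ (t := t) ⟨ht.1, ht.2.trans_le hτ₁.2⟩
      (z := fun s => γ s p) (c := (u t p).1 * dx (γ t) p + (u t p).2 * dy (γ t) p)
      (hγt.congr_deriv (by linear_combination heq))
    have hNp := hNpos t (Ioo_subset_Icc_self ht) p
    refine (hNd.rpow_const (p := -q) (Or.inl hNp.ne')).congr_deriv ?_
    have e1 : N t p ^ (-q) = N t p ^ (-q - 1) * N t p := by
      rw [← Real.rpow_add_one hNp.ne']; congr 1; ring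
    rw [e1]
    change (-(lam + 1) * γ t p * N t p + (lam + 1) * φ t * σ t * _) * -q * N t p ^ (-q - 1) = _
    linear_combination (γ t p * N t p - φ t * σ t
      * ((u t p).1 * dx (γ t) p + (u t p).2 * dy (γ t) p)) * N t p ^ (-q - 1) * hqa
  · intro t ht
    have htT := hIoo t ht
    have htc := Ioo_subset_Icc_self ht
    have htco := Ioo_subset_Ico_self htT
    have hFd : ∀ p, HasFDerivAt (fun p => N t p ^ (-q))
        ((N t p ^ (-q - 1) * φ t * σ t) • fderiv ℝ (γ t) p) p := by
      intro p
      have h1 := (hasFDerivAt_slice hcl.smooth_γ htT p).differentiableAt.hasFDerivAt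
      have h2 : HasFDerivAt (N t) ((-((lam + 1) * φ t * σ t)) • fderiv ℝ (γ t) p) p := by
        have h3 := (((h1.const_sub (Y t)).const_mul ((lam + 1) * φ t)).mul_const (σ t)).add_const
          ((φ t)⁻¹)
        refine h3.congr_fderiv ?_
        ext <;> simp <;> ring
      refine (h2.rpow_const (p := -q) (Or.inl (hNpos t htc p).ne')).congr_fderiv ?_
      rw [smul_smul]
      congr 1
      linear_combination N t p ^ (-q - 1) * φ t * σ t * hqa
    have hd₁ : ∀ p, HasFDerivAt (fun p => (u t p).1) (fderiv ℝ (fun p => (u t p).1) p) p :=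
      fun p => (hasFDerivAt_slice (f := fun t p => (u t p).1) hu₁ htT p).differentiableAt.hasFDerivAt
    have hd₂ : ∀ p, HasFDerivAt (fun p => (u t p).2) (fderiv ℝ (fun p => (u t p).2) p) p :=
      fun p => (hasFDerivAt_slice (f := fun t p => (u t p).2) hu₂ htT p).differentiableAt.hasFDerivAt
    have hv₁ : ∀ p, HasFDerivAt (fun p => (u t p).1 * N t p ^ (-q))
        ((u t p).1 • ((N t p ^ (-q - 1) * φ t * σ t) • fderiv ℝ (γ t) p)
          + N t p ^ (-q) • fderiv ℝ (fun p => (u t p).1) p) p :=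
      fun p => (hd₁ p).mul (hFd p)
    have hv₂ : ∀ p, HasFDerivAt (fun p => (u t p).2 * N t p ^ (-q))
        ((u t p).2 • ((N t p ^ (-q - 1) * φ t * σ t) • fderiv ℝ (γ t) p)
          + N t p ^ (-q) • fderiv ℝ (fun p => (u t p).2) p) p :=
      fun p => (hd₂ p).mul (hFd p)
    have hNper : TorusPeriodic (N t) := (hcl.periodic_γ t htco).comp fun x =>
      (lam + 1) * φ t * (Y t - x) * σ t + (φ t)⁻¹
    have hdiv : ∀ p, dx (fun p => (u t p).1 * N t p ^ (-q)) p
        + dy (fun p => (u t p).2 * N t p ^ (-q)) p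
        = -(γ t p * N t p ^ (-q) - N t p ^ (-q - 1) * φ t * σ t
          * ((u t p).1 * dx (γ t) p + (u t p).2 * dy (γ t) p)) := by
      intro p
      have e1 : dx (fun p => (u t p).1 * N t p ^ (-q)) p
          = (u t p).1 * (N t p ^ (-q - 1) * φ t * σ t * dx (γ t) p)
            + N t p ^ (-q) * dx (fun p => (u t p).1) p := by
        rw [dx, HasFDerivAt.fderiv (hv₁ p)]; rfl
      have e2 : dy (fun p => (u t p).2 * N t p ^ (-q)) p
          = (u t p).2 * (N t p ^ (-q - 1) * φ t * σ t * dy (γ t) p)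
            + N t p ^ (-q) * dy (fun p => (u t p).2) p := by
        rw [dy, HasFDerivAt.fderiv (hv₂ p)]; rfl
      rw [e1, e2]
      linear_combination N t p ^ (-q) * hcl.div_eq t htT p
    have hcont : Continuous fun p => dx (fun p => (u t p).1 * N t p ^ (-q)) p
        + dy (fun p => (u t p).2 * N t p ^ (-q)) p := by
      simp only [hdiv]
      exact (continuousOn_univ.1 (hF'c.comp (f := fun p : ℝ × ℝ => (t, p)) (by fun_prop)
        fun p _ => ⟨ht, mem_univ _⟩)).neg
    have hzero := setIntegral_div_eq_zero (v₁ := fun p => (u t p).1 * N t p ^ (-q))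
      (v₂ := fun p => (u t p).2 * N t p ^ (-q))
      (fun p p' hp => by simp only [hcl.periodic_u t htco p p' hp, hNper p p' hp])
      (fun p p' hp => by simp only [hcl.periodic_u t htco p p' hp, hNper p p' hp])
      (fun p => (hv₁ p).differentiableAt) (fun p => (hv₂ p).differentiableAt) hcont
    simp only [hdiv] at hzero
    rwa [integral_neg, neg_eq_zero] at hzero

end IsClassicalSolution

/-! ### Solution formulae for classical solutions -/

namespace IsClassicalSolution

variable {lam T τ m A B C : ℝ} {γ₀ ω₀ h : ℝ × ℝ → ℝ} {u : ℝ → ℝ × ℝ → ℝ × ℝ}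
  {γ ω : ℝ → ℝ × ℝ → ℝ} {p₀ : ℝ × ℝ} {X : ℝ → ℝ × ℝ} {Y S : ℝ → ℝ}

lemma exists_base (hcl : IsClassicalSolution lam T γ₀ ω₀ u γ ω) (hτ0 : 0 ≤ τ) (hτ : τ < T)
    (p₀ : ℝ × ℝ) : ∃ X Y, Base τ u γ p₀ X Y := by
  obtain ⟨X, hX0, hX⟩ := exists_isPathlineOn hcl.periodic_u hcl.smooth_u hτ
    (left_mem_Icc.2 hτ0) p₀
  obtain ⟨Y, hY, hYeq⟩ := exists_continuous_extension hτ0 (continuousOn_along hcl.smooth_γ hτ hX)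
  exact ⟨X, Y, hX0, hX, hY, hYeq⟩

lemma Base.zero_eq (hB : Base τ u γ p₀ X Y) (hcl : IsClassicalSolution lam T γ₀ ω₀ u γ ω)
    (hτ0 : 0 ≤ τ) : Y 0 = γ₀ p₀ := by
  rw [hB.eqOn (left_mem_Icc.2 hτ0)]
  simp only [hB.start, hcl.init_γ]

section

variable (hd : WellData lam γ₀ h p₀ m A B C) (hcl : IsClassicalSolution lam T γ₀ ω₀ u γ ω)
  (hB : Base τ u γ p₀ X Y)

include hd hcl hB

/-- Conservation with τ₁ = t: the carrier is 1/φ(t) everywhere at time t and 1 + (λ+1)hR(t) at time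
0. Since R' = φ^(-2), this closes the equation for R. -/
lemma expFactor_rpow (hτ : τ < T) {t : ℝ} (ht : t ∈ Icc 0 τ) :
    expFactor (lam + 1) Y t ^ (1 / (lam + 1))
      = torusAvg fun p => (1 + (lam + 1) * h p * innerTime (lam + 1) Y t) ^ (-(1 / (lam + 1))) := by
  have key := setIntegral_carrier hB hcl hd.lam_pos hτ ht
  have e1 : ∀ p, carrier lam γ Y t t p ^ (-(1 / (lam + 1)))
      = expFactor (lam + 1) Y t ^ (1 / (lam + 1)) := by
    intro p
    have hp := expFactor_pos (a := lam + 1) (Y := Y) t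
    simp only [carrier, sub_self, mul_zero, zero_add]
    rw [Real.inv_rpow hp.le, Real.rpow_neg hp.le, inv_inv]
  have e2 : ∀ p, carrier lam γ Y t 0 p = 1 + (lam + 1) * h p * innerTime (lam + 1) Y t := by
    intro p
    simp only [carrier, hB.zero_eq hcl (ht.1.trans ht.2), hcl.init_γ, expFactor_zero,
      innerTime_zero, hd.eq_sub, hd.well.zero]
    ring
  simp only [e1, e2] at key
  rw [← torusAvg_const (expFactor (lam + 1) Y t ^ (1 / (lam + 1))), torusAvg, torusAvg, key]

lemma expFactor_eq (hτ : τ < T) {t : ℝ} (ht : t ∈ Icc 0 τ) (ht0 : 0 < t) :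
    expFactor (lam + 1) Y t = 1 / ((lam + 1) * innerTime (lam + 1) Y t)
      * powAvg h (1 / (lam + 1)) (1 / ((lam + 1) * innerTime (lam + 1) Y t)) ^ (lam + 1) := by
  have hl := hd.lam_pos
  have hR := innerTime_pos (a := lam + 1) hB.cont ht0
  have hp := expFactor_pos (a := lam + 1) (Y := Y) t
  have key := expFactor_rpow hd hcl hB hτ ht
  set R := innerTime (lam + 1) Y t
  have hδ : 0 < 1 / ((lam + 1) * R) := by positivity
  have e : ∀ p, (1 + (lam + 1) * h p * R) ^ (-(1 / (lam + 1)))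
      = (1 / ((lam + 1) * R)) ^ (1 / (lam + 1)) * (h p + 1 / ((lam + 1) * R)) ^ (-(1 / (lam + 1))) := by
    intro p
    have hn := hd.well.nonneg p
    have : 1 + (lam + 1) * h p * R = (1 / ((lam + 1) * R))⁻¹ * (h p + 1 / ((lam + 1) * R)) := by
      field_simp
      ring
    rw [this, Real.mul_rpow (by positivity) (by positivity), Real.inv_rpow hδ.le,
      Real.rpow_neg hδ.le, inv_inv]
  simp only [e] at key
  rw [torusAvg_const_mul] at key
  change _ = _ * powAvg h _ _ at key
  have hK := hd.powAvg_pos hδ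
  have h1 : (expFactor (lam + 1) Y t ^ (1 / (lam + 1))) ^ (lam + 1) = expFactor (lam + 1) Y t := by
    rw [← Real.rpow_mul hp.le, one_div_mul_cancel hl.ne', Real.rpow_one]
  rw [← h1, key, Real.mul_rpow (by positivity) hK.le, ← Real.rpow_mul hδ.le,
    one_div_mul_cancel hl.ne', Real.rpow_one]

/-- The map R ↦ R/(1 + (λ+1)mR) shifts 1/((λ+1)R) by m. It turns the equation for R, written with h,
into the one for S, written with γ₀ = h - m, and uniqueness applies. -/
lemma innerTime_eq_solution (hS : IsSolutionUpTo lam γ₀ T S) (hτ : τ < T) {t : ℝ}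
    (ht : t ∈ Ico 0 τ) :
    innerTime (lam + 1) Y t / (1 + (lam + 1) * m * innerTime (lam + 1) Y t) = S t := by
  have hl := hd.lam_pos
  have hm := hd.m_pos
  refine hd.solution_unique (T' := τ) (S' := fun t => innerTime (lam + 1) Y t
    / (1 + (lam + 1) * m * innerTime (lam + 1) Y t)) hS (by simp [innerTime_zero]) ?_ ?_ ?_
    ⟨ht.1, ht.2.trans hτ⟩ ht
  · intro s hs
    have hR := innerTime_nonneg (a := lam + 1) hB.cont hs.1
    have hRd := hasDerivAt_innerTime (a := lam + 1) hB.cont s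
    have hp := expFactor_pos (a := lam + 1) (Y := Y) s
    have key := expFactor_rpow hd hcl hB hτ ⟨hs.1, hs.2.le⟩
    have hden : 0 < 1 + (lam + 1) * m * innerTime (lam + 1) Y s := by positivity
    refine HasDerivAt.hasDerivWithinAt (((hRd.div ((hRd.const_mul ((lam + 1) * m)).const_add 1)
      hden.ne')).congr_deriv ?_)
    set R := innerTime (lam + 1) Y s
    set φ := expFactor (lam + 1) Y s
    have e : ∀ p, (1 + (lam + 1) * γ₀ p * (R / (1 + (lam + 1) * m * R))) ^ (-(1 / (lam + 1)))
        = (1 + (lam + 1) * m * R) ^ (1 / (lam + 1))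
          * (1 + (lam + 1) * h p * R) ^ (-(1 / (lam + 1))) := by
      intro p
      have hn := hd.well.nonneg p
      have : 1 + (lam + 1) * γ₀ p * (R / (1 + (lam + 1) * m * R))
          = (1 + (lam + 1) * m * R)⁻¹ * (1 + (lam + 1) * h p * R) := by
        rw [hd.eq_sub]
        field_simp
        ring
      rw [this, Real.mul_rpow (by positivity) (by positivity), Real.inv_rpow hden.le,
        Real.rpow_neg hden.le, inv_inv]
    have e2 : 1 / (lam + 1) * -(2 * (lam + 1)) = -2 := by field_simp
    simp only [sRate, e]
    rw [torusAvg_const_mul, ← key, ← Real.mul_rpow hden.le hp.le, ← Real.rpow_mul (by positivity),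
      e2, Real.rpow_neg (by positivity),
      Real.rpow_ofNat]
    field_simp
    ring
  · intro s hs
    have hR := innerTime_nonneg (a := lam + 1) hB.cont hs.1
    positivity
  · intro s hs
    have hR := innerTime_nonneg (a := lam + 1) hB.cont hs.1
    rw [hd.lt_sStar_iff, ← mul_div_assoc, div_lt_one (by positivity)]
    linarith

lemma innerTime_eq_gap (hS : IsSolutionUpTo lam γ₀ T S) (hτ : τ < T) {t : ℝ} (ht : t ∈ Ioo 0 τ) :
    1 / ((lam + 1) * innerTime (lam + 1) Y t) = gap lam m (S t) := by
  have hl := hd.lam_pos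
  have hm := hd.m_pos
  have hR := innerTime_pos (a := lam + 1) hB.cont ht.1
  rw [← innerTime_eq_solution hd hcl hB hS hτ (Ioo_subset_Ico_self ht), gap]
  field_simp
  ring

lemma expFactor_eq_gap (hS : IsSolutionUpTo lam γ₀ T S) (hτ : τ < T) {t : ℝ} (ht : t ∈ Ioo 0 τ) :
    expFactor (lam + 1) Y t
      = gap lam m (S t) * powAvg h (1 / (lam + 1)) (gap lam m (S t)) ^ (lam + 1) := by
  rw [expFactor_eq hd hcl hB hτ (Ioo_subset_Icc_self ht) ht.1,
    innerTime_eq_gap hd hcl hB hS hτ ht]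

/-- The stretching rate along the base pathline. -/
lemma base_eq (hS : IsSolutionUpTo lam γ₀ T S) (hτ : τ < T) {t : ℝ} (ht : t ∈ Ioo 0 τ) :
    Y t = stretchVal lam h 0 (gap lam m (S t)) := by
  have hl := hd.lam_pos
  have htT : t ∈ Ioo 0 T := ⟨ht.1, ht.2.trans hτ⟩
  have hδ := hd.solution_gap_pos hS htT
  have hδd := hd.hasDerivAt_gap_solution hS htT
  have hK := hd.powAvg_pos hδ
  have hKd := ((hd.well.hasDerivAt_powAvg hd.inv_pos.le hδ).comp t hδd).rpow_const
    (p := lam + 1) (Or.inl hK.ne')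
  have h1 := hδd.mul hKd
  have h2 := (hasDerivAt_expFactor (a := lam + 1) hB.cont t).congr_of_eventuallyEq
    (f₁ := fun t => gap lam m (S t) * powAvg h (1 / (lam + 1)) (gap lam m (S t)) ^ (lam + 1)) <| by
      filter_upwards [Ioo_mem_nhds ht.1 ht.2] with s hs
      exact (expFactor_eq_gap hd hcl hB hS hτ hs).symm
  -- Two computations of φ': it is (λ+1)Yφ by construction, and the product rule for φ = δK^(λ+1)
  -- gives it in terms of the averages.
  have h3 := h2.unique h1
  rw [expFactor_eq_gap hd hcl hB hS hτ ht] at h3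
  simp only [Function.comp_apply] at h3
  rw [Real.rpow_sub_one hK.ne'] at h3
  rw [stretchVal, zero_add]
  have hKa : 0 < powAvg h (1 / (lam + 1)) (gap lam m (S t)) ^ (lam + 1) := Real.rpow_pos_of_pos hK _
  generalize powAvg h (1 / (lam + 1)) (gap lam m (S t)) ^ (-(2 * (lam + 1))) = P at h3 ⊢
  generalize powAvg h (1 / (lam + 1)) (gap lam m (S t)) ^ (lam + 1) = Q at h3 hKa
  generalize powAvg h (1 / (lam + 1) + 1) (gap lam m (S t)) = L at h3 ⊢
  generalize powAvg h (1 / (lam + 1)) (gap lam m (S t)) = K at h3 hK ⊢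
  generalize gap lam m (S t) = δ at h3 hδ ⊢
  have h4 : (lam + 1) * δ * Q * K * Y t = (lam + 1) * δ * Q * K * (P * (L / K - 1 / δ)) := by
    field_simp at h3 ⊢
    linear_combination h3
  exact mul_left_cancel₀ (by positivity) h4

/-- Both γ along Z and Y solve the same Riccati equation y' = a(t) - (λ+1)y². The difference of the
two sides satisfies f' = -(λ+1)(γ - Y)f and vanishes at t = 0. -/
lemma stretch_sub_base (hτ : τ < T) {Z : ℝ → ℝ × ℝ} (hZ : IsPathlineOn τ u Z) {t : ℝ}
    (ht : t ∈ Icc 0 τ) :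
    (γ t (Z t) - Y t) * expFactor (lam + 1) Y t ^ 2
      * (1 + (lam + 1) * h (Z 0) * innerTime (lam + 1) Y t) = h (Z 0) := by
  have hτ0 : 0 ≤ τ := ht.1.trans ht.2
  obtain ⟨W, hW, hWeq⟩ := exists_continuous_extension hτ0 (continuousOn_along hcl.smooth_γ hτ hZ)
  have hφ := fun s => hasDerivAt_expFactor (a := lam + 1) hB.cont s
  have hR := fun s => hasDerivAt_innerTime (a := lam + 1) hB.cont s
  have hφc := continuous_expFactor (a := lam + 1) hB.cont
  have hRc := continuous_innerTime (a := lam + 1) hB.cont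
  have hY := hB.cont
  have key := eq_mul_exp_of_hasDerivAt (τ := τ) (g := fun s => -(lam + 1) * (W s - Y s))
    (f := fun s => (W s - Y s) * expFactor (lam + 1) Y s ^ 2
      * (1 + (lam + 1) * h (Z 0) * innerTime (lam + 1) Y s) - h (Z 0)) (by fun_prop)
    (by fun_prop) (fun s hs => by
      have hWd : HasDerivAt W ((lam + 2) * torusAvg (fun q => γ s q ^ 2) - (lam + 1) * W s ^ 2) s := by
        have e : W s = γ s (Z s) := hWeq (Ioo_subset_Icc_self hs)
        rw [e]
        refine (hcl.hasDerivAt_stretch hτ hZ hs).congr_of_eventuallyEq ?_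
        filter_upwards [Icc_mem_nhds hs.1 hs.2] with r hr using hWeq hr
      have hp := (expFactor_pos (a := lam + 1) (Y := Y) s).ne'
      refine ((((hWd.sub (hB.hasDerivAt hcl hτ hs)).mul ((hφ s).pow 2)).mul
        (((hR s).const_mul ((lam + 1) * h (Z 0))).const_add 1)).sub_const _).congr_deriv ?_
      simp only [Pi.mul_apply, Pi.sub_apply, Pi.pow_apply]
      field_simp
      ring) ht
  have e0 : W 0 - Y 0 = h (Z 0) := by
    rw [hB.zero_eq hcl hτ0, hWeq (left_mem_Icc.2 hτ0)]
    simp only [hcl.init_γ, hd.eq_sub, hd.well.zero]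
    ring
  have e1 : W t = γ t (Z t) := hWeq ht
  simp only [e0, expFactor_zero, innerTime_zero, mul_zero, add_zero, one_pow, mul_one, sub_self,
    zero_mul, e1] at key
  linarith

/-- Both ω and the power on the right solve f' = γf along the pathline. The latter has growth rate Y
+ h/(φ²(1 + (λ+1)hR)), which is γ by `stretch_sub_base`. -/
lemma vort_eq_mul_rpow (hτ : τ < T) {Z : ℝ → ℝ × ℝ} (hZ : IsPathlineOn τ u Z) {t : ℝ}
    (ht : t ∈ Icc 0 τ) :
    ω t (Z t) = ω₀ (Z 0) * (expFactor (lam + 1) Y t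
      * (1 + (lam + 1) * h (Z 0) * innerTime (lam + 1) Y t)) ^ (1 / (lam + 1)) := by
  have hl := hd.lam_pos
  have hn := hd.well.nonneg (Z 0)
  have hτ0 : 0 ≤ τ := ht.1.trans ht.2
  obtain ⟨W, hW, hWeq⟩ := exists_continuous_extension hτ0 (continuousOn_along hcl.smooth_γ hτ hZ)
  have hφ := fun s => hasDerivAt_expFactor (a := lam + 1) hB.cont s
  have hR := fun s => hasDerivAt_innerTime (a := lam + 1) hB.cont s
  have hφc := continuous_expFactor (a := lam + 1) hB.cont
  have hRc := continuous_innerTime (a := lam + 1) hB.cont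
  have hpos : ∀ s ∈ Icc 0 τ, 0 < expFactor (lam + 1) Y s
      * (1 + (lam + 1) * h (Z 0) * innerTime (lam + 1) Y s) := fun s hs => by
    have := innerTime_nonneg (a := lam + 1) hB.cont hs.1
    have := expFactor_pos (a := lam + 1) (Y := Y) s
    positivity
  have k1 := eq_mul_exp_of_hasDerivAt (τ := τ) (g := W) (f := fun s => ω s (Z s)) hW
    (continuousOn_along hcl.smooth_ω hτ hZ) (fun s hs => by
      rw [hWeq (Ioo_subset_Icc_self hs)]
      exact hcl.hasDerivAt_vort hτ hZ hs) ht
  have k2 := eq_mul_exp_of_hasDerivAt (τ := τ) (g := W) (f := fun s => (expFactor (lam + 1) Y s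
      * (1 + (lam + 1) * h (Z 0) * innerTime (lam + 1) Y s)) ^ (1 / (lam + 1))) hW
    (ContinuousOn.rpow_const (by fun_prop) fun s hs => Or.inl (hpos s hs).ne') (fun s hs => by
      have hs' := Ioo_subset_Icc_self hs
      have hp := hpos s hs'
      refine (((hφ s).mul (((hR s).const_mul ((lam + 1) * h (Z 0))).const_add 1)).rpow_const
        (p := 1 / (lam + 1)) (Or.inl hp.ne')).congr_deriv ?_
      have e := stretch_sub_base hd hcl hB hτ hZ hs'
      have eW : W s = γ s (Z s) := hWeq hs'
      have hφ0 := (expFactor_pos (a := lam + 1) (Y := Y) s).ne'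
      simp only [Pi.mul_apply]
      rw [eW, Real.rpow_sub_one hp.ne']
      generalize (expFactor (lam + 1) Y s
        * (1 + (lam + 1) * h (Z 0) * innerTime (lam + 1) Y s)) ^ (1 / (lam + 1)) = G
      have hp1 := hp.ne'
      have hp2 := right_ne_zero_of_mul hp1
      field_simp
      linear_combination (-G) * e) ht
  simp only [hcl.init_ω] at k1
  simp only [expFactor_zero, innerTime_zero, mul_zero, add_zero, mul_one, Real.one_rpow,
    one_mul] at k2
  rw [k1, k2]

end

/-- The solution formulae along pathlines of a classical solution. -/
theorem along_eq (hd : WellData lam γ₀ h p₀ m A B C)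
    (hcl : IsClassicalSolution lam T γ₀ ω₀ u γ ω) (hS : IsSolutionUpTo lam γ₀ T S) (hτ : τ < T)
    {Z : ℝ → ℝ × ℝ} (hZ : IsPathlineOn τ u Z) {t : ℝ} (ht : t ∈ Ioo 0 τ) :
    γ t (Z t) = stretchVal lam h (h (Z 0)) (gap lam m (S t)) ∧
      ω t (Z t) = ω₀ (Z 0) * vortVal lam h (h (Z 0)) (gap lam m (S t)) := by
  obtain ⟨X, Y, hB⟩ := hcl.exists_base (ht.1.trans ht.2).le hτ p₀
  have hl := hd.lam_pos
  have htT : t ∈ Ioo 0 T := ⟨ht.1, ht.2.trans hτ⟩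
  have ht' := Ioo_subset_Icc_self ht
  have hn := hd.well.nonneg (Z 0)
  have hδ := hd.solution_gap_pos hS htT
  have hK := hd.powAvg_pos hδ
  have hR := innerTime_pos (a := lam + 1) hB.cont ht.1
  have e1 := innerTime_eq_gap hd hcl hB hS hτ ht
  have e2 := expFactor_eq_gap hd hcl hB hS hτ ht
  have e3 := stretch_sub_base hd hcl hB hτ hZ ht'
  have e4 := base_eq hd hcl hB hS hτ ht
  have hKa : 0 < powAvg h (1 / (lam + 1)) (gap lam m (S t)) ^ (lam + 1) := Real.rpow_pos_of_pos hK _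
  have eR : 1 + (lam + 1) * h (Z 0) * innerTime (lam + 1) Y t
      = (h (Z 0) + gap lam m (S t)) / gap lam m (S t) := by
    rw [← e1]
    field_simp
    ring
  constructor
  · have eP : powAvg h (1 / (lam + 1)) (gap lam m (S t)) ^ (-(2 * (lam + 1)))
        = ((powAvg h (1 / (lam + 1)) (gap lam m (S t)) ^ (lam + 1)) ^ 2)⁻¹ := by
      rw [Real.rpow_neg hK.le, mul_comm, Real.rpow_mul hK.le, Real.rpow_ofNat]
    rw [eR, e2, e4] at e3
    simp only [stretchVal, zero_add, eP] at e3 ⊢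
    generalize powAvg h (1 / (lam + 1)) (gap lam m (S t)) ^ (lam + 1) = Q at e3 hKa ⊢
    generalize powAvg h (1 / (lam + 1) + 1) (gap lam m (S t)) / powAvg h (1 / (lam + 1))
      (gap lam m (S t)) = L at e3 ⊢
    generalize gap lam m (S t) = δ at e3 hδ ⊢
    generalize h (Z 0) = x at e3 hn ⊢
    have hx : 0 < x + δ := by linarith
    field_simp at e3 ⊢
    refine mul_left_cancel₀ hδ.ne' ?_
    linear_combination e3
  · rw [vort_eq_mul_rpow hd hcl hB hτ hZ ht', eR, e2, vortVal]
    have e5 : gap lam m (S t) * powAvg h (1 / (lam + 1)) (gap lam m (S t)) ^ (lam + 1)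
        * ((h (Z 0) + gap lam m (S t)) / gap lam m (S t))
        = (h (Z 0) + gap lam m (S t)) * powAvg h (1 / (lam + 1)) (gap lam m (S t)) ^ (lam + 1) := by
      field_simp
    rw [e5, Real.mul_rpow (by positivity) hKa.le, ← Real.rpow_mul hK.le,
      mul_one_div_cancel hl.ne', Real.rpow_one]

end IsClassicalSolution

/-- The solution formulae for the fields, in terms of the elevation `h` of the starting point and of
the gap to the critical value. -/
structure FollowsFormulae (lam T m : ℝ) (γ₀ ω₀ h : ℝ × ℝ → ℝ) (S : ℝ → ℝ)
    (u : ℝ → ℝ × ℝ → ℝ × ℝ) (γ ω : ℝ → ℝ × ℝ → ℝ) : Prop where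
  init_γ : γ 0 = γ₀
  init_ω : ω 0 = ω₀
  stretch_eq : ∀ x₀ X, IsPathline T u x₀ X → ∀ t ∈ Ioo 0 T,
    γ t (X t) = stretchVal lam h (h x₀) (gap lam m (S t))
  vort_eq : ∀ x₀ X, IsPathline T u x₀ X → ∀ t ∈ Ioo 0 T,
    ω t (X t) = ω₀ x₀ * vortVal lam h (h x₀) (gap lam m (S t))
  range_eq : ∀ t ∈ Ioo 0 T,
    range (γ t) = range fun x₀ => stretchVal lam h (h x₀) (gap lam m (S t))

variable {lam T m A B C : ℝ} {γ₀ ω₀ h : ℝ × ℝ → ℝ} {u : ℝ → ℝ × ℝ → ℝ × ℝ}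
  {γ ω : ℝ → ℝ × ℝ → ℝ} {p₀ : ℝ × ℝ} {S : ℝ → ℝ}

lemma IsClassicalSolution.followsFormulae (hcl : IsClassicalSolution lam T γ₀ ω₀ u γ ω)
    (hd : WellData lam γ₀ h p₀ m A B C) (hS : IsSolutionUpTo lam γ₀ T S) :
    FollowsFormulae lam T m γ₀ ω₀ h S u γ ω := by
  -- Pathlines are constructed on closed intervals [0, τ] with τ < T; the midpoint of t and T serves
  -- as τ.
  have hmid : ∀ t ∈ Ioo 0 T, t ∈ Ioo 0 ((t + T) / 2) ∧ (t + T) / 2 < T := fun t ht =>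
    ⟨⟨ht.1, by linarith [ht.2]⟩, by linarith [ht.2]⟩
  refine ⟨hcl.init_γ, hcl.init_ω, fun x₀ X hX t ht => ?_, fun x₀ X hX t ht => ?_, fun t ht => ?_⟩
  · have := (along_eq hd hcl hS (hmid t ht).2 (hX.isPathlineOn (hmid t ht).2) (hmid t ht).1).1
    rwa [hX.start] at this
  · have := (along_eq hd hcl hS (hmid t ht).2 (hX.isPathlineOn (hmid t ht).2) (hmid t ht).1).2
    rwa [hX.start] at this
  · obtain ⟨ht', hτ⟩ := hmid t ht
    apply Subset.antisymm
    · rintro _ ⟨p, rfl⟩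
      obtain ⟨Z, hZt, hZ⟩ := exists_isPathlineOn hcl.periodic_u hcl.smooth_u hτ
        (Ioo_subset_Icc_self ht') p
      exact ⟨Z 0, by rw [← hZt]; exact (along_eq hd hcl hS hτ hZ ht').1.symm⟩
    · rintro _ ⟨x₀, rfl⟩
      obtain ⟨Z, hZ0, hZ⟩ := exists_isPathlineOn hcl.periodic_u hcl.smooth_u hτ
        (left_mem_Icc.2 (ht'.1.trans ht'.2).le) x₀
      exact ⟨Z t, by rw [← hZ0]; exact (along_eq hd hcl hS hτ hZ ht').1⟩

/-! ### Derivatives of S and the formulae for generalized solutions -/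

namespace WellData

lemma deriv_solution (hd : WellData lam γ₀ h p₀ m A B C) (hS : IsSolutionUpTo lam γ₀ T S) {t : ℝ}
    (ht : t ∈ Ioo 0 T) : deriv S t = ((lam + 1) * S t) ^ 2
      * powAvg h (1 / (lam + 1)) (gap lam m (S t)) ^ (-(2 * (lam + 1))) := by
  rw [(solution_hasDerivAt hS ht).deriv, hd.sRate_eq (hd.solution_pos hS ht)
    (hS.before t (Ioo_subset_Ico_self ht))]

/-- The logarithmic derivative of `S'`. -/
lemma deriv_deriv_solution_div (hd : WellData lam γ₀ h p₀ m A B C)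
    (hS : IsSolutionUpTo lam γ₀ T S) {t : ℝ} (ht : t ∈ Ioo 0 T) :
    1 / (2 * (lam + 1)) * (deriv (deriv S) t / deriv S t)
      = powAvg h (1 / (lam + 1)) (gap lam m (S t)) ^ (-(2 * (lam + 1)))
        * ((lam + 1) * S t - powAvg h (1 / (lam + 1) + 1) (gap lam m (S t))
          / powAvg h (1 / (lam + 1)) (gap lam m (S t))) := by
  have hl := hd.lam_pos
  have hs := hd.solution_pos hS ht
  have hδ := hd.solution_gap_pos hS ht
  have hK := hd.powAvg_pos hδ
  have h1 := solution_hasDerivAt hS ht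
  have h2 := ((hd.well.hasDerivAt_powAvg hd.inv_pos.le hδ).comp t
    (hd.hasDerivAt_gap_solution hS ht)).rpow_const (p := -(2 * (lam + 1))) (Or.inl hK.ne')
  have h3 := ((h1.const_mul (lam + 1)).pow 2).mul h2
  have h4 := h3.congr_of_eventuallyEq (f₁ := deriv S) <| by
    filter_upwards [Ioo_mem_nhds ht.1 ht.2] with s hs using hd.deriv_solution hS hs
  rw [h4.deriv, ← h1.deriv, hd.deriv_solution hS ht]
  simp only [Pi.pow_apply, Function.comp_apply]
  rw [Real.rpow_sub_one hK.ne']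
  have hP : 0 < powAvg h (1 / (lam + 1)) (gap lam m (S t)) ^ (-(2 * (lam + 1))) :=
    Real.rpow_pos_of_pos hK _
  generalize powAvg h (1 / (lam + 1)) (gap lam m (S t)) ^ (-(2 * (lam + 1))) = P at hP ⊢
  generalize powAvg h (1 / (lam + 1) + 1) (gap lam m (S t)) = L
  generalize powAvg h (1 / (lam + 1)) (gap lam m (S t)) = K at hK ⊢
  generalize S t = s at hs ⊢
  field_simp
  ring

end WellData

lemma IsGeneralizedSolution.followsFormulae (hg : IsGeneralizedSolution lam T γ₀ ω₀ u γ ω)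
    (hd : WellData lam γ₀ h p₀ m A B C) :
    ∃ S, IsSolutionUpTo lam γ₀ T S ∧ FollowsFormulae lam T m γ₀ ω₀ h S u γ ω := by
  obtain ⟨S, hS, hal⟩ := hg.along
  have hl := hd.lam_pos
  have hstretch : ∀ x₀ X, IsPathline T u x₀ X → ∀ t ∈ Ioo 0 T,
      γ t (X t) = stretchVal lam h (h x₀) (gap lam m (S t)) := by
    intro x₀ X hX t ht
    have hs := hd.solution_pos hS ht
    have hδ := hd.solution_gap_pos hS ht
    have hn := hd.well.nonneg x₀
    have hx : 0 < h x₀ + gap lam m (S t) := by linarith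
    have e := hd.one_add_eq hs x₀
    rw [(hal x₀ X hX t ht).1, hd.deriv_deriv_solution_div hS ht, hd.deriv_solution hS ht, e,
      stretchVal]
    -- The first term of the formula becomes P((λ+1)S - 1/y) with y = h + δ; its part P(λ+1)S
    -- cancels against the one contributed by S''/S'.
    have e' : (lam + 1) * γ₀ x₀ * S t = (lam + 1) * S t * (h x₀ + gap lam m (S t)) - 1 := by
      linarith
    generalize powAvg h (1 / (lam + 1) + 1) (gap lam m (S t)) / powAvg h (1 / (lam + 1))
      (gap lam m (S t)) = L
    generalize powAvg h (1 / (lam + 1)) (gap lam m (S t)) ^ (-(2 * (lam + 1))) = P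
    generalize h x₀ + gap lam m (S t) = y at hx e' ⊢
    field_simp
    linear_combination P * e'
  refine ⟨S, hS, hg.init_γ, hg.init_ω, hstretch, fun x₀ X hX t ht => ?_, fun t ht => ?_⟩
  · have hs := hd.solution_pos hS ht
    have hδ := hd.solution_gap_pos hS ht
    have hn := hd.well.nonneg x₀
    have hx : 0 < h x₀ + gap lam m (S t) := by linarith
    have hK := hd.powAvg_pos hδ
    have hKa : 0 < powAvg h (1 / (lam + 1)) (gap lam m (S t)) ^ (lam + 1) :=
      Real.rpow_pos_of_pos hK _
    have eS : deriv S t ^ (1 / 2 : ℝ)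
        = (lam + 1) * S t / powAvg h (1 / (lam + 1)) (gap lam m (S t)) ^ (lam + 1) := by
      rw [hd.deriv_solution hS ht, Real.rpow_neg hK.le, mul_comm 2, Real.rpow_mul hK.le,
        Real.rpow_ofNat, ← div_eq_mul_inv, ← div_pow, ← Real.sqrt_eq_rpow,
        Real.sqrt_sq (by positivity)]
    rw [(hal x₀ X hX t ht).2, hd.one_add_eq hs x₀, eS, vortVal]
    have e2 : (lam + 1) * S t * (h x₀ + gap lam m (S t))
        / ((lam + 1) * S t / powAvg h (1 / (lam + 1)) (gap lam m (S t)) ^ (lam + 1))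
        = (h x₀ + gap lam m (S t)) * powAvg h (1 / (lam + 1)) (gap lam m (S t)) ^ (lam + 1) := by
      field_simp
    rw [e2, Real.mul_rpow hx.le hKa.le, ← Real.rpow_mul hK.le, mul_one_div_cancel hl.ne',
      Real.rpow_one]
  · apply Subset.antisymm
    · rintro _ ⟨p, rfl⟩
      obtain ⟨x₀, X, hX, rfl⟩ := hg.pathlines_fill t (Ioo_subset_Ico_self ht) p
      exact ⟨x₀, (hstretch x₀ X hX t ht).symm⟩
    · rintro _ ⟨x₀, rfl⟩
      obtain ⟨X, hX⟩ := hg.exists_pathline x₀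
      exact ⟨X t, hstretch x₀ X hX t ht⟩

/-! ### Extremal values -/

namespace FollowsFormulae

lemma isLeast (hf : FollowsFormulae lam T m γ₀ ω₀ h S u γ ω) (hd : WellData lam γ₀ h p₀ m A B C)
    (hS : IsSolutionUpTo lam γ₀ T S) {t : ℝ} (ht : t ∈ Ioo 0 T) :
    IsLeast (range (γ t)) (stretchVal lam h 0 (gap lam m (S t))) := by
  rw [hf.range_eq t ht]
  refine ⟨⟨p₀, by simp only [hd.well.zero]⟩, ?_⟩
  rintro _ ⟨p, rfl⟩
  exact hd.stretchVal_mono (hd.solution_gap_pos hS ht) le_rfl (hd.well.nonneg p)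

lemma isGreatest (hf : FollowsFormulae lam T m γ₀ ω₀ h S u γ ω)
    (hd : WellData lam γ₀ h p₀ m A B C) (hS : IsSolutionUpTo lam γ₀ T S) {p₁ : ℝ × ℝ}
    (hp₁ : ∀ p, h p ≤ h p₁) {t : ℝ} (ht : t ∈ Ioo 0 T) :
    IsGreatest (range (γ t)) (stretchVal lam h (h p₁) (gap lam m (S t))) := by
  rw [hf.range_eq t ht]
  refine ⟨⟨p₁, rfl⟩, ?_⟩
  rintro _ ⟨p, rfl⟩
  exact hd.stretchVal_mono (hd.solution_gap_pos hS ht) (hd.well.nonneg p) (hp₁ p)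

end FollowsFormulae

/-- Zero mean forces γ₋ < 0: otherwise γ₀ ≥ 0 would vanish almost everywhere on the cell, although
it exceeds its minimum almost everywhere. -/
lemma wellData_of_isGenericType {pmin pmax : ℝ × ℝ} (hlam : -(1 / 2) < lam)
    (hγ₀ : IsInitialStretching γ₀) (hgen : IsGenericType γ₀ pmin pmax)
    (hsep : WellSeparatedMin γ₀ pmin) :
    ∃ A B C, WellData lam γ₀ (fun p => γ₀ p - γ₀ pmin) pmin (-γ₀ pmin) A B C ∧
      A * C - B ^ 2 = (hessian γ₀ pmin).det := by
  obtain ⟨A, B, C, hw, hdet⟩ := quadraticWell_of_isGenericType hγ₀ hgen hsep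
  refine ⟨A, B, C, ⟨hlam, ?_, hw, fun p => by ring⟩, hdet⟩
  by_contra! hneg
  have hnn : ∀ p, 0 ≤ γ₀ p := fun p => by linarith [hgen.min_le p]
  obtain ⟨c, hc⟩ := hγ₀.bounded
  have hint : IntegrableOn γ₀ cell :=
    Measure.integrableOn_of_bounded (M := c) volume_cell_lt_top.ne
      hγ₀.measurable.aestronglyMeasurable (ae_of_all _ hc)
  have h0 : ∫ p in cell, γ₀ p = 0 := by
    have := hγ₀.mean_zero
    rw [torusAvg] at this
    exact (mul_eq_zero.1 this).resolve_left (_root_.inv_pos.2 four_pi_sq_pos).ne'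
  have hae := (integral_eq_zero_iff_of_nonneg hnn hint).1 h0
  have hne : (ae (volume.restrict cell)).NeBot := by
    rw [ae_neBot, Ne, Measure.restrict_eq_zero, volume_cell]
    simp
  obtain ⟨p, hp0, hp1⟩ := (hae.and (ae_restrict_of_ae hw.ae_pos)).exists
  simp only [Pi.zero_apply] at hp0
  linarith

end Stagnation

end

/-! ### Assembly of the theorem -/

theorem mainTheorem1 (lam : ℝ) (hlam : -(1 / 2) < lam)
    (γ₀ ω₀ : ℝ × ℝ → ℝ) (pmin pmax : ℝ × ℝ)
    (hγ₀ : Stagnation.IsInitialStretching γ₀)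
    (hgen : Stagnation.IsGenericType γ₀ pmin pmax)
    (hsep : Stagnation.WellSeparatedMin γ₀ pmin)
    (Δ S M : ℝ)
    (hΔ : Δ = (Stagnation.hessian γ₀ pmin).det)
    (hS : S = Stagnation.sStar lam γ₀)
    (hM : M = Stagnation.torusAvg (fun p => (γ₀ p + |γ₀ pmin|) ^ (-(1 / (lam + 1))))) :
    (∃! T, Stagnation.IsSingularityTime lam γ₀ T) ∧
    (0 < lam →
      IntegrableOn (fun p => (γ₀ p + |γ₀ pmin|) ^ (-(1 / (lam + 1)))) Stagnation.cell volume) ∧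
    ∀ T, Stagnation.IsSingularityTime lam γ₀ T →
    ∀ (u : ℝ → ℝ × ℝ → ℝ × ℝ) (γ ω : ℝ → ℝ × ℝ → ℝ),
    (Stagnation.IsClassicalSolution lam T γ₀ ω₀ u γ ω ∨
      Stagnation.IsGeneralizedSolution lam T γ₀ ω₀ u γ ω) →
    -- (i) the infimum, attained along the pathline from the minimum
    (Asymptotics.IsEquivalent (𝓝[<] T) (fun t => ⨅ p, γ t p) (Stagnation.infRate lam T) ∧
      ∀ X, Stagnation.IsPathline T u pmin X →
        (∀ t ∈ Ico 0 T, IsLeast (range (γ t)) (γ t (X t))) ∧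
        Asymptotics.IsEquivalent (𝓝[<] T) (fun t => γ t (X t)) (Stagnation.infRate lam T)) ∧
    -- (ii) the supremum, attained along the pathline from the maximum
    (Asymptotics.IsEquivalent (𝓝[<] T) (fun t => ⨆ p, γ t p)
        (Stagnation.supRate lam S Δ M T) ∧
      ∀ X, Stagnation.IsPathline T u pmax X →
        (∀ t ∈ Ico 0 T, IsGreatest (range (γ t)) (γ t (X t))) ∧
        Asymptotics.IsEquivalent (𝓝[<] T) (fun t => γ t (X t))
          (Stagnation.supRate lam S Δ M T)) ∧
    -- (iii) the stretching rate along all other pathlines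
    (∀ x₀, ¬ Stagnation.SamePoint pmin x₀ → ¬ Stagnation.SamePoint pmax x₀ →
      ∀ X, Stagnation.IsPathline T u x₀ X →
        Asymptotics.IsEquivalent (𝓝[<] T) (fun t => γ t (X t))
          (Stagnation.supRate lam S Δ M T)) ∧
    -- (iv) the vorticity along the pathline from the minimum
    (∀ X, Stagnation.IsPathline T u pmin X →
      Tendsto (fun t => ω t (X t)) (𝓝[<] T) (𝓝 0) ∧
      Asymptotics.IsEquivalent (𝓝[<] T) (fun t => ω t (X t))
        (fun t => ω₀ pmin * Stagnation.vortMinRate lam S Δ M T t)) ∧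
    -- (iv, continued) the vorticity along all other pathlines
    (∀ x₀, ¬ Stagnation.SamePoint pmin x₀ → ∀ X, Stagnation.IsPathline T u x₀ X →
      (0 < lam → ∃ C, ∀ t ∈ Ico 0 T, |ω t (X t)| ≤ C) ∧
      (lam ≤ 0 →
        (ω₀ x₀ ≠ 0 → Tendsto (fun t => |ω t (X t)|) (𝓝[<] T) atTop) ∧
        Asymptotics.IsEquivalent (𝓝[<] T) (fun t => ω t (X t))
          (fun t => ω₀ x₀ * Stagnation.vortOtherRate lam S Δ (|γ₀ pmin| + γ₀ x₀) T t))) := by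
  obtain ⟨A, B, C, hd, hdet⟩ := Stagnation.wellData_of_isGenericType hlam hγ₀ hgen hsep
  have habs : |γ₀ pmin| = -γ₀ pmin := abs_of_neg (by linarith [hd.m_pos])
  have hl := hd.lam_pos
  set h : ℝ × ℝ → ℝ := fun p => γ₀ p - γ₀ pmin with hh
  have hadd : ∀ p, γ₀ p + |γ₀ pmin| = h p := fun p => by rw [habs, ← sub_eq_add_neg]
  simp only [hadd] at hM ⊢
  refine ⟨hd.existsUnique_singularityTime, fun h0 => hd.well.integrableOn_rpow_neg hd.inv_pos
    (by rw [div_lt_one hl]; linarith), ?_⟩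
  intro T hT u γ ω hsol
  obtain ⟨σ, hσ, hf⟩ : ∃ σ, Stagnation.IsSolutionUpTo lam γ₀ T σ ∧
      Stagnation.FollowsFormulae lam T (-γ₀ pmin) γ₀ ω₀ h σ u γ ω := by
    rcases hsol with hcl | hg
    · obtain ⟨σ, hσ⟩ := hT
      exact ⟨σ, hσ, hcl.followsFormulae hd hσ⟩
    · exact hg.followsFormulae hd
  have hev : ∀ᶠ t in 𝓝[<] T, t ∈ Ioo 0 T := Ioo_mem_nhdsLT hσ.pos
  have hgap := hd.tendsto_gap_solution hσ
  have hmax : ∀ p, h p ≤ h pmax := fun p => sub_le_sub_right (hgen.le_max p) _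
  -- Positive elevation of the maximum places the supremum under the same asymptotics as every
  -- pathline not starting at the minimum.
  have hmax_pos : 0 < h pmax := by
    obtain ⟨p, hp⟩ := hd.well.ae_pos.exists
    exact hp.trans_le (hmax p)
  have hpos : ∀ x₀, ¬ Stagnation.SamePoint pmin x₀ → 0 < h x₀ := fun x₀ hx =>
    (hd.well.nonneg x₀).lt_of_ne fun h0 => hx (hd.well.eq_zero x₀ h0.symm)
  have hsup : ∀ x, 0 < x → Asymptotics.IsEquivalent (𝓝[<] T)
      (fun t => Stagnation.stretchVal lam h x (Stagnation.gap lam (-γ₀ pmin) (σ t)))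
      (Stagnation.supRate lam S Δ M T) := fun x hx => by
    rw [hS, hΔ, hM, ← hdet]
    exact hd.stretchVal_pos_equiv hσ hx
  have halong : ∀ x₀ X, Stagnation.IsPathline T u x₀ X → 0 < h x₀ →
      Asymptotics.IsEquivalent (𝓝[<] T) (fun t => γ t (X t)) (Stagnation.supRate lam S Δ M T) :=
    fun x₀ X hX hx => (hsup _ hx).congr_left (hev.mono fun t ht => (hf.stretch_eq x₀ X hX t ht).symm)
  refine ⟨⟨?_, fun X hX => ⟨?_, ?_⟩⟩, ⟨?_, fun X hX => ⟨?_, halong pmax X hX hmax_pos⟩⟩,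
    fun x₀ hx _ X hX => halong x₀ X hX (hpos x₀ hx), fun X hX => ?_, fun x₀ hx X hX => ?_⟩
  · exact (hd.stretchVal_zero_equiv hσ).congr_left
      (hev.mono fun t ht => (hf.isLeast hd hσ ht).csInf_eq.symm)
  · intro t ht
    rcases ht.1.eq_or_lt with rfl | h0
    · rw [hX.start, hf.init_γ]
      exact ⟨mem_range_self _, forall_mem_range.2 hgen.min_le⟩
    · have ht' : t ∈ Ioo 0 T := ⟨h0, ht.2⟩
      rw [hf.stretch_eq _ X hX t ht', hd.well.zero]
      exact hf.isLeast hd hσ ht'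
  · refine (hd.stretchVal_zero_equiv hσ).congr_left (hev.mono fun t ht => ?_)
    change _ = γ t (X t)
    rw [hf.stretch_eq _ X hX t ht, hd.well.zero]
  · exact (hsup _ hmax_pos).congr_left
      (hev.mono fun t ht => (hf.isGreatest hd hσ hmax ht).csSup_eq.symm)
  · intro t ht
    rcases ht.1.eq_or_lt with rfl | h0
    · rw [hX.start, hf.init_γ]
      exact ⟨mem_range_self _, forall_mem_range.2 hgen.le_max⟩
    · have ht' : t ∈ Ioo 0 T := ⟨h0, ht.2⟩
      rw [hf.stretch_eq _ X hX t ht']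
      exact hf.isGreatest hd hσ hmax ht'
  · have he : ∀ᶠ t in 𝓝[<] T, ω₀ pmin * Stagnation.vortVal lam h 0
        (Stagnation.gap lam (-γ₀ pmin) (σ t)) = ω t (X t) := hev.mono fun t ht => by
      rw [hf.vort_eq _ X hX t ht, hd.well.zero]
    constructor
    · have h1 := (hd.tendsto_vortVal_zero.comp hgap).const_mul (ω₀ pmin)
      rw [mul_zero] at h1
      exact h1.congr' he
    · rw [hS, hΔ, hM, ← hdet]
      exact (Asymptotics.IsEquivalent.refl.mul (hd.vortVal_zero_equiv hσ)).congr_left he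
  · have hx0 := hpos x₀ hx
    have he : ∀ᶠ t in 𝓝[<] T, ω₀ x₀ * Stagnation.vortVal lam h (h x₀)
        (Stagnation.gap lam (-γ₀ pmin) (σ t)) = ω t (X t) := hev.mono fun t ht =>
      (hf.vort_eq _ X hX t ht).symm
    refine ⟨fun h0 => ?_, fun hle => ⟨fun hω => ?_, ?_⟩⟩
    · obtain ⟨c, hc⟩ := hd.exists_vortVal_le h0 hx0.le
      refine ⟨max |ω₀ x₀| (|ω₀ x₀| * c), fun t ht => ?_⟩
      rcases ht.1.eq_or_lt with rfl | ht0
      · rw [hX.start, hf.init_ω]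
        exact le_max_left _ _
      · have ht' : t ∈ Ioo 0 T := ⟨ht0, ht.2⟩
        have hδ := hd.solution_gap_pos hσ ht'
        rw [hf.vort_eq _ X hX t ht', abs_mul, abs_of_nonneg (hd.vortVal_nonneg hx0.le hδ)]
        exact (mul_le_mul_of_nonneg_left (hc _ hδ) (abs_nonneg _)).trans (le_max_right _ _)
    · have h1 := ((hd.tendsto_vortVal_atTop hle hx0).comp hgap).const_mul_atTop (abs_pos.2 hω)
      refine h1.congr' ?_
      filter_upwards [he, hev] with t ht ht'
      rw [← ht, abs_mul, abs_of_nonneg (hd.vortVal_nonneg hx0.le (hd.solution_gap_pos hσ ht'))]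
      rfl
    · rw [hS, hΔ, ← hdet, add_comm, hadd]
      exact (Asymptotics.IsEquivalent.refl.mul (hd.vortVal_pos_equiv hσ hle hx0)).congr_left he
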